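/- Let $d\ge 1$, $a_1,\dots,a_d>0$, and let $\xi_1,\dots,\xi_d$ be random vectors in $\mathbb Z^d$. Let $(X(t))_{t\ge 0}$ be the multi-type continuous-time Markov branching process with deterministic initial condition $X(0)\in\mathbb Z_{\ge 0}^d$ and replacement structure $(a,(\xi_i)_{i=1}^d)$: the càdlàg Markov jump process on $\mathbb Z_{\ge0}^d$ in which each particle of type $i$ dies, independently of everything else, at rate $a_i$, and $X$ then changes by a fresh copy of $\xi_i$; that is, the process with generator $Lf(x)=\sum_{i=1}^d a_i x_i\,\mathbb E[f(x+\xi_i)-f(x)]$. Let $A=(a_j\mathbb E[\xi_{ji}])_{i,j=1}^d$ and let $\lambda_1$ be its Perron–Frobenius eigenvalue (the eigenvalue with largest real part, which is real). Assume (A1) $\mathbb E[\xi_{ij}^4]<\infty$ for all $i,j$; (A2) almost surely $\xi_{ii}\ge -1$ and $\xi_{ij}\ge 0$ for $i\ne j$; (A3) $\lambda_1>0$. Let $\Xi_4=\sum_{i=1}^d\mathbb E[\|\xi_i\|_2^4]$. Fix a Jordan basis of $A$ over $\mathbb C$, made of blocks $J$; a block $J$ of size $m$ and eigenvalue $\lambda$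 has vectors $v_{J,1},\dots,v_{J,m}$ with $Av_{J,1}=\lambda v_{J,1}$ and $Av_{J,i}=\lambda v_{J,i}+v_{J,i-1}$ for $2\le i\le m$. Let $P_J$ be the projection on $\mathrm{span}(v_{J,1},\dots,v_{J,m})$ along the other basis vectors, and let $N_A$ be the linear map with $N_Av_{J,1}=0$ and $N_Av_{J,i}=v_{J,i-1}$ for $2\le i\le m$, for every block $J$. Let $m_1$ be the size of the largest block with eigenvalue $\lambda_1$. Let $P_s$ (resp. $P_\ell$) be the sum of the $P_J$ over all blocks whose eigenvalue $\lambda$ satisfies $\mathrm{Re}\,\lambda<\lambda_1/2$ (resp. $\mathrm{Re}\,\lambda>\lambda_1/2$). Then there is a constant $C$, depending only on $a$ and on $A$ with its chosen Jordan basis (and not on $t$, on $X(0)$, or otherwise on the laws of the $\xi_i$), such that for all $t\ge0$: **Small components.** $$\mathbb E\big[\|(1+t)^{-(m_1-1)/2}e^{-\lambda_1t/2}P_sX(t)\|_2^4\big]\le C(1+\Xi_4^{3/2})\|X(0)\|_2^4,$$ $$\mathbb E\big[\|(1+t)^{-(m_1-1)/2}e^{-\lambda_1t/2}P_s(X(t)-e^{At}X(0))\|_2^4\big]\le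 C(1+\Xi_4^{3/2})\|X(0)\|_2^2\,(1\wedge t).$$ **Critical components.** For every block $J$, of size $m$, whose eigenvalue satisfies $\mathrm{Re}\,\lambda=\lambda_1/2$, and every $1\le\kappa\le m$, $$\mathbb E\big[\|(1+t)^{-(m_1+2\kappa-2)/2}e^{-\lambda_1t/2}N_A^{m-\kappa}P_JX(t)\|_2^4\big]\le C(1+\Xi_4^{3/2})\|X(0)\|_2^4,$$ $$\mathbb E\big[\|(1+t)^{-(m_1+2\kappa-2)/2}e^{-\lambda_1t/2}N_A^{m-\kappa}P_J(X(t)-e^{At}X(0))\|_2^4\big]\le C(1+\Xi_4^{3/2})\|X(0)\|_2^2\,(1\wedge t).$$ **Large components.** $$\mathbb E\big[\|P_\ell e^{-At}X(t)\|_2^4\big]\le C(1+\Xi_4^{3/2})\|X(0)\|_2^4,$$ $$\mathbb E\big[\|P_\ell(e^{-At}X(t)-X(0))\|_2^4\big]\le C(1+\Xi_4^{3/2})\|X(0)\|_2^2\,(1\wedge t).$$ -/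

import Mathlib

open MeasureTheory ProbabilityTheory Filter Topology
open scoped NNReal ENNReal Matrix

namespace BranchingMoments

noncomputable section

variable {d : ℕ}

/-! ### Replacement structures

A replacement structure is a pair `(a, ν)`: `a i` is the parameter of the exponential lifespan of a
particle of type `i`, and `ν i` is the law on `ℤ^d` of the replacement vector `ξ_i` (a particle of
type `i` that dies is replaced by `ξ_i + e_i`, so that the composition changes by `ξ_i`). -/

/-- Euclidean norm on `ℂ^d`. -/
def l2norm (v : Fin d → ℂ) : ℝ := ‖(WithLp.toLp 2 v : EuclideanSpace ℂ (Fin d))‖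

/-- (A1): all coordinates of all replacement vectors have finite fourth moments. -/
def AssumptionA1 (ν : Fin d → Measure (Fin d → ℤ)) : Prop :=
  ∀ i j, Integrable (fun z : Fin d → ℤ => ((z j : ℤ) : ℝ) ^ 4) (ν i)

/-- (A2): almost surely `ξ_{ii} ≥ -1`, and `ξ_{ij} ≥ 0` for `j ≠ i`. -/
def AssumptionA2 (ν : Fin d → Measure (Fin d → ℤ)) : Prop :=
  ∀ i, ∀ᵐ z ∂(ν i), -1 ≤ z i ∧ ∀ j, j ≠ i → 0 ≤ z j

/-- The mean matrix `A = (a_j E[ξ_{ji}])_{i,j}`. -/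
def meanMatrix (a : Fin d → ℝ) (ν : Fin d → Measure (Fin d → ℤ)) : Matrix (Fin d) (Fin d) ℝ :=
  Matrix.of fun i j => a j * ∫ z, ((z i : ℤ) : ℝ) ∂(ν j)

/-- `Ξ_4 = ∑ i, E ‖ξ_i‖_2 ^ 4`. -/
def Xi4 (ν : Fin d → Measure (Fin d → ℤ)) : ℝ :=
  ∑ i, ∫ z, l2norm (fun k => ((z k : ℤ) : ℂ)) ^ 4 ∂(ν i)

/-! ### The branching process -/

/-- The composition `x + z`, for a composition `x` and a replacement vector `z`. Under (A2) and if
a particle of type `i` is present in `x`, then `x + ξ_i ≥ 0` almost surely, so that the truncation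
at `0` never takes effect. -/
def addReplacement (x : Fin d → ℕ) (z : Fin d → ℤ) : Fin d → ℕ :=
  fun k => ((x k : ℤ) + z k).toNat

/-- The generator of the particle system: in composition `x` there are `x i` particles of type `i`,
each of which dies at rate `a i`, independently of everything else, and the composition
then becomes `x + ξ_i`: `L f (x) = ∑ i, a_i x_i E[f (x + ξ_i) - f x]`. -/
def generator (a : Fin d → ℝ) (ν : Fin d → Measure (Fin d → ℤ)) (f : (Fin d → ℕ) → ℝ)
    (x : Fin d → ℕ) : ℝ :=
  ∑ i, a i * (x i : ℝ) * ∫ z, (f (addReplacement x z) - f x) ∂(ν i)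

/-- `X` is a multi-type continuous-time Markov branching process with replacement structure
`(a, ν)` started from the composition `x₀`: the càdlàg Markov jump process on `ℕ^d` started at `x₀`
with the generator above, given as the solution of the martingale problem for that generator on
the functions of finite support. (For such `f` and under (A2), `L f` is again finitely supported;
the paths are càdlàg in the discrete space `ℕ^d`, so they make finitely many jumps in bounded time,
and the martingale problem determines the law of `X`, in particular its Markov property.) -/
structure IsMCBP {Ω : Type*} [mΩ : MeasurableSpace Ω] (a : Fin d → ℝ)
    (ν : Fin d → Measure (Fin d → ℤ)) (x₀ : Fin d → ℕ) (μ : Measure Ω)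
    (X : ℝ≥0 → Ω → (Fin d → ℕ)) : Prop where
  initial : ∀ᵐ ω ∂μ, X 0 ω = x₀
  right_continuous : ∀ ω t, ContinuousWithinAt (fun s => X s ω) (Set.Ici t) t
  left_limits : ∀ ω t, ∃ l, Tendsto (fun s => X s ω) (𝓝[<] t) (𝓝 l)
  martingale_problem : ∃ ℱ : Filtration ℝ≥0 mΩ,
    (∀ t, Measurable[ℱ t] (X t)) ∧
    ∀ f : (Fin d → ℕ) → ℝ, f.support.Finite →
      Martingale (fun (t : ℝ≥0) ω =>
        f (X t ω) - ∫ s in (0 : ℝ)..(t : ℝ), generator a ν f (X s.toNNReal ω)) ℱ μ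

/-! ### Spectral notions -/

/-- A real matrix seen as a complex one. -/
def toC (A : Matrix (Fin d) (Fin d) ℝ) : Matrix (Fin d) (Fin d) ℂ := A.map (fun r : ℝ => (r : ℂ))

/-- The Perron-Frobenius eigenvalue `λ₁`: the largest real part of an eigenvalue. (For matrices with
nonnegative off-diagonal entries the eigenvalue with largest real part is real.) -/
def perronEigenvalue (A : Matrix (Fin d) (Fin d) ℝ) : ℝ :=
  sSup {r : ℝ | ∃ z ∈ spectrum ℂ (toC A), z.re = r}

/-- The linear map `e^{A t}` on `ℂ^d`. -/
def expMap (A : Matrix (Fin d) (Fin d) ℝ) (t : ℝ) : (Fin d → ℂ) →ₗ[ℂ] (Fin d → ℂ) :=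
  Matrix.toLin' (NormedSpace.exp ((t : ℂ) • toC A))

/-- A Jordan basis of `A` over `ℂ`: a basis of `ℂ^d` split into blocks `b` with eigenvalue `eig b`
and vectors `v_{b,0}, …, v_{b,size b - 1}`, with `A v_{b,0} = eig b • v_{b,0}` and
`A v_{b,i+1} = eig b • v_{b,i+1} + v_{b,i}`. -/
structure JordanBasis (A : Matrix (Fin d) (Fin d) ℝ) where
  numBlocks : ℕ
  size : Fin numBlocks → ℕ
  size_pos : ∀ b, 0 < size b
  eig : Fin numBlocks → ℂ
  vec : Module.Basis (Σ b : Fin numBlocks, Fin (size b)) ℂ (Fin d → ℂ)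
  map_zero : ∀ b, toC A *ᵥ vec ⟨b, ⟨0, size_pos b⟩⟩ = eig b • vec ⟨b, ⟨0, size_pos b⟩⟩
  map_succ : ∀ b (i : ℕ) (hi : i + 1 < size b),
    toC A *ᵥ vec ⟨b, ⟨i + 1, hi⟩⟩ =
      eig b • vec ⟨b, ⟨i + 1, hi⟩⟩ + vec ⟨b, ⟨i, (Nat.lt_succ_self i).trans hi⟩⟩

namespace JordanBasis

variable {A : Matrix (Fin d) (Fin d) ℝ} (J : JordanBasis A)

/-- The projection `P_J` on the Jordan space of block `b`, along the other blocks. -/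
def proj (b : Fin J.numBlocks) : (Fin d → ℂ) →ₗ[ℂ] (Fin d → ℂ) :=
  J.vec.constr ℂ fun p => if p.1 = b then J.vec p else 0

/-- The nilpotent map `N_A`: it sends `v_{b,0}` to `0` and `v_{b,i+1}` to `v_{b,i}`. -/
def nil : (Fin d → ℂ) →ₗ[ℂ] (Fin d → ℂ) :=
  J.vec.constr ℂ fun p =>
    if p.2.val = 0 then 0
    else J.vec ⟨p.1, ⟨p.2.val - 1, (Nat.sub_le _ _).trans_lt p.2.isLt⟩⟩

/-- `m₁`: the size of the largest Jordan block with eigenvalue `λ₁`. -/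
def m1 : ℕ :=
  open Classical in
  (Finset.univ.filter fun b => J.eig b = (perronEigenvalue A : ℂ)).sup J.size

/-- `P_s`: the sum of the projections on the small Jordan spaces, `Re λ < λ₁ / 2`. -/
def projSmall : (Fin d → ℂ) →ₗ[ℂ] (Fin d → ℂ) :=
  open Classical in
  ∑ b ∈ Finset.univ.filter (fun b => (J.eig b).re < perronEigenvalue A / 2), J.proj b

/-- `P_ℓ`: the sum of the projections on the large Jordan spaces, `Re λ > λ₁ / 2`. -/
def projLarge : (Fin d → ℂ) →ₗ[ℂ] (Fin d → ℂ) :=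
  open Classical in
  ∑ b ∈ Finset.univ.filter (fun b => perronEigenvalue A / 2 < (J.eig b).re), J.proj b

end JordanBasis

/-- A composition as a vector of `ℂ^d`. -/
def compVec (x : Fin d → ℕ) : Fin d → ℂ := fun k => (x k : ℂ)

/-- `E ‖Y‖_2 ^ 4`, in `[0, ∞]`. -/
def fourthMoment {Ω : Type*} [MeasurableSpace Ω] (μ : Measure Ω) (Y : Ω → Fin d → ℂ) : ℝ≥0∞ :=
  ∫⁻ ω, ENNReal.ofReal (l2norm (Y ω) ^ 4) ∂μ

/-- The scalar `(1 + t)^{-p/2} e^{-c t/2}`. -/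
def normaliser (p c t : ℝ) : ℂ :=
  (((1 + t) ^ (-p / 2) * Real.exp (-(c * t) / 2) : ℝ) : ℂ)

end

end BranchingMoments

open BranchingMoments

/-! Fix a time T and a linear map R. A linear function ℓ of the process has drift ℓ(AX), so M_s = R
e^{A(T-s)} X(s) is a martingale on [0,T] running from R e^{AT} X(0) to R X(T). Every quantity to be
bounded is the fourth moment of M_T or of M_T - M_0 for some R: the normalised P_s, the normalised
N_A^{m-κ} P_J, or P_ℓ e^{-AT}.

A jump ξ_i at time s moves M by at most b(s)‖ξ_i‖, where b(s) bounds R e^{A(T-s)}. Dynkin's formula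
for ‖M_s - M_0‖^4 leaves only second order remainders, at a rate proportional to |X(s)|. By
Cauchy-Schwarz, the supremum Q of E‖M_s - M_0‖^4 over [0,T] satisfies Q ≤ α√Q + γ, so Q ≤ α² + 2γ,
with α of order √Ξ_4 ∫ b² (E|X|²)^{1/2} and γ of order Ξ_4 ∫ b^4 E|X|
(`IsForwardSolution.integral_norm_pow_four_le`). The same computation with the square of the norm
and R = id gives E|X(s)|² ≲ (1 + √Ξ_4) ‖X(0)‖² K(s)², where K(s) = (1+s)^{m_1-1} e^{λ_1 s} is the
growth of e^{As} (`JordanBasis.exists_total_bound`). Hence the factor Ξ_4(1 + √Ξ_4) + Ξ_4 ≲ 1 +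
Ξ_4^{3/2}.

What remains is that b²K and ∫_0^T b²K are bounded uniformly in T
(`JordanBasis.exists_fourthMoment_bounds`); the two together bound the integral by a multiple of 1 ∧
T. For small components b²K decays exponentially in T - s, for large ones in s, and for critical
ones the exponentials cancel and b²K is of order 1/(1+T).

Two points need care. The process is only known through finitely supported test functions, so
Dynkin's formula has to be extended to quartic growth by a Lyapunov bound and cutoffs
(`IsForwardSolution.dynkin`). And K bounds e^{As} only because an eigenvalue of largest real part is
real (`eq_perronEigenvalue_of_re_eq`). -/

namespace BranchingMoments
noncomputable section

variable {d : ℕ}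

/-! ### Size of compositions and of replacement vectors -/

/-- The number of particles of a composition. -/
def total (x : Fin d → ℕ) : ℝ := ∑ k, (x k : ℝ)

/-- The `ℓ¹` norm of a replacement vector. -/
def l1 (z : Fin d → ℤ) : ℝ := ∑ k, |(z k : ℝ)|

lemma total_nonneg (x : Fin d → ℕ) : 0 ≤ total x := Finset.sum_nonneg fun _ _ => by positivity

lemma l1_nonneg (z : Fin d → ℤ) : 0 ≤ l1 z := Finset.sum_nonneg fun _ _ => by positivity

lemma coord_le_total (x : Fin d → ℕ) (i : Fin d) : (x i : ℝ) ≤ total x :=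
  Finset.single_le_sum (f := fun k => (x k : ℝ)) (fun _ _ => by positivity) (Finset.mem_univ i)

lemma le_l1 (z : Fin d → ℤ) (i : Fin d) : |(z i : ℝ)| ≤ l1 z :=
  Finset.single_le_sum (f := fun k => |(z k : ℝ)|) (fun _ _ => by positivity) (Finset.mem_univ i)

lemma finite_total_le (c : ℝ) : {x : Fin d → ℕ | total x ≤ c}.Finite := by
  refine (Set.finite_Iic (fun _ : Fin d => ⌊c⌋₊)).subset fun x hx => ?_
  intro k
  exact Nat.le_floor ((coord_le_total x k).trans hx)

lemma exists_total_bound {f : (Fin d → ℕ) → ℝ} (hf : f.support.Finite) :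
    ∃ N : ℝ, ∀ x, N < total x → f x = 0 := by
  obtain ⟨N, hN⟩ := (hf.image total).bddAbove
  refine ⟨N, fun x hx => ?_⟩
  by_contra h
  exact absurd (hN ⟨x, h, rfl⟩) (not_le.2 hx)

lemma addReplacement_cast {x : Fin d → ℕ} {z : Fin d → ℤ} {i : Fin d} (hx : x i ≠ 0)
    (hz : -1 ≤ z i ∧ ∀ j, j ≠ i → 0 ≤ z j) (k : Fin d) :
    ((addReplacement x z k : ℕ) : ℝ) = x k + z k := by
  have h : (0 : ℤ) ≤ (x k : ℤ) + z k := by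
    by_cases hk : k = i
    · subst hk; have := Nat.pos_of_ne_zero hx; omega
    · have := hz.2 k hk; omega
  have h2 : ((addReplacement x z k : ℕ) : ℤ) = (x k : ℤ) + z k := Int.toNat_of_nonneg h
  exact_mod_cast h2

lemma total_addReplacement {x : Fin d → ℕ} {z : Fin d → ℤ} {i : Fin d} (hx : x i ≠ 0)
    (hz : -1 ≤ z i ∧ ∀ j, j ≠ i → 0 ≤ z j) :
    total (addReplacement x z) = total x + ∑ k, (z k : ℝ) := by
  simp [total, addReplacement_cast hx hz, Finset.sum_add_distrib]

lemma abs_total_addReplacement_sub_le {x : Fin d → ℕ} {z : Fin d → ℤ} {i : Fin d} (hx : x i ≠ 0)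
    (hz : -1 ≤ z i ∧ ∀ j, j ≠ i → 0 ≤ z j) :
    |total (addReplacement x z) - total x| ≤ l1 z := by
  rw [total_addReplacement hx hz, add_sub_cancel_left]
  exact Finset.abs_sum_le_sum_abs _ _

/-- Under (A2) a jump removes at most one particle. This is why the generator preserves finite
support and why cutoffs behave well under jumps of unbounded size. -/
lemma total_le_total_addReplacement {x : Fin d → ℕ} {z : Fin d → ℤ} {i : Fin d} (hx : x i ≠ 0)
    (hz : -1 ≤ z i ∧ ∀ j, j ≠ i → 0 ≤ z j) :
    total x ≤ total (addReplacement x z) + 1 := by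
  rw [total_addReplacement hx hz]
  have : (-1 : ℝ) ≤ ∑ k, (z k : ℝ) := by
    rw [← Finset.add_sum_erase _ _ (Finset.mem_univ i)]
    have h1 : (-1 : ℝ) ≤ z i := by exact_mod_cast hz.1
    have h2 : 0 ≤ ∑ k ∈ Finset.univ.erase i, (z k : ℝ) :=
      Finset.sum_nonneg fun k hk => by exact_mod_cast hz.2 k (Finset.ne_of_mem_erase hk)
    linarith
  linarith

/-! ### The generator -/

variable {a : Fin d → ℝ} {ν : Fin d → Measure (Fin d → ℤ)}

lemma generator_eq_zero_of_total (hA2 : AssumptionA2 ν) {f : (Fin d → ℕ) → ℝ} {N : ℝ}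
    (hN : ∀ x, N < total x → f x = 0) {x : Fin d → ℕ} (hx : N + 1 < total x) :
    generator a ν f x = 0 := by
  refine Finset.sum_eq_zero fun i _ => ?_
  by_cases hi : x i = 0
  · simp [hi]
  · have : ∫ z, (f (addReplacement x z) - f x) ∂(ν i) = 0 := by
      refine integral_eq_zero_of_ae ?_
      filter_upwards [hA2 i] with z hz
      have h := total_le_total_addReplacement hi hz
      rw [hN _ (by linarith), hN x (by linarith)]
      simp
    rw [this, mul_zero]

lemma generator_support_finite (hA2 : AssumptionA2 ν) {f : (Fin d → ℕ) → ℝ}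
    (hf : f.support.Finite) : (generator a ν f).support.Finite := by
  obtain ⟨N, hN⟩ := exists_total_bound hf
  refine (finite_total_le (N + 1)).subset fun x hx => ?_
  by_contra h
  exact hx (generator_eq_zero_of_total hA2 hN (not_le.1 h))

lemma exists_abs_le_of_finite_support {α : Type*} {f : α → ℝ} (hf : f.support.Finite) :
    ∃ C, ∀ x, |f x| ≤ C := by
  obtain ⟨C, hC⟩ := (hf.image fun x => |f x|).bddAbove
  refine ⟨max C 0, fun x => ?_⟩
  by_cases h : f x = 0
  · simp [h]
  · exact (hC ⟨x, h, rfl⟩).trans (le_max_left _ _)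

/-! ### One-dimensional marginals: the forward equation -/

/-- A family of probability measures on compositions that solves the forward equation of the
branching process. -/
structure IsForwardSolution (a : Fin d → ℝ) (ν : Fin d → Measure (Fin d → ℤ)) (x₀ : Fin d → ℕ)
    (P : ℝ → Measure (Fin d → ℕ)) : Prop where
  prob : ∀ s, IsProbabilityMeasure (P s)
  meas : ∀ f : (Fin d → ℕ) → ℝ, f.support.Finite → Measurable fun s => ∫ x, f x ∂(P s)
  forward : ∀ f : (Fin d → ℕ) → ℝ, f.support.Finite → ∀ t : ℝ, 0 ≤ t →
    ∫ x, f x ∂(P t) = f x₀ + ∫ s in (0 : ℝ)..t, ∫ x, generator a ν f x ∂(P s)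

/-- Joint measurability is what Fubini needs below; it comes from approximating the time from the
right along finer and finer grids. -/
lemma measurable_uncurry_of_right_continuous {Ω : Type*} [MeasurableSpace Ω]
    {X : ℝ≥0 → Ω → (Fin d → ℕ)} (hm : ∀ t, Measurable (X t))
    (hr : ∀ ω t, ContinuousWithinAt (fun s => X s ω) (Set.Ici t) t) :
    Measurable (Function.uncurry X) := by
  -- The numerator `k + 1` puts the grid time to the right of `s`, where right-continuity applies.
  obtain ⟨r, hr'⟩ : ∃ r : ℕ → ℕ → ℝ≥0, ∀ n k, r n k = (k + 1) / (n + 1) := ⟨_, fun _ _ => rfl⟩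
  let Y : ℕ → ℝ≥0 × Ω → (Fin d → ℕ) := fun n p => X (r n ⌊p.1 * (n + 1)⌋₊) p.2
  refine measurable_of_tendsto_metrizable (f := Y) (fun n => ?_) ?_
  · have h1 : Measurable fun q : ℕ × Ω => X (r n q.1) q.2 :=
      measurable_from_prod_countable_right fun k => hm (r n k)
    have h2 : Measurable fun p : ℝ≥0 × Ω => (⌊p.1 * (n + 1)⌋₊, p.2) :=
      (Nat.measurable_floor.comp (measurable_fst.mul_const _)).prodMk measurable_snd
    exact h1.comp h2
  · rw [tendsto_pi_nhds]
    rintro ⟨s, ω⟩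
    have hlim : Tendsto (fun n : ℕ => r n ⌊s * (n + 1)⌋₊) atTop (𝓝[Set.Ici s] s) := by
      have hlow : ∀ n : ℕ, s ≤ r n ⌊s * (n + 1)⌋₊ := fun n => by
        rw [hr', le_div_iff₀ (by positivity)]
        exact (Nat.lt_floor_add_one _).le
      have hup : ∀ n : ℕ, r n ⌊s * (n + 1)⌋₊ ≤ s + 1 / (n + 1) := fun n => by
        have h : (0 : ℝ≥0) < n + 1 := by positivity
        rw [hr', div_le_iff₀ h, add_mul, div_mul_cancel₀ _ h.ne']
        gcongr
        exact Nat.floor_le (by positivity)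
      refine tendsto_nhdsWithin_iff.2 ⟨?_, Eventually.of_forall hlow⟩
      refine tendsto_of_tendsto_of_tendsto_of_le_of_le tendsto_const_nhds ?_ hlow hup
      have h0 : Tendsto (fun n : ℕ => (1 : ℝ≥0) / (n + 1)) atTop (𝓝 0) :=
        tendsto_one_div_add_atTop_nhds_zero_nat
      simpa using tendsto_const_nhds.add h0
    exact (hr ω s).tendsto.comp hlim

/-- The expectation of the martingale is constant, and Fubini moves it inside the time integral.
Since the moment bounds concern one time at a time, only these marginals are used afterwards. At
negative times the family is frozen at the law of `X 0`. -/
theorem IsMCBP.isForwardSolution {Ω : Type*} [MeasurableSpace Ω] {μ : Measure Ω}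
    [IsProbabilityMeasure μ] {x₀ : Fin d → ℕ} {X : ℝ≥0 → Ω → (Fin d → ℕ)}
    (hA2 : AssumptionA2 ν) (hX : IsMCBP a ν x₀ μ X) :
    (∀ t, Measurable (X t)) ∧ IsForwardSolution a ν x₀ fun s => μ.map (X s.toNNReal) := by
  obtain ⟨ℱ, had, hmart⟩ := hX.martingale_problem
  have hm : ∀ t, Measurable (X t) := fun t => (had t).mono (ℱ.le t) le_rfl
  have hu := measurable_uncurry_of_right_continuous hm hX.right_continuous
  have hu' : Measurable fun p : ℝ × Ω => X p.1.toNNReal p.2 :=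
    hu.comp ((measurable_real_toNNReal.comp measurable_fst).prodMk measurable_snd)
  have hmap : ∀ (f : (Fin d → ℕ) → ℝ) (s : ℝ),
      ∫ x, f x ∂(μ.map (X s.toNNReal)) = ∫ ω, f (X s.toNNReal ω) ∂μ := fun f s =>
    integral_map (hm _).aemeasurable (Measurable.of_discrete (f := f)).aestronglyMeasurable
  refine ⟨hm, ⟨fun s => Measure.isProbabilityMeasure_map (hm _).aemeasurable, ?_, ?_⟩⟩
  · intro f _
    simp_rw [hmap]
    have h : StronglyMeasurable fun p : ℝ × Ω => f (X p.1.toNNReal p.2) :=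
      ((Measurable.of_discrete (f := f)).comp hu').stronglyMeasurable
    exact h.integral_prod_right.measurable
  · intro f hf t ht
    simp_rw [hmap]
    obtain ⟨C, hC⟩ := exists_abs_le_of_finite_support (generator_support_finite (a := a) hA2 hf)
    obtain ⟨C', hC'⟩ := exists_abs_le_of_finite_support hf
    have hint : Integrable (fun p : Ω × ℝ => generator a ν f (X p.2.toNNReal p.1))
        (μ.prod (volume.restrict (Set.Ioc 0 t))) := by
      refine Integrable.of_bound (C := C) ?_ (ae_of_all _ fun p => hC _)
      exact ((Measurable.of_discrete (f := generator a ν f)).comp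
        (hu'.comp measurable_swap)).aestronglyMeasurable
    have hswap : ∫ ω, (∫ s in (0 : ℝ)..t, generator a ν f (X s.toNNReal ω)) ∂μ =
        ∫ s in (0 : ℝ)..t, ∫ ω, generator a ν f (X s.toNNReal ω) ∂μ := by
      simp_rw [intervalIntegral.integral_of_le ht]
      exact integral_integral_swap hint
    have hI1 : Integrable (fun ω => f (X t.toNNReal ω)) μ :=
      Integrable.of_bound (C := C') ((Measurable.of_discrete (f := f)).comp
        (hm _)).aestronglyMeasurable (ae_of_all _ fun p => hC' _)
    have hI2 : Integrable (fun ω => ∫ s in (0 : ℝ)..t, generator a ν f (X s.toNNReal ω)) μ := by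
      simp_rw [intervalIntegral.integral_of_le ht]
      exact hint.integral_prod_left
    have h0 := (hmart f hf).setIntegral_eq (zero_le : (0 : ℝ≥0) ≤ t.toNNReal) MeasurableSet.univ
    simp only [Measure.restrict_univ, Real.coe_toNNReal t ht, NNReal.coe_zero,
      intervalIntegral.integral_same, sub_zero] at h0
    rw [integral_sub hI1 hI2, hswap] at h0
    have h1 : ∫ ω, f (X 0 ω) ∂μ = f x₀ := by
      rw [integral_congr_ae (g := fun _ => f x₀)
        (hX.initial.mono fun ω h => by simp only [h])]
      simp
    linarith
end
end BranchingMoments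

namespace BranchingMoments
noncomputable section

variable {d : ℕ} {a : Fin d → ℝ} {ν : Fin d → Measure (Fin d → ℤ)}
  {x₀ : Fin d → ℕ} {P : ℝ → Measure (Fin d → ℕ)}

/-! ### Time-dependent test functions of finite support -/

lemma generator_sum [∀ i, IsProbabilityMeasure (ν i)] {ι : Type*} (S : Finset ι)
    (f : ι → (Fin d → ℕ) → ℝ) (hf : ∀ j, (f j).support.Finite) (c : ι → ℝ) (x : Fin d → ℕ) :
    generator a ν (fun x => ∑ j ∈ S, c j * f j x) x = ∑ j ∈ S, c j * generator a ν (f j) x := by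
  unfold generator
  simp_rw [Finset.mul_sum]
  rw [Finset.sum_comm]
  refine Finset.sum_congr rfl fun i _ => ?_
  have hint : ∀ j, Integrable (fun z => f j (addReplacement x z) - f j x) (ν i) := fun j => by
    obtain ⟨C, hC⟩ := exists_abs_le_of_finite_support (hf j)
    refine Integrable.of_bound (C := C + C) Measurable.of_discrete.aestronglyMeasurable
      (ae_of_all _ fun z => ?_)
    exact (norm_sub_le _ _).trans (add_le_add (hC _) (hC _))
  have : ∫ z, (∑ j ∈ S, c j * f j (addReplacement x z) - ∑ j ∈ S, c j * f j x) ∂(ν i) =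
      ∑ j ∈ S, c j * ∫ z, (f j (addReplacement x z) - f j x) ∂(ν i) := by
    simp_rw [← integral_const_mul]
    rw [← integral_finsetSum _ fun j _ => (hint j).const_mul _]
    simp_rw [mul_sub, Finset.sum_sub_distrib]
  rw [this, Finset.mul_sum]
  exact Finset.sum_congr rfl fun j _ => by ring

namespace IsForwardSolution

lemma integrable_of_bounded (hP : IsForwardSolution a ν x₀ P) {f : (Fin d → ℕ) → ℝ} {C : ℝ}
    (hC : ∀ x, |f x| ≤ C) (s : ℝ) : Integrable f (P s) := by
  have := hP.prob s
  exact Integrable.of_bound (C := C) Measurable.of_discrete.aestronglyMeasurable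
    (ae_of_all _ hC)

lemma integrable_of_finite_support (hP : IsForwardSolution a ν x₀ P) {f : (Fin d → ℕ) → ℝ}
    (hf : f.support.Finite) (s : ℝ) : Integrable f (P s) :=
  hP.integrable_of_bounded (exists_abs_le_of_finite_support hf).choose_spec s

lemma continuousOn_integral (hP : IsForwardSolution a ν x₀ P) (hA2 : AssumptionA2 ν)
    {f : (Fin d → ℕ) → ℝ} (hf : f.support.Finite) :
    ContinuousOn (fun s => ∫ x, f x ∂(P s)) (Set.Ici 0) := by
  have hg := generator_support_finite (a := a) hA2 hf
  obtain ⟨C, hC⟩ := exists_abs_le_of_finite_support hg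
  have hii : ∀ u v : ℝ, IntervalIntegrable (fun s => ∫ x, generator a ν f x ∂(P s)) volume u v := by
    intro u v
    refine (intervalIntegrable_const (c := C)).mono_fun (hP.meas _ hg).aestronglyMeasurable
      (ae_of_all _ fun s => ?_)
    have := hP.prob s
    have h := norm_integral_le_of_norm_le_const (μ := P s) (f := generator a ν f) (ae_of_all _ hC)
    simp only [probReal_univ, mul_one] at h
    exact h.trans (Real.le_norm_self C)
  refine ContinuousOn.congr (f := fun t => f x₀ + ∫ s in (0 : ℝ)..t, ∫ x, generator a ν f x ∂(P s))
    ?_ fun t ht => hP.forward f hf t ht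
  exact (continuous_const.add (intervalIntegral.continuous_primitive hii 0)).continuousOn

/-- The generator maps finitely supported functions to finitely supported ones, so the integrand in
the forward equation is itself continuous in time and the fundamental theorem of calculus applies.
-/
lemma hasDerivAt_integral (hP : IsForwardSolution a ν x₀ P) (hA2 : AssumptionA2 ν)
    {f : (Fin d → ℕ) → ℝ} (hf : f.support.Finite) {t : ℝ} (ht : 0 < t) :
    HasDerivAt (fun s => ∫ x, f x ∂(P s)) (∫ x, generator a ν f x ∂(P t)) t := by
  have hc := hP.continuousOn_integral hA2 (generator_support_finite (a := a) hA2 hf)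
  have h1 : HasDerivAt (fun u => ∫ s in (0 : ℝ)..u, ∫ x, generator a ν f x ∂(P s))
      (∫ x, generator a ν f x ∂(P t)) t := by
    refine intervalIntegral.integral_hasDerivAt_right ?_ ?_ ?_
    · exact (hc.mono (by rw [Set.uIcc_of_le ht.le]; exact Set.Icc_subset_Ici_self)).intervalIntegrable
    · exact (hP.meas _ (generator_support_finite hA2 hf)).stronglyMeasurable.stronglyMeasurableAtFilter
    · exact hc.continuousAt (Ici_mem_nhds ht)
  refine (h1.const_add (f x₀)).congr_of_eventuallyEq ?_
  filter_upwards [Ioi_mem_nhds ht] with s hs using hP.forward f hf s (le_of_lt hs)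

/-- With a fixed finite set carrying all the supports, the expectation is a finite sum of F_s(y)
P_s({y}), and the claim is the product rule followed by integration. -/
theorem forward_time_dependent (hP : IsForwardSolution a ν x₀ P) (hA2 : AssumptionA2 ν)
    [∀ i, IsProbabilityMeasure (ν i)] (S : Finset (Fin d → ℕ)) {F F' : ℝ → (Fin d → ℕ) → ℝ}
    (hF : ∀ s, ∀ y ∉ S, F s y = 0) (hF' : ∀ s, ∀ y ∉ S, F' s y = 0)
    (hd : ∀ y s, HasDerivAt (fun s => F s y) (F' s y) s) (hc : ∀ y, Continuous fun s => F' s y)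
    {T : ℝ} (hT : 0 ≤ T) :
    ContinuousOn (fun s => ∫ x, (F' s x + generator a ν (F s) x) ∂(P s)) (Set.Ici 0) ∧
    ∫ x, F T x ∂(P T) = F 0 x₀ + ∫ s in (0 : ℝ)..T, ∫ x, (F' s x + generator a ν (F s) x) ∂(P s) := by
  -- Indicators of points, the basis in which every function vanishing off `S` is expanded.
  let e : (Fin d → ℕ) → (Fin d → ℕ) → ℝ := fun y x => if x = y then 1 else 0
  have he : ∀ y, (e y).support.Finite := fun y => by
    refine (Set.finite_singleton y).subset fun x hx => ?_
    by_contra h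
    exact hx (if_neg h)
  have hge : ∀ y, (generator a ν (e y)).support.Finite := fun y => generator_support_finite hA2 (he y)
  have hrep : ∀ g : (Fin d → ℕ) → ℝ, (∀ y ∉ S, g y = 0) → g = fun x => ∑ y ∈ S, g y * e y x := by
    intro g hg
    funext x
    by_cases hx : x ∈ S
    · simp [e, hx]
    · simp [e, hx, hg x hx]
  have hE : ∀ g : (Fin d → ℕ) → ℝ, (∀ y ∉ S, g y = 0) → ∀ s,
      ∫ x, g x ∂(P s) = ∑ y ∈ S, g y * ∫ x, e y x ∂(P s) := by
    intro g hg s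
    conv_lhs => rw [hrep g hg]
    rw [integral_finsetSum _ fun y _ => (hP.integrable_of_finite_support (he y) s).const_mul _]
    simp_rw [integral_const_mul]
  have hsum : ∀ s, ∫ x, (F' s x + generator a ν (F s) x) ∂(P s) =
      ∑ y ∈ S, (F' s y * (∫ x, e y x ∂(P s)) + F s y * ∫ x, generator a ν (e y) x ∂(P s)) := by
    intro s
    have hfs : ∀ g : (Fin d → ℕ) → ℝ, (∀ y ∉ S, g y = 0) → g.support.Finite := fun g hg =>
      S.finite_toSet.subset fun x hx => by
        by_contra h
        exact hx (hg x h)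
    rw [integral_add (hP.integrable_of_finite_support (hfs _ (hF' s)) s)
      (hP.integrable_of_finite_support (generator_support_finite hA2 (hfs _ (hF s))) s),
      hE _ (hF' s), Finset.sum_add_distrib]
    congr 1
    have : generator a ν (F s) = fun x => ∑ y ∈ S, F s y * generator a ν (e y) x := by
      funext x
      conv_lhs => rw [hrep (F s) (hF s)]
      exact generator_sum S e he _ x
    rw [this, integral_finsetSum _ fun y _ => (hP.integrable_of_finite_support (hge y) s).const_mul _]
    simp_rw [integral_const_mul]
  have hcF : ∀ y, Continuous fun s => F s y := fun y =>
    continuous_iff_continuousAt.2 fun s => (hd y s).continuousAt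
  have hcont : ContinuousOn (fun s => ∫ x, (F' s x + generator a ν (F s) x) ∂(P s)) (Set.Ici 0) := by
    simp_rw [hsum]
    refine continuousOn_finsetSum _ fun y _ => ?_
    exact ((hc y).continuousOn.mul (hP.continuousOn_integral hA2 (he y))).add
      ((hcF y).continuousOn.mul (hP.continuousOn_integral hA2 (hge y)))
  refine ⟨hcont, ?_⟩
  have hcontU : ContinuousOn (fun s => ∫ x, F s x ∂(P s)) (Set.Icc 0 T) := by
    simp_rw [fun s => hE (F s) (hF s) s]
    refine (continuousOn_finsetSum _ fun y _ => ?_).mono Set.Icc_subset_Ici_self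
    exact (hcF y).continuousOn.mul (hP.continuousOn_integral hA2 (he y))
  have hder : ∀ s ∈ Set.Ioo 0 T, HasDerivAt (fun s => ∫ x, F s x ∂(P s))
      (∫ x, (F' s x + generator a ν (F s) x) ∂(P s)) s := by
    intro s hs
    rw [hsum s]
    simp_rw [fun s => hE (F s) (hF s) s]
    exact HasDerivAt.fun_sum fun y _ => (hd y s).mul (hP.hasDerivAt_integral hA2 (he y) hs.1)
  have hftc := intervalIntegral.integral_eq_sub_of_hasDerivAt_of_le hT hcontU hder
    ((hcont.mono (by rw [Set.uIcc_of_le hT]; exact Set.Icc_subset_Ici_self)).intervalIntegrable)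
  have h0 : ∫ x, F 0 x ∂(P 0) = F 0 x₀ := by
    have hfs : (F 0).support.Finite := S.finite_toSet.subset fun x hx => by
      by_contra h
      exact hx (hF 0 x h)
    simpa using hP.forward (F 0) hfs 0 le_rfl
  rw [hftc, h0]
  ring

end IsForwardSolution
end
end BranchingMoments

namespace BranchingMoments
noncomputable section

variable {d : ℕ} {a : Fin d → ℝ} {ν : Fin d → Measure (Fin d → ℤ)}
  {x₀ : Fin d → ℕ} {P : ℝ → Measure (Fin d → ℕ)}

/-! ### Fourth moments -/

lemma integrable_one_add_l1_pow [∀ i, IsProbabilityMeasure (ν i)] (hA1 : AssumptionA1 ν)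
    (i : Fin d) : Integrable (fun z => (1 + l1 z) ^ 4) (ν i) := by
  have h : Integrable (fun z : Fin d → ℤ => 8 * (1 + (d : ℝ) ^ 3 * ∑ k, ((z k : ℤ) : ℝ) ^ 4)) (ν i) :=
    ((integrable_const _).add ((integrable_finsetSum _ fun k _ => hA1 i k).const_mul _)).const_mul _
  refine h.mono' Measurable.of_discrete.aestronglyMeasurable (ae_of_all _ fun z => ?_)
  have h0 := l1_nonneg z
  rw [Real.norm_of_nonneg (by positivity)]
  have h1 : l1 z ^ 4 ≤ (d : ℝ) ^ 3 * ∑ k, (z k : ℝ) ^ 4 := by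
    rcases Nat.eq_zero_or_pos d with hd | hd
    · subst hd; simp [l1]
    have h2 := pow_sum_div_card_le_sum_pow (s := Finset.univ) (f := fun k => |(z k : ℝ)|) 
      (fun _ _ => abs_nonneg _) 3
    simp only [Finset.card_univ, Fintype.card_fin, Nat.reduceAdd] at h2
    rw [div_le_iff₀ (by positivity)] at h2
    have h4 : ∀ k, |(z k : ℝ)| ^ 4 = (z k : ℝ) ^ 4 := fun k => by
      rw [← abs_pow, abs_of_nonneg (by positivity)]
    simp_rw [h4] at h2
    rw [mul_comm]
    exact h2
  nlinarith [sq_nonneg (l1 z - 1), sq_nonneg (l1 z ^ 2 - 1), sq_nonneg (l1 z * (l1 z - 1))]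

/-- The total jump rate weighted with the fourth moments of the replacement vectors. -/
def momentRate (a : Fin d → ℝ) (ν : Fin d → Measure (Fin d → ℤ)) : ℝ :=
  ∑ i, a i * ∫ z, (1 + l1 z) ^ 4 ∂(ν i)

lemma momentRate_nonneg (ha : ∀ i, 0 < a i) : 0 ≤ momentRate a ν :=
  Finset.sum_nonneg fun i _ => mul_nonneg (ha i).le (integral_nonneg fun z => by positivity)

/-- An upper bound for the generator from an upper bound for the increments. -/
lemma generator_le [∀ i, IsProbabilityMeasure (ν i)] (ha : ∀ i, 0 < a i) (hA1 : AssumptionA1 ν)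
    (hA2 : AssumptionA2 ν) {f : (Fin d → ℕ) → ℝ} {x : Fin d → ℕ} {B : ℝ} (hB : 0 ≤ B)
    (h : ∀ i z, x i ≠ 0 → (-1 ≤ z i ∧ ∀ j, j ≠ i → 0 ≤ z j) →
      x i * (f (addReplacement x z) - f x) ≤ B * (1 + l1 z) ^ 4) :
    generator a ν f x ≤ B * momentRate a ν := by
  unfold generator momentRate
  rw [Finset.mul_sum]
  refine Finset.sum_le_sum fun i _ => ?_
  rw [mul_assoc, mul_left_comm B]
  refine mul_le_mul_of_nonneg_left ?_ (ha i).le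
  rw [← integral_const_mul, ← integral_const_mul]
  by_cases hi : x i = 0
  · simp only [hi, Nat.cast_zero, zero_mul, integral_zero]
    exact integral_nonneg fun z => by positivity
  -- A non-integrable increment has integral `0` by convention, and the right-hand side is
  -- nonnegative.
  by_cases hint : Integrable (fun z => (x i : ℝ) * (f (addReplacement x z) - f x)) (ν i)
  · refine integral_mono_ae hint ((integrable_one_add_l1_pow hA1 i).const_mul _) ?_
    filter_upwards [hA2 i] with z hz using h i z hi hz
  · rw [integral_undef hint]
    exact integral_nonneg fun z => by positivity

lemma abs_generator_le [∀ i, IsProbabilityMeasure (ν i)] (ha : ∀ i, 0 < a i)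
    (hA1 : AssumptionA1 ν) (hA2 : AssumptionA2 ν) {f : (Fin d → ℕ) → ℝ} {x : Fin d → ℕ} {B : ℝ}
    (hB : 0 ≤ B)
    (h : ∀ i z, x i ≠ 0 → (-1 ≤ z i ∧ ∀ j, j ≠ i → 0 ≤ z j) →
      x i * |f (addReplacement x z) - f x| ≤ B * (1 + l1 z) ^ 4) :
    |generator a ν f x| ≤ B * momentRate a ν := by
  rw [abs_le']
  refine ⟨generator_le ha hA1 hA2 hB fun i z hi hz => le_trans ?_ (h i z hi hz), ?_⟩
  · gcongr
    exact le_abs_self _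
  · have : -generator a ν f x = generator a ν (fun y => - f y) x := by
      unfold generator
      rw [← Finset.sum_neg_distrib]
      refine Finset.sum_congr rfl fun i _ => ?_
      rw [← mul_neg, ← integral_neg]
      congr 2
      funext z
      ring
    rw [this]
    refine generator_le ha hA1 hA2 hB fun i z hi hz => le_trans ?_ (h i z hi hz)
    gcongr
    rw [← neg_sub', ]
    exact neg_le_abs _

/-- The weight `(1 + |x|)^4`. -/
def weight (x : Fin d → ℕ) : ℝ := (1 + total x) ^ 4

lemma weight_pos (x : Fin d → ℕ) : 0 < weight x := by
  have := total_nonneg x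
  unfold weight
  positivity

lemma mul_pow_three_le_weight (x : Fin d → ℕ) (i : Fin d) :
    x i * (1 + total x) ^ 3 ≤ weight x := by
  have h0 := total_nonneg x
  have := coord_le_total x i
  calc x i * (1 + total x) ^ 3 ≤ (1 + total x) * (1 + total x) ^ 3 := by gcongr; linarith
    _ = weight x := by unfold weight; ring

namespace IsForwardSolution

/-- Lyapunov bound: the generator applied to (1+|x|)^4 is at most a multiple of it, because an
increment of order (1+|x|)^3 is multiplied by a jump rate of order |x|. Truncating at N keeps the
inequality, and N minus the truncated weight has finite support, so the forward equation applies to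
it. -/
lemma integral_min_weight_le (hP : IsForwardSolution a ν x₀ P) [∀ i, IsProbabilityMeasure (ν i)]
    (ha : ∀ i, 0 < a i) (hA1 : AssumptionA1 ν) (hA2 : AssumptionA2 ν) {N : ℝ} (hN : 1 ≤ N)
    {t : ℝ} (ht : 0 ≤ t) :
    ∫ x, min (weight x) N ∂(P t) ≤ Real.exp (momentRate a ν * t) * weight x₀ := by
  let g : (Fin d → ℕ) → ℝ := fun x => N - min (weight x) N
  have hg : g.support.Finite := by
    refine (finite_total_le N).subset fun x hx => ?_
    by_contra h
    have h1 : N < total x := not_le.1 h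
    have h2 : N ≤ weight x :=
      calc N ≤ 1 + total x := by linarith
        _ ≤ weight x := le_self_pow₀ (by linarith) (by norm_num)
    exact hx (by simp [g, h2])
  have hgen : ∀ x, -generator a ν g x ≤ momentRate a ν * (N - g x) := by
    intro x
    have hneg : -generator a ν g x = generator a ν (fun x => min (weight x) N) x := by
      unfold generator
      rw [← Finset.sum_neg_distrib]
      refine Finset.sum_congr rfl fun i _ => ?_
      rw [← mul_neg, ← integral_neg]
      congr 2
      funext z
      simp only [g]
      ring
    rw [hneg, mul_comm]
    have hmin : 0 ≤ min (weight x) N := le_min (weight_pos x).le (by linarith)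
    have : N - g x = min (weight x) N := by simp [g]
    rw [this]
    refine generator_le ha hA1 hA2 hmin fun i z hi hz => ?_
    have hl := l1_nonneg z
    -- Where the weight is already above N, its truncation cannot increase; elsewhere the
    -- untruncated increment is estimated.
    rcases le_total N (weight x) with hw | hw
    · rw [min_eq_right hw]
      have h1 : min (weight (addReplacement x z)) N - N ≤ 0 := by
        have := min_le_right (weight (addReplacement x z)) N
        linarith
      have h2 := mul_nonpos_of_nonneg_of_nonpos (Nat.cast_nonneg (α := ℝ) (x i)) h1
      have h3 : 0 ≤ N * (1 + l1 z) ^ 4 := by positivity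
      linarith
    · rw [min_eq_left hw]
      have h1 : min (weight (addReplacement x z)) N ≤ (1 + total x + l1 z) ^ 4 := by
        refine (min_le_left _ _).trans ?_
        have h2 := (abs_le.1 (abs_total_addReplacement_sub_le hi hz)).2
        have := total_nonneg x
        have := total_nonneg (addReplacement x z)
        exact pow_le_pow_left₀ (by linarith) (by linarith) 4
      have h2 : (1 + total x + l1 z) ^ 4 - weight x ≤ (1 + total x) ^ 3 * (1 + l1 z) ^ 4 := by
        have h3 : 1 ≤ 1 + total x := by linarith [total_nonneg x]
        unfold weight
        generalize 1 + total x = u at h3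
        generalize l1 z = v at hl
        have e1 : u ^ 2 * v ^ 2 ≤ u ^ 3 * v ^ 2 := by gcongr; norm_num
        have e2 : u * v ^ 3 ≤ u ^ 3 * v ^ 3 := by
          gcongr; exact le_self_pow₀ h3 (by norm_num)
        have e3 : v ^ 4 ≤ u ^ 3 * v ^ 4 := le_mul_of_one_le_left (by positivity) (one_le_pow₀ h3)
        have e4 : 0 ≤ u ^ 3 := by positivity
        nlinarith
      calc (x i : ℝ) * (min (weight (addReplacement x z)) N - weight x)
          ≤ x i * ((1 + total x) ^ 3 * (1 + l1 z) ^ 4) := by gcongr; linarith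
        _ = (x i * (1 + total x) ^ 3) * (1 + l1 z) ^ 4 := by ring
        _ ≤ weight x * (1 + l1 z) ^ 4 := by gcongr; exact mul_pow_three_le_weight x i
  have hcg := hP.continuousOn_integral hA2 hg
  let c := momentRate a ν
  -- Grönwall's inequality: the truncated mean, discounted by `exp (-(c * s))`, is nonincreasing.
  let v : ℝ → ℝ := fun s => Real.exp (-(c * s)) * (N - ∫ x, g x ∂(P s))
  have hanti : AntitoneOn v (Set.Ici 0) := by
    have hde : ∀ s, HasDerivAt (fun s => Real.exp (-(c * s))) (Real.exp (-(c * s)) * (-c)) s := by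
      intro s
      simpa using (((hasDerivAt_id s).const_mul c).neg).exp
    have hdv : ∀ s ∈ interior (Set.Ici (0 : ℝ)), HasDerivAt v
        (Real.exp (-(c * s)) * (-c) * (N - ∫ x, g x ∂(P s)) +
          Real.exp (-(c * s)) * (-∫ x, generator a ν g x ∂(P s))) s := by
      intro s hs
      rw [interior_Ici] at hs
      exact (hde s).mul ((hP.hasDerivAt_integral hA2 hg hs).const_sub N)
    refine antitoneOn_of_deriv_nonpos (convex_Ici 0) ?_ ?_ ?_
    · exact (Continuous.continuousOn (by fun_prop)).mul (continuousOn_const.sub hcg)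
    · exact fun s hs => (hdv s hs).differentiableAt.differentiableWithinAt
    · intro s hs
      rw [(hdv s hs).deriv]
      have := hP.prob s
      have hi1 := hP.integrable_of_finite_support hg s
      have hi2 := hP.integrable_of_finite_support (generator_support_finite (a := a) hA2 hg) s
      have h1 : -∫ x, generator a ν g x ∂(P s) ≤ c * (N - ∫ x, g x ∂(P s)) := by
        rw [← integral_neg]
        calc ∫ x, -generator a ν g x ∂(P s) ≤ ∫ x, c * (N - g x) ∂(P s) :=
              integral_mono hi2.neg (((integrable_const N).sub hi1).const_mul c) hgen
          _ = c * (N - ∫ x, g x ∂(P s)) := by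
              rw [integral_const_mul, integral_sub (integrable_const N) hi1]
              simp
      have h2 : 0 < Real.exp (-(c * s)) := Real.exp_pos _
      nlinarith
  have hv := hanti Set.self_mem_Ici (Set.mem_Ici.2 ht) ht
  have hE : ∀ s, ∫ x, min (weight x) N ∂(P s) = N - ∫ x, g x ∂(P s) := by
    intro s
    have := hP.prob s
    have h1 : ∫ x, min (weight x) N ∂(P s) = ∫ x, (N - g x) ∂(P s) := by simp [g]
    rw [h1, integral_sub (integrable_const N) (hP.integrable_of_finite_support hg s)]
    simp
  have h0 : v 0 ≤ weight x₀ := by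
    have h1 : ∫ x, g x ∂(P 0) = g x₀ := by simpa using hP.forward g hg 0 le_rfl
    simp only [v, h1, mul_zero, neg_zero, Real.exp_zero, one_mul, g, sub_sub_cancel]
    exact min_le_left _ _
  rw [hE t]
  have h1 : Real.exp (c * t) * v t = N - ∫ x, g x ∂(P t) := by
    simp only [v, ← mul_assoc, ← Real.exp_add]
    simp
  rw [← h1]
  exact mul_le_mul_of_nonneg_left (hv.trans h0) (Real.exp_pos _).le

/-- Fatou's lemma as the truncation level tends to infinity. The rate `momentRate a ν` depends on
the laws ν beyond Ξ_4, so this bound serves only for integrability and finiteness and never enters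
the final constant. -/
theorem integrable_weight (hP : IsForwardSolution a ν x₀ P) [∀ i, IsProbabilityMeasure (ν i)]
    (ha : ∀ i, 0 < a i) (hA1 : AssumptionA1 ν) (hA2 : AssumptionA2 ν) {t : ℝ} (ht : 0 ≤ t) :
    Integrable weight (P t) ∧
      ∫ x, weight x ∂(P t) ≤ Real.exp (momentRate a ν * t) * weight x₀ := by
  have := hP.prob t
  set R := Real.exp (momentRate a ν * t) * weight x₀
  have hR : 0 ≤ R := mul_nonneg (Real.exp_pos _).le (weight_pos _).le
  have hlim : ∀ x : Fin d → ℕ, Tendsto (fun n : ℕ => ENNReal.ofReal (min (weight x) (n + 1))) atTop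
      (𝓝 (ENNReal.ofReal (weight x))) := fun x => by
    refine tendsto_const_nhds.congr' ?_
    filter_upwards [eventually_ge_atTop ⌈weight x⌉₊] with n hn
    rw [min_eq_left]
    have := Nat.ceil_le.1 hn
    linarith
  have hlint : ∫⁻ x, ENNReal.ofReal (weight x) ∂(P t) ≤ ENNReal.ofReal R := by
    calc ∫⁻ x, ENNReal.ofReal (weight x) ∂(P t)
        = ∫⁻ x, liminf (fun n : ℕ => ENNReal.ofReal (min (weight x) (n + 1))) atTop ∂(P t) := by
          simp_rw [fun x => (hlim x).liminf_eq]
      _ ≤ liminf (fun n : ℕ => ∫⁻ x, ENNReal.ofReal (min (weight x) (n + 1)) ∂(P t)) atTop :=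
          lintegral_liminf_le fun n => Measurable.of_discrete
      _ ≤ ENNReal.ofReal R := by
          refine liminf_le_of_frequently_le' (Frequently.of_forall fun n => ?_)
          have hpos : ∀ x : Fin d → ℕ, 0 ≤ min (weight x) ((n : ℝ) + 1) := fun x =>
            le_min (weight_pos x).le (by positivity)
          rw [← ofReal_integral_eq_lintegral_ofReal
            (hP.integrable_of_bounded (C := n + 1) (fun x => by
              rw [abs_of_nonneg (hpos x)]; exact min_le_right _ _) t) (ae_of_all _ hpos)]
          exact ENNReal.ofReal_le_ofReal
            (hP.integral_min_weight_le ha hA1 hA2 (by simp) ht)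
  have hint : Integrable weight (P t) := by
    refine ⟨Measurable.of_discrete.aestronglyMeasurable, ?_⟩
    rw [hasFiniteIntegral_iff_ofReal (ae_of_all _ fun x => (weight_pos x).le)]
    exact hlint.trans_lt ENNReal.ofReal_lt_top
  refine ⟨hint, ?_⟩
  rw [← ofReal_integral_eq_lintegral_ofReal hint (ae_of_all _ fun x => (weight_pos x).le)] at hlint
  exact (ENNReal.ofReal_le_ofReal_iff hR).1 hlint

end IsForwardSolution
end
end BranchingMoments

namespace BranchingMoments
noncomputable section

variable {d : ℕ} {a : Fin d → ℝ} {ν : Fin d → Measure (Fin d → ℤ)}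
  {x₀ : Fin d → ℕ} {P : ℝ → Measure (Fin d → ℕ)}

/-! ### Extension to test functions of polynomial growth -/

/-- The tent function that cuts off compositions with more than `n + 1` particles. -/
def cutoff (n : ℕ) (x : Fin d → ℕ) : ℝ := max 0 (1 - total x / (n + 1))

lemma cutoff_nonneg (n : ℕ) (x : Fin d → ℕ) : 0 ≤ cutoff n x := le_max_left _ _

lemma cutoff_le_one (n : ℕ) (x : Fin d → ℕ) : cutoff n x ≤ 1 := by
  have := total_nonneg x
  refine max_le zero_le_one ?_
  have : 0 ≤ total x / (n + 1) := by positivity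
  linarith

lemma cutoff_eq_zero {n : ℕ} {x : Fin d → ℕ} (h : (n : ℝ) + 1 ≤ total x) : cutoff n x = 0 := by
  refine max_eq_left ?_
  rw [sub_nonpos, le_div_iff₀ (by positivity)]
  linarith

lemma tendsto_cutoff (x : Fin d → ℕ) : Tendsto (fun n => cutoff n x) atTop (𝓝 1) := by
  have h0 : Tendsto (fun n : ℕ => total x * ((1 : ℝ) / (n + 1))) atTop (𝓝 (total x * 0)) :=
    tendsto_one_div_add_atTop_nhds_zero_nat.const_mul _
  have h1 := (tendsto_const_nhds (x := (0 : ℝ))).max ((tendsto_const_nhds (x := (1 : ℝ))).sub h0)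
  simpa [cutoff, div_eq_mul_inv] using h1

/-- The tent has slope 1/(n+1) and matters only for |x| ≤ n+2, so the factor |x| from the jump rate
is compensated uniformly in n. -/
lemma total_mul_abs_cutoff_sub_le (n : ℕ) {x : Fin d → ℕ} {z : Fin d → ℤ} {i : Fin d}
    (hx : x i ≠ 0) (hz : -1 ≤ z i ∧ ∀ j, j ≠ i → 0 ≤ z j) :
    total x * |cutoff n (addReplacement x z) - cutoff n x| ≤ 2 * l1 z := by
  have hn : (0 : ℝ) < n + 1 := by positivity
  have hl := l1_nonneg z
  -- Above n+2 one jump cannot bring the total below n+1, so both cutoff values vanish.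
  rcases lt_or_ge ((n : ℝ) + 2) (total x) with h | h
  · have h1 := total_le_total_addReplacement hx hz
    rw [cutoff_eq_zero (x := x) (by linarith), cutoff_eq_zero (by linarith)]
    simpa using hl
  · have h1 : |cutoff n (addReplacement x z) - cutoff n x| ≤ l1 z / (n + 1) := by
      unfold cutoff
      refine (abs_max_sub_max_le_max _ _ _ _).trans (max_le (by simp; positivity) ?_)
      have : 1 - total (addReplacement x z) / (n + 1) - (1 - total x / (n + 1)) =
          -((total (addReplacement x z) - total x) / (n + 1)) := by ring
      rw [this, abs_neg, abs_div, abs_of_pos hn]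
      gcongr
      exact abs_total_addReplacement_sub_le hx hz
    calc total x * |cutoff n (addReplacement x z) - cutoff n x|
        ≤ (n + 2) * (l1 z / (n + 1)) := by
          gcongr
      _ ≤ (2 * (n + 1)) * (l1 z / (n + 1)) := by
          gcongr
          linarith
      _ = 2 * l1 z := by field_simp

/-- Test functions of growth at most `(1 + |x|)^4`, with increments of order `(1 + |x|)^3`. -/
structure HasGrowth (K : ℝ) (f : (Fin d → ℕ) → ℝ) : Prop where
  bound : ∀ x, |f x| ≤ K * weight x
  incr : ∀ x i z, x i ≠ 0 → (-1 ≤ z i ∧ ∀ j, j ≠ i → 0 ≤ z j) →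
    |f (addReplacement x z) - f x| ≤ K * (1 + total x) ^ 3 * (1 + l1 z) ^ 4

namespace HasGrowth

variable {K : ℝ} {f : (Fin d → ℕ) → ℝ}

/-- Product rule for increments: one term carries the increment of f, the other that of the cutoff.
The bound is independent of n, which makes it a dominating function. -/
lemma mul_incr_cutoff_le (hf : HasGrowth K f) (hK : 0 ≤ K) (n : ℕ) {x : Fin d → ℕ}
    {z : Fin d → ℤ} {i : Fin d} (hx : x i ≠ 0) (hz : -1 ≤ z i ∧ ∀ j, j ≠ i → 0 ≤ z j) :
    x i * |f (addReplacement x z) * cutoff n (addReplacement x z) - f x * cutoff n x| ≤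
      3 * K * weight x * (1 + l1 z) ^ 4 := by
  set y := addReplacement x z
  have hl := l1_nonneg z
  have ht := total_nonneg x
  have hw := weight_pos x
  have e1 : f y * cutoff n y - f x * cutoff n x =
    (f y - f x) * cutoff n y + f x * (cutoff n y - cutoff n x) := by ring
  have e2 : |f y * cutoff n y - f x * cutoff n x| ≤
      K * (1 + total x) ^ 3 * (1 + l1 z) ^ 4 + K * weight x * |cutoff n y - cutoff n x| := by
    rw [e1]
    refine (abs_add_le _ _).trans (add_le_add ?_ ?_)
    · rw [abs_mul, abs_of_nonneg (cutoff_nonneg n y)]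
      refine (mul_le_of_le_one_right (abs_nonneg _) (cutoff_le_one n y)).trans (hf.incr x i z hx hz)
    · rw [abs_mul]
      exact mul_le_mul_of_nonneg_right (hf.bound x) (abs_nonneg _)
  have e3 : 2 * l1 z ≤ 2 * (1 + l1 z) ^ 4 := by
    have : 1 + l1 z ≤ (1 + l1 z) ^ 4 := le_self_pow₀ (by linarith) (by norm_num)
    linarith
  calc x i * |f y * cutoff n y - f x * cutoff n x|
      ≤ x i * (K * (1 + total x) ^ 3 * (1 + l1 z) ^ 4 + K * weight x * |cutoff n y - cutoff n x|) := by
        gcongr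
    _ = K * (x i * (1 + total x) ^ 3) * (1 + l1 z) ^ 4
        + K * weight x * (x i * |cutoff n y - cutoff n x|) := by ring
    _ ≤ K * weight x * (1 + l1 z) ^ 4 + K * weight x * (total x * |cutoff n y - cutoff n x|) := by
        gcongr
        · exact mul_pow_three_le_weight x i
        · exact coord_le_total x i
    _ ≤ K * weight x * (1 + l1 z) ^ 4 + K * weight x * (2 * (1 + l1 z) ^ 4) := by
        exact add_le_add le_rfl (mul_le_mul_of_nonneg_left
          ((total_mul_abs_cutoff_sub_le n hx hz).trans e3) (mul_nonneg hK hw.le))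
    _ = 3 * K * weight x * (1 + l1 z) ^ 4 := by ring

lemma abs_generator_cutoff_le [∀ i, IsProbabilityMeasure (ν i)] (ha : ∀ i, 0 < a i)
    (hA1 : AssumptionA1 ν) (hA2 : AssumptionA2 ν) (hf : HasGrowth K f) (hK : 0 ≤ K) (n : ℕ)
    (x : Fin d → ℕ) :
    |generator a ν (fun y => f y * cutoff n y) x| ≤ 3 * K * weight x * momentRate a ν := by
  have hw := weight_pos x
  exact abs_generator_le ha hA1 hA2 (by positivity) fun i z hx hz =>
    hf.mul_incr_cutoff_le hK n hx hz

lemma integrable_incr [∀ i, IsProbabilityMeasure (ν i)] (hA1 : AssumptionA1 ν)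
    (hA2 : AssumptionA2 ν) (hf : HasGrowth K f) {x : Fin d → ℕ} {i : Fin d} (hx : x i ≠ 0) :
    Integrable (fun z => f (addReplacement x z) - f x) (ν i) := by
  refine ((integrable_one_add_l1_pow hA1 i).const_mul (K * (1 + total x) ^ 3)).mono'
    Measurable.of_discrete.aestronglyMeasurable ?_
  filter_upwards [hA2 i] with z hz using hf.incr x i z hx hz

lemma tendsto_generator_cutoff [∀ i, IsProbabilityMeasure (ν i)]
    (hA1 : AssumptionA1 ν) (hA2 : AssumptionA2 ν) (hf : HasGrowth K f) (hK : 0 ≤ K)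
    (x : Fin d → ℕ) :
    Tendsto (fun n => generator a ν (fun y => f y * cutoff n y) x) atTop
      (𝓝 (generator a ν f x)) := by
  refine tendsto_finsetSum _ fun i _ => ?_
  by_cases hx : x i = 0
  · simp [hx]
  refine Tendsto.const_mul _ ?_
  refine tendsto_integral_of_dominated_convergence
    (fun z => 3 * K * weight x * (1 + l1 z) ^ 4) (fun n => Measurable.of_discrete.aestronglyMeasurable)
    ((integrable_one_add_l1_pow hA1 i).const_mul _) (fun n => ?_) (ae_of_all _ fun z => ?_)
  · filter_upwards [hA2 i] with z hz
    refine le_trans ?_ (hf.mul_incr_cutoff_le hK n hx hz)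
    refine le_mul_of_one_le_left (norm_nonneg _) ?_
    exact_mod_cast Nat.one_le_iff_ne_zero.2 hx
  · simpa using ((tendsto_cutoff (addReplacement x z)).const_mul (f (addReplacement x z))).sub
      ((tendsto_cutoff x).const_mul (f x))

end HasGrowth

namespace IsForwardSolution

lemma integrable_of_le_weight (hP : IsForwardSolution a ν x₀ P)
    [∀ i, IsProbabilityMeasure (ν i)] (ha : ∀ i, 0 < a i) (hA1 : AssumptionA1 ν)
    (hA2 : AssumptionA2 ν) {f : (Fin d → ℕ) → ℝ} {K : ℝ} (hf : ∀ x, |f x| ≤ K * weight x)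
    {t : ℝ} (ht : 0 ≤ t) : Integrable f (P t) :=
  ((hP.integrable_weight ha hA1 hA2 ht).1.const_mul K).mono'
    Measurable.of_discrete.aestronglyMeasurable (ae_of_all _ hf)

/-- The finitely supported case is applied to F times the cutoff, and n tends to infinity by
dominated convergence: over jumps inside the generator, over compositions with a multiple of the
weight as dominating function, and over time with a constant. -/
theorem forward_of_growth (hP : IsForwardSolution a ν x₀ P)
    [∀ i, IsProbabilityMeasure (ν i)] (ha : ∀ i, 0 < a i) (hA1 : AssumptionA1 ν)
    (hA2 : AssumptionA2 ν) {F F' : ℝ → (Fin d → ℕ) → ℝ} {T K : ℝ} (hT : 0 ≤ T) (hK : 0 ≤ K)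
    (hF : ∀ s ∈ Set.Icc 0 T, HasGrowth K (F s))
    (hF' : ∀ s ∈ Set.Icc 0 T, ∀ x, |F' s x| ≤ K * weight x)
    (hd : ∀ y s, HasDerivAt (fun s => F s y) (F' s y) s) (hc : ∀ y, Continuous fun s => F' s y) :
    IntervalIntegrable (fun s => ∫ x, (F' s x + generator a ν (F s) x) ∂(P s)) volume 0 T ∧
    ∫ x, F T x ∂(P T) = F 0 x₀ + ∫ s in (0 : ℝ)..T, ∫ x, (F' s x + generator a ν (F s) x) ∂(P s) := by
  let h : ℕ → ℝ → (Fin d → ℕ) → ℝ := fun n s x =>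
    F' s x * cutoff n x + generator a ν (fun y => F s y * cutoff n y) x
  have hfin : ∀ n : ℕ, ContinuousOn (fun s => ∫ x, h n s x ∂(P s)) (Set.Ici 0) ∧
      ∫ x, F T x * cutoff n x ∂(P T) = F 0 x₀ * cutoff n x₀ +
        ∫ s in (0 : ℝ)..T, ∫ x, h n s x ∂(P s) := by
    intro n
    have hS : ∀ x : Fin d → ℕ, x ∉ (finite_total_le ((n : ℝ) + 1)).toFinset → cutoff n x = 0 := by
      intro x hx
      rw [Set.Finite.mem_toFinset] at hx
      exact cutoff_eq_zero (not_le.1 hx).le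
    exact hP.forward_time_dependent hA2 (finite_total_le ((n : ℝ) + 1)).toFinset
      (F := fun s x => F s x * cutoff n x) (F' := fun s x => F' s x * cutoff n x)
      (fun s y hy => by simp only [hS y hy, mul_zero]) (fun s y hy => by simp only [hS y hy, mul_zero])
      (fun y s => (hd y s).mul_const _) (fun y => (hc y).mul continuous_const) hT
  let B := K + 3 * K * momentRate a ν
  have hB : 0 ≤ B := by
    have := momentRate_nonneg (ν := ν) ha
    positivity
  have hhb : ∀ n, ∀ s ∈ Set.Icc 0 T, ∀ x, |h n s x| ≤ B * weight x := by
    intro n s hs x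
    have h1 : |F' s x * cutoff n x| ≤ K * weight x := by
      rw [abs_mul, abs_of_nonneg (cutoff_nonneg n x)]
      exact (mul_le_of_le_one_right (abs_nonneg _) (cutoff_le_one n x)).trans (hF' s hs x)
    have h2 := (hF s hs).abs_generator_cutoff_le ha hA1 hA2 hK n x
    calc |h n s x| ≤ K * weight x + 3 * K * weight x * momentRate a ν :=
          (abs_add_le _ _).trans (add_le_add h1 h2)
      _ = B * weight x := by ring
  have hlim : ∀ s ∈ Set.Icc 0 T, Tendsto (fun n => ∫ x, h n s x ∂(P s)) atTop
      (𝓝 (∫ x, (F' s x + generator a ν (F s) x) ∂(P s))) := by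
    intro s hs
    refine tendsto_integral_of_dominated_convergence (fun x => B * weight x)
      (fun n => Measurable.of_discrete.aestronglyMeasurable)
      ((hP.integrable_weight ha hA1 hA2 hs.1).1.const_mul _)
      (fun n => ae_of_all _ (hhb n s hs)) (ae_of_all _ fun x => ?_)
    have h1 := (tendsto_cutoff x).const_mul (F' s x)
    rw [mul_one] at h1
    exact h1.add ((hF s hs).tendsto_generator_cutoff hA1 hA2 hK x)
  let D := B * (Real.exp (momentRate a ν * T) * weight x₀)
  have hbd : ∀ n, ∀ s ∈ Set.Icc 0 T, ‖∫ x, h n s x ∂(P s)‖ ≤ D := by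
    intro n s hs
    have hw := hP.integrable_weight ha hA1 hA2 hs.1
    calc ‖∫ x, h n s x ∂(P s)‖ ≤ ∫ x, B * weight x ∂(P s) :=
          norm_integral_le_of_norm_le (hw.1.const_mul _) (ae_of_all _ (hhb n s hs))
      _ = B * ∫ x, weight x ∂(P s) := integral_const_mul _ _
      _ ≤ B * (Real.exp (momentRate a ν * s) * weight x₀) := by gcongr; exact hw.2
      _ ≤ D := by
        have := momentRate_nonneg (ν := ν) ha
        have := (weight_pos x₀).le
        simp only [D]
        gcongr
        exact hs.2
  have hsub : Set.uIoc 0 T ⊆ Set.Icc 0 T := by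
    rw [Set.uIoc_of_le hT]; exact Set.Ioc_subset_Icc_self
  have hmeas : ∀ n, AEStronglyMeasurable (fun s => ∫ x, h n s x ∂(P s))
      (volume.restrict (Set.uIoc 0 T)) := fun n =>
    ((hfin n).1.mono (hsub.trans Set.Icc_subset_Ici_self)).aestronglyMeasurable measurableSet_uIoc
  have hmeas' : AEStronglyMeasurable (fun s => ∫ x, (F' s x + generator a ν (F s) x) ∂(P s))
      (volume.restrict (Set.uIoc 0 T)) := by
    refine aestronglyMeasurable_of_tendsto_ae atTop hmeas ?_
    exact (ae_restrict_iff' measurableSet_uIoc).2 (ae_of_all _ fun s hs => hlim s (hsub hs))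
  have hii : IntervalIntegrable (fun s => ∫ x, (F' s x + generator a ν (F s) x) ∂(P s)) volume 0 T := by
    refine (intervalIntegrable_const (c := D)).mono_fun hmeas' ?_
    refine (ae_restrict_iff' measurableSet_uIoc).2 (ae_of_all _ fun s hs => ?_)
    exact (le_of_tendsto (hlim s (hsub hs)).norm
      (Eventually.of_forall fun n => hbd n s (hsub hs))).trans (Real.le_norm_self D)
  refine ⟨hii, ?_⟩
  have hT' : T ∈ Set.Icc 0 T := ⟨hT, le_rfl⟩
  have hL : Tendsto (fun n => ∫ x, F T x * cutoff n x ∂(P T)) atTop (𝓝 (∫ x, F T x ∂(P T))) := by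
    refine tendsto_integral_of_dominated_convergence (fun x => K * weight x)
      (fun n => Measurable.of_discrete.aestronglyMeasurable)
      ((hP.integrable_weight ha hA1 hA2 hT).1.const_mul _)
      (fun n => ae_of_all _ fun x => ?_) (ae_of_all _ fun x => ?_)
    · rw [norm_mul, Real.norm_of_nonneg (cutoff_nonneg n x)]
      exact (mul_le_of_le_one_right (norm_nonneg _) (cutoff_le_one n x)).trans ((hF T hT').bound x)
    · simpa using (tendsto_cutoff x).const_mul (F T x)
  have hR : Tendsto (fun n => F 0 x₀ * cutoff n x₀ + ∫ s in (0 : ℝ)..T, ∫ x, h n s x ∂(P s)) atTop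
      (𝓝 (F 0 x₀ + ∫ s in (0 : ℝ)..T, ∫ x, (F' s x + generator a ν (F s) x) ∂(P s))) := by
    have h1 := (tendsto_cutoff x₀).const_mul (F 0 x₀)
    rw [mul_one] at h1
    refine h1.add ?_
    exact intervalIntegral.tendsto_integral_filter_of_dominated_convergence (fun _ => D)
      (Eventually.of_forall hmeas)
      (Eventually.of_forall fun n => ae_of_all _ fun s hs => hbd n s (hsub hs))
      intervalIntegrable_const (ae_of_all _ fun s hs => hlim s (hsub hs))
  refine tendsto_nhds_unique hL ?_
  simp_rw [fun n => (hfin n).2]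
  exact hR

end IsForwardSolution
end
end BranchingMoments

namespace BranchingMoments
noncomputable section

variable {d : ℕ} {a : Fin d → ℝ} {ν : Fin d → Measure (Fin d → ℤ)}
  {x₀ : Fin d → ℕ} {P : ℝ → Measure (Fin d → ℕ)}
  {E : Type*} [NormedAddCommGroup E] [InnerProductSpace ℝ E]

/-! ### Dynkin's formula for functions of linear martingales -/

/-- A composition as a vector of `ℝ^d`. -/
def natVec (x : Fin d → ℕ) : Fin d → ℝ := fun k => (x k : ℝ)

/-- A replacement vector as a vector of `ℝ^d`. -/
def intVec (z : Fin d → ℤ) : Fin d → ℝ := fun k => (z k : ℝ)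

lemma natVec_addReplacement {x : Fin d → ℕ} {z : Fin d → ℤ} {i : Fin d} (hx : x i ≠ 0)
    (hz : -1 ≤ z i ∧ ∀ j, j ≠ i → 0 ≤ z j) :
    natVec (addReplacement x z) = natVec x + intVec z :=
  funext fun k => addReplacement_cast hx hz k

lemma integrable_coord [∀ i, IsProbabilityMeasure (ν i)] (hA1 : AssumptionA1 ν) (i k : Fin d) :
    Integrable (fun z : Fin d → ℤ => ((z k : ℤ) : ℝ)) (ν i) := by
  refine (integrable_one_add_l1_pow hA1 i).mono' Measurable.of_discrete.aestronglyMeasurable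
    (ae_of_all _ fun z => ?_)
  have h1 : 1 + l1 z ≤ (1 + l1 z) ^ 4 :=
    le_self_pow₀ (by linarith [l1_nonneg z]) (by norm_num)
  have h2 := le_l1 z k
  rw [Real.norm_eq_abs]
  linarith

lemma linear_apply_eq_sum (ℓ : (Fin d → ℝ) →ₗ[ℝ] E) (x : Fin d → ℝ) :
    ℓ x = ∑ k, x k • ℓ (Pi.single k 1) := by
  conv_lhs => rw [pi_eq_sum_univ x, map_sum]
  refine Finset.sum_congr rfl fun k _ => ?_
  rw [map_smul]
  congr 2
  funext j
  simp [Pi.single_apply, eq_comm]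

lemma integrable_linear [∀ i, IsProbabilityMeasure (ν i)] (hA1 : AssumptionA1 ν) (i : Fin d)
    (ℓ : (Fin d → ℝ) →ₗ[ℝ] ℝ) : Integrable (fun z => ℓ (intVec z)) (ν i) := by
  simp only [fun z => linear_apply_eq_sum ℓ (intVec z)]
  exact integrable_finsetSum _ fun k _ => (integrable_coord hA1 i k).mul_const _

lemma integral_linear [∀ i, IsProbabilityMeasure (ν i)] (hA1 : AssumptionA1 ν) (i : Fin d)
    (ℓ : (Fin d → ℝ) →ₗ[ℝ] ℝ) :
    ∫ z, ℓ (intVec z) ∂(ν i) = ℓ fun k => ∫ z, ((z k : ℤ) : ℝ) ∂(ν i) := by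
  simp only [fun z => linear_apply_eq_sum ℓ (intVec z), smul_eq_mul, intVec]
  rw [linear_apply_eq_sum, integral_finsetSum _ fun k _ => (integrable_coord hA1 i k).mul_const _]
  exact Finset.sum_congr rfl fun k _ => integral_mul_const _ _

/-- The drift of a linear function is that function of Ax; this is where the mean matrix enters. -/
lemma sum_integral_linear [∀ i, IsProbabilityMeasure (ν i)] (hA1 : AssumptionA1 ν)
    (ℓ : (Fin d → ℝ) →ₗ[ℝ] ℝ) (x : Fin d → ℕ) :
    ∑ i, a i * x i * ∫ z, ℓ (intVec z) ∂(ν i) = ℓ (meanMatrix a ν *ᵥ natVec x) := by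
  simp_rw [integral_linear hA1, ← smul_eq_mul (a := a _ * _), ← map_smul, ← map_sum]
  congr 1
  funext k
  simp only [Finset.sum_apply, Pi.smul_apply, smul_eq_mul, Matrix.mulVec, dotProduct, meanMatrix,
    Matrix.of_apply, natVec]
  exact Finset.sum_congr rfl fun i _ => by ring

/-- Smooth functions of growth of order four, given with their derivative. -/
structure IsTestFunction (c : ℝ) (φ : E → ℝ) (Dφ : E → E →L[ℝ] ℝ) : Prop where
  nonneg : 0 ≤ c
  hasFDerivAt : ∀ y, HasFDerivAt φ (Dφ y) y
  continuous : Continuous Dφ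
  bound : ∀ y, |φ y| ≤ c * (1 + ‖y‖) ^ 4
  incr : ∀ y η, |φ (y + η) - φ y| ≤ c * (1 + ‖y‖) ^ 3 * (1 + ‖η‖) ^ 4
  deriv_bound : ∀ y η, |Dφ y η| ≤ c * (1 + ‖y‖) ^ 3 * ‖η‖

/-- A family of linear maps `G s` of the form `R e^{A (T - s)}`. -/
def IsBackwardFlow (A : Matrix (Fin d) (Fin d) ℝ) (G : ℝ → (Fin d → ℝ) →ₗ[ℝ] E) : Prop :=
  ∀ x s, HasDerivAt (fun s => G s x) (-(G s (A *ᵥ x))) s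

namespace IsBackwardFlow

variable {A : Matrix (Fin d) (Fin d) ℝ} {G : ℝ → (Fin d → ℝ) →ₗ[ℝ] E}

lemma continuous_apply (hG : IsBackwardFlow A G) (x : Fin d → ℝ) : Continuous fun s => G s x :=
  continuous_iff_continuousAt.2 fun s => (hG x s).continuousAt

lemma exists_bound (hG : IsBackwardFlow A G) (T : ℝ) :
    ∃ L, 0 ≤ L ∧ ∀ s ∈ Set.Icc 0 T, ∀ x, ‖G s x‖ ≤ L * ∑ k, |x k| := by
  have h1 : ∀ k : Fin d, ∃ C, ∀ s ∈ Set.Icc 0 T, ‖G s (Pi.single k 1)‖ ≤ C := fun k =>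
    isCompact_Icc.exists_bound_of_continuousOn (hG.continuous_apply _).continuousOn
  choose C hC using h1
  refine ⟨∑ k, |C k|, by positivity, fun s hs x => ?_⟩
  rw [linear_apply_eq_sum, Finset.mul_sum]
  refine (norm_sum_le _ _).trans (Finset.sum_le_sum fun k _ => ?_)
  rw [norm_smul, mul_comm, Real.norm_eq_abs]
  gcongr
  exact ((hC k s hs).trans (le_abs_self _)).trans
    (Finset.single_le_sum (f := fun k => |C k|) (fun _ _ => abs_nonneg _) (Finset.mem_univ k))

end IsBackwardFlow

lemma sum_abs_natVec (x : Fin d → ℕ) : ∑ k, |natVec x k| = total x :=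
  Finset.sum_congr rfl fun _ _ => abs_of_nonneg (Nat.cast_nonneg _)

lemma exists_sum_abs_mulVec_le (A : Matrix (Fin d) (Fin d) ℝ) :
    ∃ L, 0 ≤ L ∧ ∀ x : Fin d → ℝ, ∑ k, |(A *ᵥ x) k| ≤ L * ∑ k, |x k| := by
  refine ⟨∑ k, ∑ j, |A k j|, by positivity, fun x => ?_⟩
  rw [Finset.sum_mul]
  refine Finset.sum_le_sum fun k _ => ?_
  rw [Finset.sum_mul]
  have h : (A *ᵥ x) k = ∑ j, A k j * x j := rfl
  rw [h]
  refine (Finset.abs_sum_le_sum_abs _ _).trans ?_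
  refine Finset.sum_le_sum fun j _ => ?_
  rw [abs_mul]
  gcongr
  exact Finset.single_le_sum (f := fun k => |x k|) (fun _ _ => abs_nonneg _) (Finset.mem_univ j)

lemma IsTestFunction.exists_growth {c : ℝ} {φ : E → ℝ} {Dφ : E → E →L[ℝ] ℝ}
    (hφ : IsTestFunction c φ Dφ) {A : Matrix (Fin d) (Fin d) ℝ} {G : ℝ → (Fin d → ℝ) →ₗ[ℝ] E}
    (hG : IsBackwardFlow A G) (v : E) (T : ℝ) :
    ∃ K, 0 ≤ K ∧ (∀ s ∈ Set.Icc 0 T, HasGrowth K fun x : Fin d → ℕ => φ (G s (natVec x) - v)) ∧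
      ∀ s ∈ Set.Icc 0 T, ∀ x : Fin d → ℕ,
        |Dφ (G s (natVec x) - v) (-(G s (A *ᵥ natVec x)))| ≤ K * weight x := by
  obtain ⟨L, hL0, hL⟩ := hG.exists_bound T
  obtain ⟨α, hα0, hα⟩ := exists_sum_abs_mulVec_le A
  have hc := hφ.nonneg
  let M := 1 + L + ‖v‖
  have hM : 1 ≤ M := by have := norm_nonneg v; simp only [M]; linarith
  have hM0 : 0 ≤ M := by linarith
  have hy : ∀ s ∈ Set.Icc 0 T, ∀ x : Fin d → ℕ, 1 + ‖G s (natVec x) - v‖ ≤ M * (1 + total x) := by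
    intro s hs x
    have h1 := hL s hs (natVec x)
    rw [sum_abs_natVec] at h1
    have h2 := norm_sub_le (G s (natVec x)) v
    have h3 := total_nonneg x
    have h4 := norm_nonneg v
    simp only [M]
    nlinarith [mul_nonneg h4 h3]
  -- The first summand absorbs the increments (powers 3 and 4 of `M`) and the size of φ; the second
  -- absorbs the time derivative (powers 3 and 1, and `α` from applying the matrix).
  refine ⟨c * M ^ 7 + c * M ^ 4 * α, by positivity, fun s hs => ⟨fun x => ?_, fun x i z hx hz => ?_⟩,
    fun s hs x => ?_⟩
  · have hw := weight_pos x
    calc |φ (G s (natVec x) - v)| ≤ c * (1 + ‖G s (natVec x) - v‖) ^ 4 := hφ.bound _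
      _ ≤ c * (M * (1 + total x)) ^ 4 := by gcongr; exact hy s hs x
      _ = c * M ^ 4 * weight x := by unfold weight; ring
      _ ≤ (c * M ^ 7 + c * M ^ 4 * α) * weight x := by
        gcongr
        have : c * M ^ 4 ≤ c * M ^ 7 := by gcongr; norm_num
        have : 0 ≤ c * M ^ 4 * α := by positivity
        linarith
  · have hl := l1_nonneg z
    have ht := total_nonneg x
    have e : G s (natVec (addReplacement x z)) - v = (G s (natVec x) - v) + G s (intVec z) := by
      rw [natVec_addReplacement hx hz, map_add]; abel
    have h1 : 1 + ‖G s (intVec z)‖ ≤ M * (1 + l1 z) := by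
      have h1 : ‖G s (intVec z)‖ ≤ L * l1 z := hL s hs (intVec z)
      have h4 := norm_nonneg v
      simp only [M]
      nlinarith [mul_nonneg h4 hl]
    simp only [e]
    calc |φ (G s (natVec x) - v + G s (intVec z)) - φ (G s (natVec x) - v)|
        ≤ c * (1 + ‖G s (natVec x) - v‖) ^ 3 * (1 + ‖G s (intVec z)‖) ^ 4 := hφ.incr _ _
      _ ≤ c * (M * (1 + total x)) ^ 3 * (M * (1 + l1 z)) ^ 4 := by gcongr; exact hy s hs x
      _ = c * M ^ 7 * (1 + total x) ^ 3 * (1 + l1 z) ^ 4 := by ring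
      _ ≤ (c * M ^ 7 + c * M ^ 4 * α) * (1 + total x) ^ 3 * (1 + l1 z) ^ 4 := by
        gcongr
        have : 0 ≤ c * M ^ 4 * α := by positivity
        linarith
  · have ht := total_nonneg x
    have h1 : ‖G s (A *ᵥ natVec x)‖ ≤ M * (α * (1 + total x)) := by
      refine (hL s hs _).trans ?_
      have h2 := hα (natVec x)
      rw [sum_abs_natVec] at h2
      have hLM : L ≤ M := by have := norm_nonneg v; simp only [M]; linarith
      refine mul_le_mul hLM (h2.trans ?_) (Finset.sum_nonneg fun _ _ => abs_nonneg _) hM0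
      gcongr
      linarith
    calc |Dφ (G s (natVec x) - v) (-(G s (A *ᵥ natVec x)))|
        ≤ c * (1 + ‖G s (natVec x) - v‖) ^ 3 * ‖-(G s (A *ᵥ natVec x))‖ := hφ.deriv_bound _ _
      _ ≤ c * (M * (1 + total x)) ^ 3 * (M * (α * (1 + total x))) := by
        rw [norm_neg]
        gcongr
        exact hy s hs x
      _ = c * M ^ 4 * α * weight x := by unfold weight; ring
      _ ≤ (c * M ^ 7 + c * M ^ 4 * α) * weight x := by
        have := weight_pos x
        gcongr
        have : 0 ≤ c * M ^ 7 := by positivity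
        linarith

/-- The second order remainder of `φ`, integrated against the jumps from the composition `x`. -/
def jumpRemainder (a : Fin d → ℝ) (ν : Fin d → Measure (Fin d → ℤ)) (φ : E → ℝ)
    (Dφ : E → E →L[ℝ] ℝ) (g : (Fin d → ℝ) →ₗ[ℝ] E) (v : E) (x : Fin d → ℕ) : ℝ :=
  ∑ i, a i * x i * ∫ z, (φ (g (natVec x) - v + g (intVec z)) - φ (g (natVec x) - v) -
    Dφ (g (natVec x) - v) (g (intVec z))) ∂(ν i)

namespace IsForwardSolution

/-- Along a backward flow the time derivative contributes -Dφ(G_s A x), which is exactly minus the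
first order part of the generator. Only the second order remainder of φ survives, which expresses
that G_s X(s) is a martingale. -/
theorem dynkin (hP : IsForwardSolution a ν x₀ P) [∀ i, IsProbabilityMeasure (ν i)]
    (ha : ∀ i, 0 < a i) (hA1 : AssumptionA1 ν) (hA2 : AssumptionA2 ν)
    {G : ℝ → (Fin d → ℝ) →ₗ[ℝ] E} (hG : IsBackwardFlow (meanMatrix a ν) G)
    {c : ℝ} {φ : E → ℝ} {Dφ : E → E →L[ℝ] ℝ} (hφ : IsTestFunction c φ Dφ) (v : E)
    {T : ℝ} (hT : 0 ≤ T) :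
    Integrable (fun x => φ (G T (natVec x) - v)) (P T) ∧
    IntervalIntegrable (fun s => ∫ x, jumpRemainder a ν φ Dφ (G s) v x ∂(P s)) volume 0 T ∧
    ∫ x, φ (G T (natVec x) - v) ∂(P T) = φ (G 0 (natVec x₀) - v) +
      ∫ s in (0 : ℝ)..T, ∫ x, jumpRemainder a ν φ Dφ (G s) v x ∂(P s) := by
  obtain ⟨K, hK, hF, hF'⟩ := hφ.exists_growth hG v T
  have hT' : T ∈ Set.Icc 0 T := ⟨hT, le_rfl⟩
  have hd : ∀ (y : Fin d → ℕ) s, HasDerivAt (fun s => φ (G s (natVec y) - v))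
      (Dφ (G s (natVec y) - v) (-(G s (meanMatrix a ν *ᵥ natVec y)))) s := fun y s =>
    (hφ.hasFDerivAt _).comp_hasDerivAt s ((hG (natVec y) s).sub_const v)
  have hc : ∀ y : Fin d → ℕ, Continuous fun s =>
      Dφ (G s (natVec y) - v) (-(G s (meanMatrix a ν *ᵥ natVec y))) := fun y =>
    (hφ.continuous.comp ((hG.continuous_apply _).sub continuous_const)).clm_apply
      (hG.continuous_apply _).neg
  have key := hP.forward_of_growth ha hA1 hA2 hT hK hF hF' hd hc
  have hrem : ∀ s ∈ Set.Icc 0 T, ∀ x : Fin d → ℕ,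
      Dφ (G s (natVec x) - v) (-(G s (meanMatrix a ν *ᵥ natVec x))) +
        generator a ν (fun x => φ (G s (natVec x) - v)) x = jumpRemainder a ν φ Dφ (G s) v x := by
    intro s hs x
    -- The linearisation of the test function at x, whose drift cancels the time derivative.
    let ℓ : (Fin d → ℝ) →ₗ[ℝ] ℝ := (Dφ (G s (natVec x) - v) : E →ₗ[ℝ] ℝ) ∘ₗ G s
    have h1 : Dφ (G s (natVec x) - v) (-(G s (meanMatrix a ν *ᵥ natVec x))) =
        -∑ i, a i * x i * ∫ z, ℓ (intVec z) ∂(ν i) := by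
      rw [sum_integral_linear hA1, map_neg]
      rfl
    rw [h1, neg_add_eq_sub]
    unfold generator jumpRemainder
    rw [← Finset.sum_sub_distrib]
    refine Finset.sum_congr rfl fun i _ => ?_
    by_cases hx : x i = 0
    · simp [hx]
    rw [← mul_sub, ← integral_sub ((hF s hs).integrable_incr hA1 hA2 hx) (integrable_linear hA1 i ℓ)]
    congr 1
    refine integral_congr_ae ?_
    filter_upwards [hA2 i] with z hz
    have e : G s (natVec (addReplacement x z)) - v = (G s (natVec x) - v) + G s (intVec z) := by
      rw [natVec_addReplacement hx hz, map_add]; abel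
    rw [e]
    rfl
  have hsub : Set.uIoc 0 T ⊆ Set.Icc 0 T := by
    rw [Set.uIoc_of_le hT]; exact Set.Ioc_subset_Icc_self
  have hcongr : ∀ s ∈ Set.Icc 0 T, ∫ x, (Dφ (G s (natVec x) - v)
      (-(G s (meanMatrix a ν *ᵥ natVec x))) +
        generator a ν (fun x => φ (G s (natVec x) - v)) x) ∂(P s) =
      ∫ x, jumpRemainder a ν φ Dφ (G s) v x ∂(P s) := fun s hs => by
    simp_rw [hrem s hs]
  refine ⟨hP.integrable_of_le_weight ha hA1 hA2 (hF T hT').bound hT, ?_, ?_⟩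
  · exact key.1.congr fun s hs => hcongr s (hsub hs)
  · rw [key.2]
    congr 1
    exact intervalIntegral.integral_congr fun s hs => hcongr s (by rwa [Set.uIcc_of_le hT] at hs)

end IsForwardSolution

/-! ### The test functions -/

lemma isTestFunction_clm (ℓ : E →L[ℝ] ℝ) : IsTestFunction ‖ℓ‖ ℓ fun _ => ℓ where
  nonneg := norm_nonneg _
  hasFDerivAt _ := ℓ.hasFDerivAt
  continuous := continuous_const
  bound y := by
    have h := norm_nonneg y
    refine (ℓ.le_opNorm y).trans ?_
    gcongr
    have : 1 + ‖y‖ ≤ (1 + ‖y‖) ^ 4 := le_self_pow₀ (by linarith) (by norm_num)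
    linarith
  incr y η := by
    have h := norm_nonneg y
    have h' := norm_nonneg η
    rw [map_add, add_sub_cancel_left, mul_assoc]
    refine (ℓ.le_opNorm η).trans ?_
    gcongr
    have h1 : 1 + ‖η‖ ≤ (1 + ‖η‖) ^ 4 := le_self_pow₀ (by linarith) (by norm_num)
    have h2 : 1 ≤ (1 + ‖y‖) ^ 3 := one_le_pow₀ (by linarith)
    nlinarith
  deriv_bound y η := by
    have h := norm_nonneg y
    have h2 : 1 ≤ (1 + ‖y‖) ^ 3 := one_le_pow₀ (by linarith)
    refine (ℓ.le_opNorm η).trans ?_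
    rw [mul_right_comm]
    exact le_mul_of_one_le_right (by positivity) h2

lemma isTestFunction_norm_sq :
    IsTestFunction 2 (fun y : E => ‖y‖ ^ 2) fun y => (2 : ℝ) • innerSL ℝ y where
  nonneg := by norm_num
  hasFDerivAt y := by
    simpa [ofNat_smul_eq_nsmul] using (hasStrictFDerivAt_norm_sq y).hasFDerivAt
  continuous := by fun_prop
  bound y := by
    have h := norm_nonneg y
    rw [abs_of_nonneg (by positivity)]
    have : ‖y‖ ^ 2 ≤ (1 + ‖y‖) ^ 4 := by nlinarith [pow_nonneg h 3, pow_nonneg h 4, pow_nonneg h 2]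
    nlinarith [pow_nonneg h 2]
  incr y η := by
    have h := norm_nonneg y
    have h' := norm_nonneg η
    have hi := abs_real_inner_le_norm y η
    rw [norm_add_sq_real, add_assoc, add_sub_cancel_left]
    have h1 : 1 + ‖y‖ ≤ (1 + ‖y‖) ^ 3 := le_self_pow₀ (by linarith) (by norm_num)
    have h2 : (1 + ‖η‖) ^ 2 ≤ (1 + ‖η‖) ^ 4 := pow_le_pow_right₀ (by linarith) (by norm_num)
    calc |2 * inner ℝ y η + ‖η‖ ^ 2| ≤ |2 * inner ℝ y η| + |‖η‖ ^ 2| := abs_add_le _ _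
      _ ≤ 2 * (‖y‖ * ‖η‖) + ‖η‖ ^ 2 := by
        rw [abs_mul, abs_two, abs_of_nonneg (sq_nonneg ‖η‖)]
        gcongr
      _ ≤ 2 * (1 + ‖y‖) * (1 + ‖η‖) ^ 2 := by nlinarith [mul_nonneg h h', mul_nonneg h (sq_nonneg ‖η‖)]
      _ ≤ 2 * (1 + ‖y‖) ^ 3 * (1 + ‖η‖) ^ 4 := by gcongr
  deriv_bound y η := by
    have h := norm_nonneg y
    have h1 : 1 + ‖y‖ ≤ (1 + ‖y‖) ^ 3 := le_self_pow₀ (by linarith) (by norm_num)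
    simp only [smul_apply, innerSL_apply_apply, smul_eq_mul, abs_mul, abs_two]
    have hi := abs_real_inner_le_norm y η
    have : ‖y‖ * ‖η‖ ≤ (1 + ‖y‖) ^ 3 * ‖η‖ := by gcongr; linarith
    linarith

lemma isTestFunction_norm_pow_four :
    IsTestFunction 15 (fun y : E => ‖y‖ ^ 4) fun y => (4 * ‖y‖ ^ 2) • innerSL ℝ y where
  nonneg := by norm_num
  hasFDerivAt y := by
    have h := ((hasStrictFDerivAt_norm_sq y).hasFDerivAt).pow 2
    refine (h.congr_fderiv ?_).congr_of_eventuallyEq (Eventually.of_forall fun z => ?_)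
    · ext η
      simp
      ring
    · ring
  continuous := by fun_prop
  bound y := by
    have h := norm_nonneg y
    rw [abs_of_nonneg (by positivity)]
    have : ‖y‖ ^ 4 ≤ (1 + ‖y‖) ^ 4 := by gcongr; linarith
    nlinarith [pow_nonneg h 4]
  incr y η := by
    have h := norm_nonneg y
    have h' := norm_nonneg η
    have e1 : |‖y + η‖ - ‖y‖| ≤ ‖η‖ := by simpa using abs_norm_sub_norm_le (y + η) y
    have e2 := norm_add_le y η
    have e3 := norm_nonneg (y + η)
    have e4 : ‖y + η‖ ^ 4 - ‖y‖ ^ 4 = (‖y + η‖ - ‖y‖) *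
      (‖y + η‖ ^ 3 + ‖y + η‖ ^ 2 * ‖y‖ + ‖y + η‖ * ‖y‖ ^ 2 + ‖y‖ ^ 3) := by ring
    have e5 : ‖y + η‖ ≤ (1 + ‖y‖) * (1 + ‖η‖) := by nlinarith
    have e6 : ‖y‖ ≤ (1 + ‖y‖) * (1 + ‖η‖) := by nlinarith
    rw [e4, abs_mul, abs_of_nonneg (a := _ + _ + _ + _) (by positivity)]
    generalize ‖y + η‖ = p at *
    generalize ‖y‖ = q at *
    generalize ‖η‖ = r at *
    set m := (1 + q) * (1 + r) with hm
    have hm0 : 0 ≤ m := by positivity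
    calc |p - q| * (p ^ 3 + p ^ 2 * q + p * q ^ 2 + q ^ 3)
        ≤ (1 + r) * (m ^ 3 + m ^ 2 * m + m * m ^ 2 + m ^ 3) := by gcongr; linarith
      _ = 4 * (1 + q) ^ 3 * (1 + r) ^ 4 := by rw [hm]; ring
      _ ≤ 15 * (1 + q) ^ 3 * (1 + r) ^ 4 := by gcongr; norm_num
  deriv_bound y η := by
    have h := norm_nonneg y
    simp only [smul_apply, innerSL_apply_apply, smul_eq_mul, abs_mul]
    rw [abs_of_nonneg (by norm_num : (0 : ℝ) ≤ 4), abs_of_nonneg (sq_nonneg ‖y‖)]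
    have hi := abs_real_inner_le_norm y η
    calc 4 * ‖y‖ ^ 2 * |inner ℝ y η| ≤ 4 * ‖y‖ ^ 2 * (‖y‖ * ‖η‖) := by gcongr
      _ = 4 * ‖y‖ ^ 3 * ‖η‖ := by ring
      _ ≤ 15 * (1 + ‖y‖) ^ 3 * ‖η‖ := by gcongr <;> linarith

end
end BranchingMoments

namespace BranchingMoments
noncomputable section

variable {d : ℕ} {a : Fin d → ℝ} {ν : Fin d → Measure (Fin d → ℤ)}
  {x₀ : Fin d → ℕ} {P : ℝ → Measure (Fin d → ℕ)}
  {E : Type*} [NormedAddCommGroup E] [InnerProductSpace ℝ E]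

/-! ### Moments of linear martingales -/

/-- The Euclidean norm of a real vector. -/
def realNorm (x : Fin d → ℝ) : ℝ := l2norm fun k => (x k : ℂ)

lemma l2norm_nonneg (v : Fin d → ℂ) : 0 ≤ l2norm v := norm_nonneg _

lemma l2norm_sq (v : Fin d → ℂ) : l2norm v ^ 2 = ∑ k, ‖v k‖ ^ 2 := by
  unfold l2norm
  rw [EuclideanSpace.norm_sq_eq]

lemma norm_le_l2norm (v : Fin d → ℂ) (k : Fin d) : ‖v k‖ ≤ l2norm v :=
  PiLp.norm_apply_le (WithLp.toLp 2 v) k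

lemma l2norm_le_sum (v : Fin d → ℂ) : l2norm v ≤ ∑ k, ‖v k‖ := by
  refine abs_le_of_sq_le_sq' ?_ (by positivity) |>.2
  rw [l2norm_sq]
  exact Finset.sum_sq_le_sq_sum_of_nonneg fun _ _ => norm_nonneg _

lemma realNorm_intVec_le_l1 (z : Fin d → ℤ) : realNorm (intVec z) ≤ l1 z := by
  refine (l2norm_le_sum _).trans (le_of_eq ?_)
  simp [l1, intVec]

lemma integrable_realNorm_pow_four [∀ i, IsProbabilityMeasure (ν i)] (hA1 : AssumptionA1 ν)
    (i : Fin d) : Integrable (fun z => realNorm (intVec z) ^ 4) (ν i) := by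
  refine (integrable_one_add_l1_pow hA1 i).mono' Measurable.of_discrete.aestronglyMeasurable
    (ae_of_all _ fun z => ?_)
  have h0 : 0 ≤ realNorm (intVec z) := norm_nonneg _
  rw [Real.norm_of_nonneg (by positivity)]
  gcongr
  linarith [realNorm_intVec_le_l1 z]

lemma Xi4_nonneg : 0 ≤ Xi4 ν :=
  Finset.sum_nonneg fun _ _ => integral_nonneg fun _ => pow_nonneg (norm_nonneg _) 4

lemma integral_realNorm_pow_four_le (i : Fin d) :
    ∫ z, realNorm (intVec z) ^ 4 ∂(ν i) ≤ Xi4 ν := by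
  have e : ∀ j, ∫ z, realNorm (intVec z) ^ 4 ∂(ν j) =
      ∫ z, l2norm (fun k => ((z k : ℤ) : ℂ)) ^ 4 ∂(ν j) := fun j => by
    simp [realNorm, intVec]
  rw [e]
  exact Finset.single_le_sum
    (f := fun j => ∫ z, l2norm (fun k => ((z k : ℤ) : ℂ)) ^ 4 ∂(ν j))
    (fun _ _ => integral_nonneg fun _ => pow_nonneg (norm_nonneg _) 4) (Finset.mem_univ i)

lemma integral_mul_le_sqrt_mul_sqrt {α : Type*} [MeasurableSpace α] {μ : Measure α} {f g : α → ℝ}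
    (hf0 : 0 ≤ f) (hg0 : 0 ≤ g) (hfm : AEStronglyMeasurable f μ) (hgm : AEStronglyMeasurable g μ)
    (hf : Integrable (fun x => f x ^ 2) μ) (hg : Integrable (fun x => g x ^ 2) μ) :
    ∫ x, f x * g x ∂μ ≤ √(∫ x, f x ^ 2 ∂μ) * √(∫ x, g x ^ 2 ∂μ) := by
  have h := integral_mul_le_Lp_mul_Lq_of_nonneg Real.HolderConjugate.two_two (ae_of_all μ hf0)
    (ae_of_all μ hg0) (by simpa using (memLp_two_iff_integrable_sq hfm).2 hf)
    (by simpa using (memLp_two_iff_integrable_sq hgm).2 hg)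
  simpa [Real.sqrt_eq_rpow] using h

lemma integrable_realNorm_sq [∀ i, IsProbabilityMeasure (ν i)] (hA1 : AssumptionA1 ν)
    (i : Fin d) : Integrable (fun z => realNorm (intVec z) ^ 2) (ν i) := by
  refine (integrable_one_add_l1_pow hA1 i).mono' Measurable.of_discrete.aestronglyMeasurable
    (ae_of_all _ fun z => ?_)
  have h0 : 0 ≤ realNorm (intVec z) := norm_nonneg _
  have h1 := l1_nonneg z
  rw [Real.norm_of_nonneg (by positivity)]
  calc realNorm (intVec z) ^ 2 ≤ (1 + l1 z) ^ 2 := by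
        gcongr; linarith [realNorm_intVec_le_l1 z]
    _ ≤ (1 + l1 z) ^ 4 := pow_le_pow_right₀ (by linarith) (by norm_num)

/-- Cauchy-Schwarz against 1. Expressing second moments through √Ξ_4 lets Ξ_4 be the only quantity
that keeps track of the laws ν. -/
lemma integral_realNorm_sq_le [∀ i, IsProbabilityMeasure (ν i)] (hA1 : AssumptionA1 ν)
    (i : Fin d) : ∫ z, realNorm (intVec z) ^ 2 ∂(ν i) ≤ √(Xi4 ν) := by
  have h := integral_mul_le_sqrt_mul_sqrt (μ := ν i) (f := fun _ => 1)
    (g := fun z : Fin d → ℤ => realNorm (intVec z) ^ 2)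
    (fun _ => zero_le_one) (fun _ => sq_nonneg _) aestronglyMeasurable_const
    Measurable.of_discrete.aestronglyMeasurable (integrable_const _)
    (by simpa [← pow_mul] using integrable_realNorm_pow_four hA1 i)
  simp only [one_mul, one_pow, integral_const, probReal_univ, smul_eq_mul, mul_one, Real.sqrt_one,
    ← pow_mul] at h
  exact h.trans (Real.sqrt_le_sqrt (integral_realNorm_pow_four_le i))

section bounds

variable [∀ i, IsProbabilityMeasure (ν i)] {g : (Fin d → ℝ) →ₗ[ℝ] E} {β : ℝ}

lemma integral_norm_sq_le (hA1 : AssumptionA1 ν) (hg : ∀ x, ‖g x‖ ≤ β * realNorm x) (i : Fin d) :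
    Integrable (fun z => ‖g (intVec z)‖ ^ 2) (ν i) ∧
      ∫ z, ‖g (intVec z)‖ ^ 2 ∂(ν i) ≤ β ^ 2 * √(Xi4 ν) := by
  have h1 : ∀ z : Fin d → ℤ, ‖g (intVec z)‖ ^ 2 ≤ β ^ 2 * realNorm (intVec z) ^ 2 := fun z => by
    rw [← mul_pow]; gcongr; exact hg _
  have h2 := (integrable_realNorm_sq hA1 i).const_mul (β ^ 2)
  have h3 : Integrable (fun z => ‖g (intVec z)‖ ^ 2) (ν i) :=
    h2.mono' Measurable.of_discrete.aestronglyMeasurable (ae_of_all _ fun z => by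
      rw [Real.norm_of_nonneg (by positivity)]; exact h1 z)
  refine ⟨h3, (integral_mono h3 h2 h1).trans ?_⟩
  rw [integral_const_mul]
  gcongr
  exact integral_realNorm_sq_le hA1 i

lemma integral_norm_pow_four_le (hA1 : AssumptionA1 ν) (hg : ∀ x, ‖g x‖ ≤ β * realNorm x)
    (i : Fin d) :
    Integrable (fun z => ‖g (intVec z)‖ ^ 4) (ν i) ∧
      ∫ z, ‖g (intVec z)‖ ^ 4 ∂(ν i) ≤ β ^ 4 * Xi4 ν := by
  have h1 : ∀ z : Fin d → ℤ, ‖g (intVec z)‖ ^ 4 ≤ β ^ 4 * realNorm (intVec z) ^ 4 := fun z => by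
    rw [← mul_pow]; gcongr; exact hg _
  have h2 := (integrable_realNorm_pow_four hA1 i).const_mul (β ^ 4)
  have h3 : Integrable (fun z => ‖g (intVec z)‖ ^ 4) (ν i) :=
    h2.mono' Measurable.of_discrete.aestronglyMeasurable (ae_of_all _ fun z => by
      rw [Real.norm_of_nonneg (by positivity)]; exact h1 z)
  refine ⟨h3, (integral_mono h3 h2 h1).trans ?_⟩
  rw [integral_const_mul]
  gcongr
  exact integral_realNorm_pow_four_le i

lemma sum_rate_mul_le (ha : ∀ i, 0 < a i) (x : Fin d → ℕ) {I : Fin d → ℝ} {B : ℝ} (hB : 0 ≤ B)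
    (hI : ∀ i, I i ≤ B) : ∑ i, a i * x i * I i ≤ (∑ i, a i) * total x * B := by
  rw [Finset.sum_mul, Finset.sum_mul]
  refine Finset.sum_le_sum fun i _ => ?_
  have := ha i
  have := total_nonneg x
  calc a i * x i * I i ≤ a i * x i * B := by gcongr; exact hI i
    _ ≤ a i * total x * B := by gcongr; exact coord_le_total x i

lemma jumpRemainder_norm_sq_le (ha : ∀ i, 0 < a i) (hA1 : AssumptionA1 ν)
    (hg : ∀ x, ‖g x‖ ≤ β * realNorm x) (v : E) (x : Fin d → ℕ) :
    jumpRemainder a ν (fun y : E => ‖y‖ ^ 2) (fun y => (2 : ℝ) • innerSL ℝ y) g v x ≤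
      (∑ i, a i) * total x * (β ^ 2 * √(Xi4 ν)) := by
  have e : ∀ y η : E, ‖y + η‖ ^ 2 - ‖y‖ ^ 2 - ((2 : ℝ) • innerSL ℝ y) η = ‖η‖ ^ 2 := by
    intro y η
    rw [norm_add_sq_real]
    simp
    ring
  unfold jumpRemainder
  simp only [e]
  exact sum_rate_mul_le ha x (by positivity) fun i => (integral_norm_sq_le hA1 hg i).2

lemma norm_pow_four_remainder_le (y η : E) :
    ‖y + η‖ ^ 4 - ‖y‖ ^ 4 - ((4 * ‖y‖ ^ 2) • innerSL ℝ y) η ≤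
      8 * ‖y‖ ^ 2 * ‖η‖ ^ 2 + 3 * ‖η‖ ^ 4 := by
  have e : ‖y + η‖ ^ 4 = (‖y‖ ^ 2 + 2 * inner ℝ y η + ‖η‖ ^ 2) ^ 2 := by
    rw [← norm_add_sq_real]; ring
  rw [e]
  simp only [smul_apply, innerSL_apply_apply, smul_eq_mul]
  have h := abs_real_inner_le_norm y η
  have h2 : inner ℝ y η ^ 2 ≤ (‖y‖ * ‖η‖) ^ 2 := by
    rw [← sq_abs]; gcongr
  -- After expansion the remainder is 4⟨y,η⟩² + 4⟨y,η⟩‖η‖² + 2‖y‖²‖η‖² + ‖η‖⁴. Bounding the mixed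
  -- term by 2⟨y,η⟩² + 2‖η‖⁴ gives the constants 6 + 2 = 8 and 1 + 2 = 3.
  nlinarith [sq_nonneg (inner ℝ y η - ‖η‖ ^ 2)]

lemma jumpRemainder_norm_pow_four_le (ha : ∀ i, 0 < a i) (hA1 : AssumptionA1 ν)
    (hg : ∀ x, ‖g x‖ ≤ β * realNorm x) (v : E) (x : Fin d → ℕ) :
    jumpRemainder a ν (fun y : E => ‖y‖ ^ 4) (fun y => (4 * ‖y‖ ^ 2) • innerSL ℝ y) g v x ≤
      (∑ i, a i) * total x *
        (8 * ‖g (natVec x) - v‖ ^ 2 * (β ^ 2 * √(Xi4 ν)) + 3 * (β ^ 4 * Xi4 ν)) := by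
  have hX := Xi4_nonneg (ν := ν)
  refine sum_rate_mul_le ha x (by positivity) fun i => ?_
  obtain ⟨i2, b2⟩ := integral_norm_sq_le hA1 hg i
  obtain ⟨i4, b4⟩ := integral_norm_pow_four_le hA1 hg i
  set y := g (natVec x) - v
  have hint := (i2.const_mul (8 * ‖y‖ ^ 2)).add (i4.const_mul 3)
  calc ∫ z, (‖y + g (intVec z)‖ ^ 4 - ‖y‖ ^ 4 - ((4 * ‖y‖ ^ 2) • innerSL ℝ y) (g (intVec z))) ∂(ν i)
      ≤ ∫ z, (8 * ‖y‖ ^ 2 * ‖g (intVec z)‖ ^ 2 + 3 * ‖g (intVec z)‖ ^ 4) ∂(ν i) := by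
        have hle := fun z => norm_pow_four_remainder_le y (g (intVec z))
        by_cases h : Integrable (fun z => ‖y + g (intVec z)‖ ^ 4 - ‖y‖ ^ 4 -
            ((4 * ‖y‖ ^ 2) • innerSL ℝ y) (g (intVec z))) (ν i)
        · exact integral_mono h hint hle
        · rw [integral_undef h]
          exact integral_nonneg fun z => by positivity
    _ = 8 * ‖y‖ ^ 2 * ∫ z, ‖g (intVec z)‖ ^ 2 ∂(ν i) + 3 * ∫ z, ‖g (intVec z)‖ ^ 4 ∂(ν i) := by
        rw [integral_add (i2.const_mul _) (i4.const_mul _), integral_const_mul, integral_const_mul]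
    _ ≤ 8 * ‖y‖ ^ 2 * (β ^ 2 * √(Xi4 ν)) + 3 * (β ^ 4 * Xi4 ν) := by gcongr

end bounds

end
end BranchingMoments

/-! ### Mean, variance and fourth moment of the martingales G_s X(s) -/

namespace BranchingMoments
noncomputable section

variable {d : ℕ} {a : Fin d → ℝ} {ν : Fin d → Measure (Fin d → ℤ)}
  {x₀ : Fin d → ℕ} {P : ℝ → Measure (Fin d → ℕ)}
  {E : Type*} [NormedAddCommGroup E] [InnerProductSpace ℝ E]

namespace IsForwardSolution

/-- A continuous linear functional has zero second order remainder, so Dynkin's formula says that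
its mean is conserved along the flow. -/
theorem integral_clm (hP : IsForwardSolution a ν x₀ P) [∀ i, IsProbabilityMeasure (ν i)]
    (ha : ∀ i, 0 < a i) (hA1 : AssumptionA1 ν) (hA2 : AssumptionA2 ν)
    {G : ℝ → (Fin d → ℝ) →ₗ[ℝ] E} (hG : IsBackwardFlow (meanMatrix a ν) G) (ℓ : E →L[ℝ] ℝ)
    {T : ℝ} (hT : 0 ≤ T) :
    ∫ x, ℓ (G T (natVec x)) ∂(P T) = ℓ (G 0 (natVec x₀)) := by
  have h := (hP.dynkin ha hA1 hA2 hG (isTestFunction_clm ℓ) 0 hT).2.2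
  simpa [jumpRemainder] using h

lemma integrable_total (hP : IsForwardSolution a ν x₀ P) [∀ i, IsProbabilityMeasure (ν i)]
    (ha : ∀ i, 0 < a i) (hA1 : AssumptionA1 ν) (hA2 : AssumptionA2 ν) {s : ℝ} (hs : 0 ≤ s) :
    Integrable total (P s) :=
  hP.integrable_of_le_weight ha hA1 hA2 (K := 1) (fun x => by
    have h := total_nonneg x
    have : 1 + total x ≤ (1 + total x) ^ 4 := le_self_pow₀ (by linarith) (by norm_num)
    rw [abs_of_nonneg h, one_mul, weight]
    linarith) hs

lemma integrable_total_sq (hP : IsForwardSolution a ν x₀ P) [∀ i, IsProbabilityMeasure (ν i)]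
    (ha : ∀ i, 0 < a i) (hA1 : AssumptionA1 ν) (hA2 : AssumptionA2 ν) {s : ℝ} (hs : 0 ≤ s) :
    Integrable (fun x => total x ^ 2) (P s) :=
  hP.integrable_of_le_weight ha hA1 hA2 (K := 1) (fun x => by
    have h := total_nonneg x
    rw [abs_of_nonneg (by positivity), one_mul, weight]
    calc total x ^ 2 ≤ (1 + total x) ^ 2 := by gcongr; linarith
      _ ≤ (1 + total x) ^ 4 := pow_le_pow_right₀ (by linarith) (by norm_num)) hs

theorem integral_norm_sq_le (hP : IsForwardSolution a ν x₀ P) [∀ i, IsProbabilityMeasure (ν i)]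
    (ha : ∀ i, 0 < a i) (hA1 : AssumptionA1 ν) (hA2 : AssumptionA2 ν)
    {G : ℝ → (Fin d → ℝ) →ₗ[ℝ] E} (hG : IsBackwardFlow (meanMatrix a ν) G)
    {T : ℝ} (hT : 0 ≤ T) {b m : ℝ → ℝ} (hb : ∀ s ∈ Set.Icc 0 T, ∀ x, ‖G s x‖ ≤ b s * realNorm x)
    (hm : ∀ s ∈ Set.Icc 0 T, ∫ x, total x ∂(P s) ≤ m s) (hbc : Continuous b)
    (hmc : Continuous m) :
    Integrable (fun x => ‖G T (natVec x) - G 0 (natVec x₀)‖ ^ 2) (P T) ∧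
    ∫ x, ‖G T (natVec x) - G 0 (natVec x₀)‖ ^ 2 ∂(P T) ≤
      (∑ i, a i) * √(Xi4 ν) * ∫ s in (0 : ℝ)..T, b s ^ 2 * m s := by
  have hα : 0 ≤ ∑ i, a i := Finset.sum_nonneg fun i _ => (ha i).le
  set v := G 0 (natVec x₀)
  obtain ⟨h1, h2, h3⟩ := hP.dynkin ha hA1 hA2 hG isTestFunction_norm_sq v hT
  refine ⟨h1, ?_⟩
  rw [h3]
  have hv : ‖G 0 (natVec x₀) - v‖ ^ 2 = 0 := by simp [v]
  rw [hv, zero_add, ← intervalIntegral.integral_const_mul]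
  refine intervalIntegral.integral_mono_on hT h2
    (Continuous.intervalIntegrable (by fun_prop) _ _) fun s hs => ?_
  have hti := hP.integrable_total ha hA1 hA2 hs.1
  calc ∫ x, jumpRemainder a ν (fun y : E => ‖y‖ ^ 2) (fun y => (2 : ℝ) • innerSL ℝ y) (G s) v x ∂(P s)
      ≤ ∫ x, (∑ i, a i) * total x * (b s ^ 2 * √(Xi4 ν)) ∂(P s) := by
        have hle := jumpRemainder_norm_sq_le (ν := ν) ha hA1 (hb s hs) v
        by_cases hint : Integrable (jumpRemainder a ν (fun y : E => ‖y‖ ^ 2)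
            (fun y => (2 : ℝ) • innerSL ℝ y) (G s) v) (P s)
        · exact integral_mono hint ((hti.const_mul _).mul_const _) hle
        · rw [integral_undef hint]
          exact integral_nonneg fun x => mul_nonneg (mul_nonneg hα (total_nonneg x)) (by positivity)
    _ = (∑ i, a i) * (∫ x, total x ∂(P s)) * (b s ^ 2 * √(Xi4 ν)) := by
        rw [integral_mul_const, integral_const_mul]
    _ ≤ (∑ i, a i) * m s * (b s ^ 2 * √(Xi4 ν)) := by
        gcongr
        exact hm s hs
    _ = (∑ i, a i) * √(Xi4 ν) * (b s ^ 2 * m s) := by ring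

/-- The remainder of the fourth power contains |x| ‖M_s - M_0‖², whose mean Cauchy-Schwarz bounds by
h(s) times the square root of the fourth moment being estimated. The argument closes by taking the
supremum over [0,T]. -/
theorem integral_norm_pow_four_le (hP : IsForwardSolution a ν x₀ P)
    [∀ i, IsProbabilityMeasure (ν i)]
    (ha : ∀ i, 0 < a i) (hA1 : AssumptionA1 ν) (hA2 : AssumptionA2 ν)
    {G : ℝ → (Fin d → ℝ) →ₗ[ℝ] E} (hG : IsBackwardFlow (meanMatrix a ν) G)
    {T : ℝ} (hT : 0 ≤ T) {b m h : ℝ → ℝ}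
    (hb : ∀ s ∈ Set.Icc 0 T, ∀ x, ‖G s x‖ ≤ b s * realNorm x)
    (hm : ∀ s ∈ Set.Icc 0 T, ∫ x, total x ∂(P s) ≤ m s) (hh0 : ∀ s, 0 ≤ h s)
    (hh : ∀ s ∈ Set.Icc 0 T, ∫ x, total x ^ 2 ∂(P s) ≤ h s ^ 2) (hbc : Continuous b)
    (hmc : Continuous m) (hhc : Continuous h) :
    Integrable (fun x => ‖G T (natVec x) - G 0 (natVec x₀)‖ ^ 4) (P T) ∧
    ∫ x, ‖G T (natVec x) - G 0 (natVec x₀)‖ ^ 4 ∂(P T) ≤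
      ((∑ i, a i) * 8 * √(Xi4 ν) * ∫ s in (0 : ℝ)..T, b s ^ 2 * h s) ^ 2 +
        6 * (∑ i, a i) * Xi4 ν * ∫ s in (0 : ℝ)..T, b s ^ 4 * m s := by
  have hα : 0 ≤ ∑ i, a i := Finset.sum_nonneg fun i _ => (ha i).le
  have hX := Xi4_nonneg (ν := ν)
  set v := G 0 (natVec x₀) with hvdef
  have hT' : T ∈ Set.Icc 0 T := ⟨hT, le_rfl⟩
  obtain ⟨K, hK, hF, -⟩ := (isTestFunction_norm_pow_four (E := E)).exists_growth hG v T
  let q : ℝ → ℝ := fun s => ∫ x, ‖G s (natVec x) - v‖ ^ 4 ∂(P s)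
  have hq0 : ∀ s, 0 ≤ q s := fun s => integral_nonneg fun x => by positivity
  have hint : ∀ s ∈ Set.Icc 0 T, Integrable (fun x => ‖G s (natVec x) - v‖ ^ 4) (P s) :=
    fun s hs => hP.integrable_of_le_weight ha hA1 hA2 (hF s hs).bound hs.1
  have hqbdd : BddAbove (q '' Set.Icc 0 T) := by
    refine ⟨K * (Real.exp (momentRate a ν * T) * weight x₀), ?_⟩
    rintro _ ⟨s, hs, rfl⟩
    have hw := hP.integrable_weight ha hA1 hA2 hs.1
    calc q s ≤ ∫ x, K * weight x ∂(P s) :=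
          integral_mono (hint s hs) (hw.1.const_mul K) fun x =>
            (le_abs_self _).trans ((hF s hs).bound x)
      _ = K * ∫ x, weight x ∂(P s) := integral_const_mul _ _
      _ ≤ K * (Real.exp (momentRate a ν * s) * weight x₀) := by gcongr; exact hw.2
      _ ≤ K * (Real.exp (momentRate a ν * T) * weight x₀) := by
        have := momentRate_nonneg (ν := ν) ha
        have := (weight_pos x₀).le
        gcongr
        exact hs.2
  -- This supremum is finite by the Lyapunov bound; its size is irrelevant, but without finiteness
  -- the inequality Q ≤ √Q α + γ would carry no information.
  set Q := sSup (q '' Set.Icc 0 T) with hQ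
  have hqQ : ∀ s ∈ Set.Icc 0 T, q s ≤ Q := fun s hs => le_csSup hqbdd ⟨s, hs, rfl⟩
  have hQ0 : 0 ≤ Q := (hq0 T).trans (hqQ T hT')
  have hm0 : ∀ s ∈ Set.Icc 0 T, 0 ≤ m s := fun s hs =>
    (integral_nonneg fun x => total_nonneg x).trans (hm s hs)
  set α := (∑ i, a i) * 8 * √(Xi4 ν) * ∫ s in (0 : ℝ)..T, b s ^ 2 * h s with hαdef
  set γ := 3 * (∑ i, a i) * Xi4 ν * ∫ s in (0 : ℝ)..T, b s ^ 4 * m s with hγdef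
  have hstep : ∀ t ∈ Set.Icc 0 T, q t ≤ √Q * α + γ := by
    intro t ht
    obtain ⟨-, h2, h3⟩ := hP.dynkin ha hA1 hA2 hG isTestFunction_norm_pow_four v ht.1
    have hv : ‖G 0 (natVec x₀) - v‖ ^ 4 = 0 := by simp [v]
    rw [hv, zero_add] at h3
    let B : ℝ → ℝ := fun s => √Q * ((∑ i, a i) * 8 * √(Xi4 ν) * (b s ^ 2 * h s)) +
        3 * (∑ i, a i) * Xi4 ν * (b s ^ 4 * m s)
    have hBc : Continuous B := by fun_prop
    have hB0 : ∀ s ∈ Set.Icc 0 T, 0 ≤ B s := fun s hs => by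
      have := hm0 s hs
      have := hh0 s
      positivity
    have hle : q t ≤ ∫ s in (0 : ℝ)..t, B s := by
      change ∫ x, ‖G t (natVec x) - v‖ ^ 4 ∂(P t) ≤ _
      rw [h3]
      refine intervalIntegral.integral_mono_on ht.1 h2 (hBc.intervalIntegrable _ _) fun s hs => ?_
      have hs' : s ∈ Set.Icc 0 T := ⟨hs.1, hs.2.trans ht.2⟩
      have hti := hP.integrable_total ha hA1 hA2 hs.1
      have hti2 := hP.integrable_total_sq ha hA1 hA2 hs.1
      have hq2 : Integrable (fun x => (‖G s (natVec x) - v‖ ^ 2) ^ 2) (P s) := by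
        simpa [← pow_mul] using hint s hs'
      have hcs : ∫ x, total x * ‖G s (natVec x) - v‖ ^ 2 ∂(P s) ≤ h s * √Q := by
        refine (integral_mul_le_sqrt_mul_sqrt (fun x => total_nonneg x) (fun x => sq_nonneg _)
          Measurable.of_discrete.aestronglyMeasurable Measurable.of_discrete.aestronglyMeasurable
          hti2 hq2).trans ?_
        refine mul_le_mul ?_ (Real.sqrt_le_sqrt ?_) (Real.sqrt_nonneg _) (hh0 s)
        · exact Real.sqrt_le_iff.2 ⟨hh0 s, hh s hs'⟩
        · simpa [← pow_mul] using hqQ s hs'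
      have hmulint : Integrable (fun x => total x * ‖G s (natVec x) - v‖ ^ 2) (P s) := by
        refine (hti2.add hq2).mono' Measurable.of_discrete.aestronglyMeasurable
          (ae_of_all _ fun x => ?_)
        have h0 := total_nonneg x
        rw [Real.norm_of_nonneg (by positivity)]
        simp only [Pi.add_apply]
        nlinarith [sq_nonneg (total x - ‖G s (natVec x) - v‖ ^ 2), sq_nonneg (total x),
          sq_nonneg (‖G s (natVec x) - v‖ ^ 2)]
      have hrem := jumpRemainder_norm_pow_four_le (ν := ν) ha hA1 (hb s hs') v
      have hrhs : Integrable (fun x => (∑ i, a i) * 8 * (b s ^ 2 * √(Xi4 ν)) *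
          (total x * ‖G s (natVec x) - v‖ ^ 2) + 3 * (∑ i, a i) * Xi4 ν * b s ^ 4 * total x) (P s) :=
        (hmulint.const_mul _).add (hti.const_mul _)
      have hrem' : ∀ x, jumpRemainder a ν (fun y : E => ‖y‖ ^ 4)
          (fun y => (4 * ‖y‖ ^ 2) • innerSL ℝ y) (G s) v x ≤
          (∑ i, a i) * 8 * (b s ^ 2 * √(Xi4 ν)) *
          (total x * ‖G s (natVec x) - v‖ ^ 2) + 3 * (∑ i, a i) * Xi4 ν * b s ^ 4 * total x :=
        fun x => (hrem x).trans (le_of_eq (by ring))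
      by_cases hi : Integrable (jumpRemainder a ν (fun y : E => ‖y‖ ^ 4)
          (fun y => (4 * ‖y‖ ^ 2) • innerSL ℝ y) (G s) v) (P s)
      · refine (integral_mono hi hrhs hrem').trans ?_
        rw [integral_add (hmulint.const_mul _) (hti.const_mul _), integral_const_mul,
          integral_const_mul]
        calc (∑ i, a i) * 8 * (b s ^ 2 * √(Xi4 ν)) *
                (∫ x, total x * ‖G s (natVec x) - v‖ ^ 2 ∂(P s)) +
                3 * (∑ i, a i) * Xi4 ν * b s ^ 4 * ∫ x, total x ∂(P s)
            ≤ (∑ i, a i) * 8 * (b s ^ 2 * √(Xi4 ν)) * (h s * √Q) +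
                3 * (∑ i, a i) * Xi4 ν * b s ^ 4 * m s := by
              gcongr
              exact hm s hs'
          _ = B s := by simp only [B]; ring
      · rw [integral_undef hi]
        exact hB0 s hs'
    have hmono : ∫ s in (0 : ℝ)..t, B s ≤ ∫ s in (0 : ℝ)..T, B s := by
      refine intervalIntegral.integral_mono_interval le_rfl ht.1 ht.2 ?_ (hBc.intervalIntegrable _ _)
      refine (ae_restrict_iff' measurableSet_Ioc).2 (ae_of_all _ fun s hs => ?_)
      exact hB0 s (Set.Ioc_subset_Icc_self hs)
    refine (hle.trans hmono).trans (le_of_eq ?_)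
    simp only [B]
    rw [intervalIntegral.integral_add (Continuous.intervalIntegrable (by fun_prop) _ _)
      (Continuous.intervalIntegrable (by fun_prop) _ _), intervalIntegral.integral_const_mul,
      intervalIntegral.integral_const_mul, intervalIntegral.integral_const_mul]
  refine ⟨hint T hT', ?_⟩
  have hQle : Q ≤ √Q * α + γ :=
    csSup_le ⟨_, T, hT', rfl⟩ (by rintro _ ⟨s, hs, rfl⟩; exact hstep s hs)
  have hsq : √Q ^ 2 = Q := Real.sq_sqrt hQ0
  -- Uses √Q α ≤ (Q + α²)/2 and absorbs Q/2 on the left.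
  have hfin : Q ≤ α ^ 2 + 2 * γ := by nlinarith [sq_nonneg (√Q - α)]
  have : 6 * (∑ i, a i) * Xi4 ν * ∫ s in (0 : ℝ)..T, b s ^ 4 * m s = 2 * γ := by
    rw [hγdef]; ring
  rw [this]
  exact (hqQ T hT').trans hfin

end IsForwardSolution

end
end BranchingMoments

namespace BranchingMoments
noncomputable section

variable {d : ℕ}

/-! ### The exponential of a matrix -/

open scoped Matrix.Norms.Operator in
lemma hasSum_exp_mulVec (B : Matrix (Fin d) (Fin d) ℂ) (v : Fin d → ℂ) :
    HasSum (fun k : ℕ => ((k.factorial : ℂ))⁻¹ • (B ^ k *ᵥ v)) (NormedSpace.exp B *ᵥ v) := by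
  have h := NormedSpace.exp_series_hasSum_exp' (𝕂 := ℂ) B
  let L : Matrix (Fin d) (Fin d) ℂ →ₗ[ℂ] (Fin d → ℂ) :=
    { toFun := fun M => M *ᵥ v
      map_add' := fun M N => Matrix.add_mulVec M N v
      map_smul' := fun c M => Matrix.smul_mulVec c M v }
  have h2 := h.mapL (LinearMap.toContinuousLinearMap L)
  simp only [map_smul] at h2
  exact h2

lemma expMap_apply (A : Matrix (Fin d) (Fin d) ℝ) (t : ℝ) (v : Fin d → ℂ) :
    expMap A t v = NormedSpace.exp ((t : ℂ) • toC A) *ᵥ v := rfl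

lemma expMap_add (A : Matrix (Fin d) (Fin d) ℝ) (s t : ℝ) (v : Fin d → ℂ) :
    expMap A (s + t) v = expMap A s (expMap A t v) := by
  simp only [expMap_apply, Complex.ofReal_add, add_smul]
  rw [Matrix.exp_add_of_commute, Matrix.mulVec_mulVec]
  exact ((Commute.refl _).smul_left _).smul_right _

lemma expMap_zero (A : Matrix (Fin d) (Fin d) ℝ) (v : Fin d → ℂ) : expMap A 0 v = v := by
  simp [expMap_apply]

open scoped Matrix.Norms.Operator in
lemma hasDerivAt_expMap (A : Matrix (Fin d) (Fin d) ℝ) (v : Fin d → ℂ) (t : ℝ) :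
    HasDerivAt (fun s => expMap A s v) (expMap A t (toC A *ᵥ v)) t := by
  have h := hasDerivAt_exp_smul_const (𝕂 := ℂ) (toC A) (t : ℂ)
  let L : Matrix (Fin d) (Fin d) ℂ →ₗ[ℂ] (Fin d → ℂ) :=
    { toFun := fun M => M *ᵥ v
      map_add' := fun M N => Matrix.add_mulVec M N v
      map_smul' := fun c M => Matrix.smul_mulVec c M v }
  have h2 := (LinearMap.toContinuousLinearMap L).hasFDerivAt.comp_hasDerivAt (t : ℂ) h
  have h3 := h2.scomp t (Complex.ofRealCLM.hasDerivAt (x := t))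
  have h4 : HasDerivAt (fun s : ℝ => expMap A s v)
      ((1 : ℂ) • ((NormedSpace.exp ((t : ℂ) • toC A) * toC A) *ᵥ v)) t := h3
  rwa [one_smul, ← Matrix.mulVec_mulVec] at h4

/-- Splits off the scalar part, which commutes with everything. On a Jordan block with eigenvalue μ
the remaining exponential series is finite. -/
lemma exp_smul_mulVec_eq (M : Matrix (Fin d) (Fin d) ℂ) (t μ : ℂ) (v : Fin d → ℂ) :
    NormedSpace.exp (t • M) *ᵥ v =
      Complex.exp (t * μ) • (NormedSpace.exp (t • (M - μ • (1 : Matrix (Fin d) (Fin d) ℂ))) *ᵥ v) := by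
  have h1 : t • M = (t * μ) • (1 : Matrix (Fin d) (Fin d) ℂ) + t • (M - μ • 1) := by
    rw [smul_sub, smul_smul]; abel
  have hc : Commute ((t * μ) • (1 : Matrix (Fin d) (Fin d) ℂ)) (t • (M - μ • 1)) :=
    (Commute.one_left _).smul_left _
  have h2 : NormedSpace.exp ((t * μ) • (1 : Matrix (Fin d) (Fin d) ℂ)) =
      Complex.exp (t * μ) • (1 : Matrix (Fin d) (Fin d) ℂ) := by
    rw [← Matrix.diagonal_one, ← Matrix.diagonal_smul, Matrix.exp_diagonal, ← Matrix.diagonal_smul]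
    congr 1
    funext i
    simp [Pi.coe_exp, Complex.exp_eq_exp_ℂ]
  rw [h1, Matrix.exp_add_of_commute _ _ hc, h2, Matrix.smul_mul, one_mul, Matrix.smul_mulVec]

lemma expMap_eigenvector {A : Matrix (Fin d) (Fin d) ℝ} {μ : ℂ} {v : Fin d → ℂ}
    (hv : toC A *ᵥ v = μ • v) (t : ℝ) : expMap A t v = Complex.exp (t * μ) • v := by
  rw [expMap_apply, exp_smul_mulVec_eq _ _ μ]
  congr 1
  refine (hasSum_exp_mulVec _ v).unique ?_
  have h0 : ((t : ℂ) • (toC A - μ • (1 : Matrix (Fin d) (Fin d) ℂ))) *ᵥ v = 0 := by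
    rw [Matrix.smul_mulVec, Matrix.sub_mulVec, hv, Matrix.smul_mulVec, Matrix.one_mulVec, sub_self,
      smul_zero]
  have := hasSum_single (f := fun k : ℕ => ((k.factorial : ℂ))⁻¹ •
    (((t : ℂ) • (toC A - μ • (1 : Matrix (Fin d) (Fin d) ℂ))) ^ k *ᵥ v)) 0 (fun k hk => by
      obtain ⟨n, rfl⟩ := Nat.exists_eq_succ_of_ne_zero hk
      rw [pow_succ, ← Matrix.mulVec_mulVec, h0, Matrix.mulVec_zero, smul_zero])
  simpa using this

/-! ### The Euclidean norm -/

lemma l2norm_add_le (u v : Fin d → ℂ) : l2norm (u + v) ≤ l2norm u + l2norm v :=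
  norm_add_le (WithLp.toLp 2 u : EuclideanSpace ℂ (Fin d)) (WithLp.toLp 2 v)

lemma l2norm_smul (c : ℂ) (v : Fin d → ℂ) : l2norm (c • v) = ‖c‖ * l2norm v :=
  norm_smul c (WithLp.toLp 2 v : EuclideanSpace ℂ (Fin d))

lemma l2norm_zero : l2norm (0 : Fin d → ℂ) = 0 :=
  norm_zero (E := EuclideanSpace ℂ (Fin d))

lemma l2norm_sum_le {ι : Type*} (s : Finset ι) (f : ι → Fin d → ℂ) :
    l2norm (∑ i ∈ s, f i) ≤ ∑ i ∈ s, l2norm (f i) :=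
  Finset.le_sum_of_subadditive _ l2norm_zero.le l2norm_add_le s f

lemma l2norm_pos {v : Fin d → ℂ} (hv : v ≠ 0) : 0 < l2norm v := by
  refine (l2norm_nonneg v).lt_of_ne' fun h => hv ?_
  funext k
  have := norm_le_l2norm v k
  rw [h] at this
  simpa using this

namespace JordanBasis

variable {A : Matrix (Fin d) (Fin d) ℝ} (J : JordanBasis A)

/-- The `i`-th vector of block `b`, and `0` if the block is shorter than that. -/
def blockVec (b : Fin J.numBlocks) (i : ℕ) : Fin d → ℂ :=
  if h : i < J.size b then J.vec ⟨b, ⟨i, h⟩⟩ else 0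

lemma blockVec_of_lt {b : Fin J.numBlocks} {i : ℕ} (h : i < J.size b) :
    J.blockVec b i = J.vec ⟨b, ⟨i, h⟩⟩ := dif_pos h

lemma vec_eq_blockVec (p : Σ b : Fin J.numBlocks, Fin (J.size b)) :
    J.vec p = J.blockVec p.1 p.2 := (J.blockVec_of_lt p.2.isLt).symm

lemma sub_eig_pow_mulVec (b : Fin J.numBlocks) (k : ℕ) : ∀ i, i < J.size b →
    (toC A - J.eig b • (1 : Matrix (Fin d) (Fin d) ℂ)) ^ k *ᵥ J.blockVec b i =
      if k ≤ i then J.blockVec b (i - k) else 0 := by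
  have hW : ∀ v, (toC A - J.eig b • (1 : Matrix (Fin d) (Fin d) ℂ)) *ᵥ v =
      toC A *ᵥ v - J.eig b • v := fun v => by
    rw [Matrix.sub_mulVec, Matrix.smul_mulVec, Matrix.one_mulVec]
  induction k with
  | zero => intro i _; simp
  | succ k ih =>
    intro i hi
    rw [pow_succ, ← Matrix.mulVec_mulVec, hW, J.blockVec_of_lt hi]
    cases i with
    | zero => rw [J.map_zero b, sub_self, Matrix.mulVec_zero]; simp
    | succ i =>
      rw [J.map_succ b i hi, add_sub_cancel_left, ← J.blockVec_of_lt (by omega : i < J.size b),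
        ih i (by omega)]
      simp

/-- The exponential on a Jordan block. -/
lemma expMap_blockVec (b : Fin J.numBlocks) {i : ℕ} (hi : i < J.size b) (r : ℝ) :
    expMap A r (J.blockVec b i) = Complex.exp (r * J.eig b) •
      ∑ k ∈ Finset.range (i + 1), ((r : ℂ) ^ k * ((k.factorial : ℂ))⁻¹) • J.blockVec b (i - k) := by
  rw [expMap_apply, exp_smul_mulVec_eq _ _ (J.eig b)]
  congr 1
  refine (hasSum_exp_mulVec _ _).unique ?_
  have hterm : ∀ k : ℕ, ((k.factorial : ℂ))⁻¹ •
      (((r : ℂ) • (toC A - J.eig b • (1 : Matrix (Fin d) (Fin d) ℂ))) ^ k *ᵥ J.blockVec b i) =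
      if k ≤ i then ((r : ℂ) ^ k * ((k.factorial : ℂ))⁻¹) • J.blockVec b (i - k) else 0 := fun k => by
    rw [smul_pow, Matrix.smul_mulVec, J.sub_eig_pow_mulVec b k i hi]
    split_ifs
    · rw [smul_smul, mul_comm]
    · simp
  simp_rw [hterm]
  have h := hasSum_sum_of_ne_finset_zero (f := fun k : ℕ =>
    if k ≤ i then ((r : ℂ) ^ k * ((k.factorial : ℂ))⁻¹) • J.blockVec b (i - k) else 0)
    (s := Finset.range (i + 1)) (L := SummationFilter.unconditional ℕ) (fun k hk => if_neg (by simpa using hk))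
  convert h using 1
  exact Finset.sum_congr rfl fun k hk => (if_pos (by simpa [Nat.lt_succ_iff] using hk)).symm

/-- A bound for the Euclidean norms of the vectors of the basis. -/
def vecBound : ℝ := ∑ p, l2norm (J.vec p)

lemma vecBound_nonneg : 0 ≤ J.vecBound := Finset.sum_nonneg fun _ _ => l2norm_nonneg _

lemma l2norm_blockVec_le (b : Fin J.numBlocks) (i : ℕ) : l2norm (J.blockVec b i) ≤ J.vecBound := by
  unfold blockVec
  split_ifs with h
  · exact Finset.single_le_sum (f := fun p => l2norm (J.vec p)) (fun _ _ => l2norm_nonneg _)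
      (Finset.mem_univ _)
  · rw [l2norm_zero]; exact J.vecBound_nonneg

/-- The sum of the sizes of the blocks. -/
def totalSize : ℕ := ∑ b, J.size b

lemma size_le_totalSize (b : Fin J.numBlocks) : J.size b ≤ J.totalSize :=
  Finset.single_le_sum (f := J.size) (fun _ _ => Nat.zero_le _) (Finset.mem_univ b)

/-- The exponential shifts a block vector down k places with coefficient r^k/k!. If R kills
everything shifted by more than q places, the polynomial factor has degree at most q. Negative r is
allowed, for use with the large components. -/
lemma l2norm_map_expMap_blockVec_le (R : (Fin d → ℂ) →ₗ[ℂ] (Fin d → ℂ)) (b : Fin J.numBlocks)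
    {q : ℕ} {i : ℕ} (hi : i < J.size b)
    (hR : ∀ j ≤ i, l2norm (R (J.blockVec b j)) ≤ J.vecBound)
    (hR0 : ∀ k ≤ i, q < k → R (J.blockVec b (i - k)) = 0) (r : ℝ) :
    l2norm (R (expMap A r (J.blockVec b i))) ≤
      J.totalSize * J.vecBound * ((1 + |r|) ^ q * Real.exp ((J.eig b).re * r)) := by
  have hM := J.vecBound_nonneg
  rw [J.expMap_blockVec b hi, map_smul, l2norm_smul, map_sum]
  have h1 : ‖Complex.exp (r * J.eig b)‖ = Real.exp ((J.eig b).re * r) := by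
    rw [Complex.norm_exp]
    simp [mul_comm]
  have h2 : ∀ k ∈ Finset.range (i + 1),
      l2norm (R (((r : ℂ) ^ k * ((k.factorial : ℂ))⁻¹) • J.blockVec b (i - k))) ≤
        (1 + |r|) ^ q * J.vecBound := by
    intro k hk
    rw [Finset.mem_range] at hk
    rcases lt_or_ge q k with hqk | hqk
    · rw [map_smul, hR0 k (by omega) hqk, smul_zero, l2norm_zero]
      positivity
    · rw [map_smul, l2norm_smul]
      refine mul_le_mul ?_ (hR _ (Nat.sub_le _ _)) (l2norm_nonneg _) (by positivity)
      rw [norm_mul, norm_pow, norm_inv, Complex.norm_natCast, Complex.norm_real, Real.norm_eq_abs]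
      calc |r| ^ k * ((k.factorial : ℝ))⁻¹ ≤ |r| ^ k * 1 := by
            gcongr
            exact inv_le_one_of_one_le₀ (by exact_mod_cast Nat.one_le_iff_ne_zero.2 k.factorial_ne_zero)
        _ ≤ (1 + |r|) ^ k := by
            rw [mul_one]; gcongr; linarith
        _ ≤ (1 + |r|) ^ q := pow_le_pow_right₀ (by linarith [abs_nonneg r]) hqk
  have h3 := (l2norm_sum_le _ _).trans (Finset.sum_le_sum h2)
  rw [Finset.sum_const, Finset.card_range, nsmul_eq_mul] at h3
  have h4 : ((i + 1 : ℕ) : ℝ) ≤ J.totalSize := by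
    exact_mod_cast Nat.succ_le_of_lt (hi.trans_le (J.size_le_totalSize b))
  rw [h1]
  calc Real.exp ((J.eig b).re * r) * l2norm (∑ k ∈ Finset.range (i + 1),
          R (((r : ℂ) ^ k * ((k.factorial : ℂ))⁻¹) • J.blockVec b (i - k)))
      ≤ Real.exp ((J.eig b).re * r) * (J.totalSize * ((1 + |r|) ^ q * J.vecBound)) := by
        gcongr
        refine h3.trans ?_
        gcongr
    _ = _ := by ring

/-- A linear map is bounded by its values on the Jordan basis. -/
lemma exists_basis_bound : ∃ C, 0 ≤ C ∧ ∀ (T : (Fin d → ℂ) →ₗ[ℂ] (Fin d → ℂ)) (β : ℝ), 0 ≤ β →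
    (∀ b i, i < J.size b → l2norm (T (J.blockVec b i)) ≤ β) →
    ∀ x, l2norm (T x) ≤ C * β * l2norm x := by
  let f := fun p => LinearMap.toContinuousLinearMap (J.vec.coord p)
  refine ⟨∑ p, ‖f p‖, by positivity, fun T β hβ hT x => ?_⟩
  have h1 : T x = ∑ p, J.vec.repr x p • T (J.vec p) := by
    conv_lhs => rw [← J.vec.sum_repr x, map_sum]
    simp only [map_smul]
  rw [h1, Finset.sum_mul, Finset.sum_mul]
  refine (l2norm_sum_le _ _).trans (Finset.sum_le_sum fun p _ => ?_)
  rw [l2norm_smul, mul_right_comm]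
  have h2 : ‖J.vec.repr x p‖ ≤ ‖f p‖ * l2norm x := by
    refine ((f p).le_opNorm x).trans ?_
    gcongr
    exact (pi_norm_le_iff_of_nonneg (l2norm_nonneg x)).2 fun k => norm_le_l2norm x k
  have h3 : l2norm (T (J.vec p)) ≤ β := by
    rw [J.vec_eq_blockVec]
    exact hT _ _ p.2.isLt
  exact mul_le_mul h2 h3 (l2norm_nonneg _) (mul_nonneg (norm_nonneg _) (l2norm_nonneg _))

/-! ### The projections and the nilpotent map on the basis -/

lemma proj_blockVec (b b' : Fin J.numBlocks) (i : ℕ) :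
    J.proj b (J.blockVec b' i) = if b' = b then J.blockVec b' i else 0 := by
  unfold blockVec proj
  split_ifs with h h' h'
  · rw [Module.Basis.constr_basis, if_pos h']
  · rw [Module.Basis.constr_basis, if_neg h']
  · exact LinearMap.map_zero _
  · exact LinearMap.map_zero _

lemma sum_proj_blockVec (S : Finset (Fin J.numBlocks)) (b : Fin J.numBlocks) (i : ℕ) :
    (∑ b' ∈ S, J.proj b') (J.blockVec b i) = if b ∈ S then J.blockVec b i else 0 := by
  simp [LinearMap.sum_apply, proj_blockVec]

lemma nil_pow_blockVec (b : Fin J.numBlocks) (k : ℕ) : ∀ i, i < J.size b →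
    (J.nil ^ k) (J.blockVec b i) = if k ≤ i then J.blockVec b (i - k) else 0 := by
  induction k with
  | zero => intro i _; simp
  | succ k ih =>
    intro i hi
    rw [pow_succ, Module.End.mul_apply, J.blockVec_of_lt hi]
    unfold nil at *
    rw [Module.Basis.constr_basis]
    cases i with
    | zero => simp
    | succ i =>
      simp only [Nat.add_eq_zero_iff, one_ne_zero, and_false, if_false, add_tsub_cancel_right]
      rw [← J.blockVec_of_lt (by omega : i < J.size b), ih i (by omega)]
      simp

end JordanBasis

end
end BranchingMoments

namespace BranchingMoments
noncomputable section

variable {d : ℕ}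

/-! ### Growth of the exponential and the Perron-Frobenius eigenvalue -/

lemma exists_pos_le_of_finite {ι : Type*} [Finite ι] {f : ι → ℝ} (hf : ∀ i, 0 < f i) :
    ∃ ε, 0 < ε ∧ ∀ i, ε ≤ f i := by
  rcases isEmpty_or_nonempty ι with h | h
  · exact ⟨1, one_pos, fun i => h.elim i⟩
  · obtain ⟨i, hi⟩ := Finite.exists_min f
    exact ⟨f i, hf i, hi⟩

lemma exists_one_add_pow_le_exp (n : ℕ) {δ : ℝ} (hδ : 0 < δ) :
    ∃ C, 0 < C ∧ ∀ r : ℝ, 0 ≤ r → (1 + r) ^ n ≤ C * Real.exp (δ * r) := by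
  -- Dividing by `n + 1` rather than `n` covers n = 0.
  let η := δ / (n + 1)
  have hη : 0 < η := by positivity
  refine ⟨(1 + 1 / η) ^ n, by positivity, fun r hr => ?_⟩
  have h1 : 1 + r ≤ (1 + 1 / η) * Real.exp (η * r) := by
    have h2 := Real.add_one_le_exp (η * r)
    have h3 : 1 + r ≤ (1 + 1 / η) * (η * r + 1) := by
      have : (1 + 1 / η) * (η * r + 1) = 1 + r + (η * r + 1 / η) := by field_simp; ring
      rw [this]
      have : 0 ≤ η * r + 1 / η := by positivity
      linarith
    exact h3.trans (by gcongr)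
  calc (1 + r) ^ n ≤ ((1 + 1 / η) * Real.exp (η * r)) ^ n := by gcongr
    _ = (1 + 1 / η) ^ n * Real.exp (n * (η * r)) := by rw [mul_pow, ← Real.exp_nat_mul]
    _ ≤ (1 + 1 / η) ^ n * Real.exp (δ * r) := by
      have h2 : (n : ℝ) * η ≤ δ := by
        simp only [η]
        rw [← mul_div_assoc, div_le_iff₀ (by positivity)]
        linarith [mul_comm δ (n : ℝ)]
      have h3 : n * (η * r) ≤ δ * r := by
        rw [← mul_assoc]
        exact mul_le_mul_of_nonneg_right h2 hr
      exact mul_le_mul_of_nonneg_left (Real.exp_le_exp.2 h3) (by positivity)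

lemma le_of_exp_growth {c C ρ σ : ℝ} (hc : 0 < c) (n : ℕ)
    (h : ∀ r : ℝ, 0 ≤ r → c * Real.exp (ρ * r) ≤ C * ((1 + r) ^ n * Real.exp (σ * r))) : ρ ≤ σ := by
  by_contra hlt
  rw [not_le] at hlt
  have hδ : 0 < (ρ - σ) / 2 := by linarith
  obtain ⟨D, hD, hD'⟩ := exists_one_add_pow_le_exp n hδ
  have hC : 0 < C := by
    have := h 0 le_rfl
    simp at this
    linarith
  have h1 : ∀ r : ℝ, 0 ≤ r → Real.exp ((ρ - σ) / 2 * r) ≤ C * D / c := by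
    intro r hr
    rw [le_div_iff₀ hc]
    have e1 : Real.exp (ρ * r) = Real.exp ((ρ - σ) / 2 * r) *
        (Real.exp ((ρ - σ) / 2 * r) * Real.exp (σ * r)) := by
      rw [← Real.exp_add, ← Real.exp_add]; congr 1; ring
    have h2 := h r hr
    have h3 : C * ((1 + r) ^ n * Real.exp (σ * r)) ≤
        C * (D * Real.exp ((ρ - σ) / 2 * r) * Real.exp (σ * r)) := by
      gcongr; exact hD' r hr
    rw [e1] at h2
    have h4 : 0 < Real.exp ((ρ - σ) / 2 * r) * Real.exp (σ * r) := by positivity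
    refine le_of_mul_le_mul_right ?_ h4
    linarith
  -- At this r the exponent equals the bound y = C D / c, and exp y ≤ y contradicts 1 + y ≤ exp y.
  have h5 := h1 (C * D / c / ((ρ - σ) / 2)) (by positivity)
  rw [mul_div_cancel₀ _ hδ.ne'] at h5
  have := Real.add_one_le_exp (C * D / c)
  linarith

lemma mem_spectrum_iff (M : Matrix (Fin d) (Fin d) ℂ) (μ : ℂ) :
    μ ∈ spectrum ℂ M ↔ ∃ v, v ≠ 0 ∧ M *ᵥ v = μ • v := by
  rw [← Matrix.spectrum_toLin', ← Module.End.hasEigenvalue_iff_mem_spectrum]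
  constructor
  · intro h
    obtain ⟨v, hv⟩ := h.exists_hasEigenvector
    exact ⟨v, hv.2, by simpa using hv.apply_eq_smul⟩
  · rintro ⟨v, hv0, hv⟩
    exact Module.End.hasEigenvalue_of_hasEigenvector
      (Module.End.hasEigenvector_iff.2 ⟨Module.End.mem_eigenspace_iff.2 (by simpa using hv), hv0⟩)

lemma finite_spectrum_re (A : Matrix (Fin d) (Fin d) ℝ) :
    {r : ℝ | ∃ z ∈ spectrum ℂ (toC A), z.re = r}.Finite :=
  (Matrix.finite_spectrum (toC A)).image Complex.re

lemma re_le_perronEigenvalue {A : Matrix (Fin d) (Fin d) ℝ} {μ : ℂ} (hμ : μ ∈ spectrum ℂ (toC A)) :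
    μ.re ≤ perronEigenvalue A :=
  le_csSup (finite_spectrum_re A).bddAbove ⟨μ, hμ, rfl⟩

lemma exists_re_eq_perronEigenvalue {A : Matrix (Fin d) (Fin d) ℝ} (h : 0 < perronEigenvalue A) :
    ∃ μ ∈ spectrum ℂ (toC A), μ.re = perronEigenvalue A := by
  refine Set.Nonempty.csSup_mem ?_ (finite_spectrum_re A)
  by_contra hne
  rw [Set.not_nonempty_iff_eq_empty] at hne
  -- The real supremum of the empty set is `0` by convention, so an empty spectrum contradicts `h`.
  rw [perronEigenvalue, hne, Real.sSup_empty] at h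
  exact lt_irrefl _ h

namespace JordanBasis

variable {A : Matrix (Fin d) (Fin d) ℝ} (J : JordanBasis A)

lemma eig_mem_spectrum (b : Fin J.numBlocks) : J.eig b ∈ spectrum ℂ (toC A) :=
  (mem_spectrum_iff _ _).2 ⟨_, J.vec.ne_zero _, J.map_zero b⟩

lemma re_eig_le (b : Fin J.numBlocks) : (J.eig b).re ≤ perronEigenvalue A :=
  re_le_perronEigenvalue (J.eig_mem_spectrum b)

lemma exists_growth {σ : ℝ} (hσ : ∀ b, (J.eig b).re ≤ σ) : ∃ C, 0 ≤ C ∧ ∀ r : ℝ, 0 ≤ r → ∀ x,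
    l2norm (expMap A r x) ≤ C * ((1 + r) ^ J.totalSize * Real.exp (σ * r)) * l2norm x := by
  obtain ⟨C, hC, h⟩ := J.exists_basis_bound
  have hM := J.vecBound_nonneg
  refine ⟨C * (J.totalSize * J.vecBound), by positivity, fun r hr x => ?_⟩
  refine (h (expMap A r) (J.totalSize * J.vecBound * ((1 + r) ^ J.totalSize * Real.exp (σ * r)))
    (by positivity) (fun b i hi => ?_) x).trans (le_of_eq (by ring))
  have h1 := J.l2norm_map_expMap_blockVec_le LinearMap.id b (q := J.totalSize) hi
    (fun j _ => J.l2norm_blockVec_le b j) (fun k hk hk' => by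
      have := J.size_le_totalSize b; omega) r
  rw [abs_of_nonneg hr] at h1
  refine h1.trans ?_
  gcongr
  exact hσ b

/-- If every block had smaller real part, e^{Ar} applied to an eigenvector for μ would grow more
slowly than e^{r Re μ}. -/
lemma exists_re_le_re_eig {μ : ℂ} (hμ : μ ∈ spectrum ℂ (toC A)) :
    ∃ b, μ.re ≤ (J.eig b).re := by
  by_contra! hne
  obtain ⟨ε, hε, hε'⟩ := exists_pos_le_of_finite (f := fun b => μ.re - (J.eig b).re)
    (fun b => sub_pos.2 (hne b))
  obtain ⟨C, -, h⟩ := J.exists_growth (σ := μ.re - ε) (fun b => by linarith [hε' b])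
  obtain ⟨v, hv0, hv⟩ := (mem_spectrum_iff _ _).1 hμ
  have h2 := le_of_exp_growth (ρ := μ.re) (σ := μ.re - ε) (C := C * l2norm v) (l2norm_pos hv0)
    J.totalSize (fun r hr => by
      have h1 := h r hr v
      rw [expMap_eigenvector hv, l2norm_smul, Complex.norm_exp] at h1
      simp only [Complex.mul_re, Complex.ofReal_re, Complex.ofReal_im, zero_mul, sub_zero] at h1
      rw [mul_comm r] at h1
      linarith)
  linarith

end JordanBasis

/-- Nonnegativity of B propagates Bw ≥ ρw to B^n w ≥ ρ^n w, and the exponential series are compared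
term by term. The real part only returns to real numbers, since the matrix exponential is taken over
ℂ. -/
lemma exp_mul_le_re_exp_mulVec {B : Matrix (Fin d) (Fin d) ℝ} (hB : ∀ i j, 0 ≤ B i j) {w : Fin d → ℝ}
    {ρ : ℝ} (hw : ∀ i, ρ * w i ≤ (B *ᵥ w) i) (hρ : 0 ≤ ρ) {t : ℝ} (ht : 0 ≤ t) (i : Fin d) :
    Real.exp (ρ * t) * w i ≤
      ((NormedSpace.exp ((t : ℂ) • toC B) *ᵥ fun k => (w k : ℂ)) i).re := by
  have hpow : ∀ n : ℕ, ∀ i, ρ ^ n * w i ≤ (B ^ n *ᵥ w) i := by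
    intro n
    induction n with
    | zero => intro i; simp
    | succ n ih =>
      intro i
      have h1 : (B ^ (n + 1) *ᵥ w) i = ∑ k, B i k * (B ^ n *ᵥ w) k := by
        rw [pow_succ', ← Matrix.mulVec_mulVec]; rfl
      rw [h1]
      calc ρ ^ (n + 1) * w i = ρ ^ n * (ρ * w i) := by ring
        _ ≤ ρ ^ n * (B *ᵥ w) i := by gcongr; exact hw i
        _ = ∑ k, B i k * (ρ ^ n * w k) := by
          change ρ ^ n * ∑ k, B i k * w k = _
          rw [Finset.mul_sum]
          exact Finset.sum_congr rfl fun k _ => by ring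
        _ ≤ _ := Finset.sum_le_sum fun k _ => mul_le_mul_of_nonneg_left (ih k) (hB i k)
  have hcast : ∀ n : ℕ, toC B ^ n *ᵥ (fun k => (w k : ℂ)) = fun k => (((B ^ n *ᵥ w) k : ℝ) : ℂ) := by
    intro n
    have h1 : toC B ^ n = toC (B ^ n) := by
      have := (Matrix.map_pow B Complex.ofRealHom n).symm
      exact this
    rw [h1]
    funext k
    simp [toC, Matrix.mulVec, dotProduct]
  have h1 : HasSum (fun n : ℕ => t ^ n * ((n.factorial : ℝ))⁻¹ * (B ^ n *ᵥ w) i)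
      (((NormedSpace.exp ((t : ℂ) • toC B) *ᵥ fun k => (w k : ℂ)) i).re) := by
    have h2 := hasSum_exp_mulVec ((t : ℂ) • toC B) (fun k => (w k : ℂ))
    have h3 := Complex.hasSum_re ((Pi.hasSum.1 h2) i)
    convert h3 using 1
    funext n
    rw [smul_pow, Matrix.smul_mulVec, hcast]
    simp only [Pi.smul_apply, smul_eq_mul, ← Complex.ofReal_pow, ← Complex.ofReal_natCast,
      ← Complex.ofReal_inv, ← Complex.ofReal_mul, Complex.ofReal_re]
    ring
  have h4 : HasSum (fun n : ℕ => (ρ * t) ^ n / (n.factorial : ℝ) * w i) (Real.exp (ρ * t) * w i) := by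
    have := NormedSpace.expSeries_div_hasSum_exp (ρ * t)
    rw [← Real.exp_eq_exp_ℝ] at this
    exact this.mul_right _
  refine hasSum_le (fun n => ?_) h4 h1
  have h5 : 0 ≤ t ^ n * ((n.factorial : ℝ))⁻¹ := by positivity
  calc (ρ * t) ^ n / (n.factorial : ℝ) * w i = t ^ n * ((n.factorial : ℝ))⁻¹ * (ρ ^ n * w i) := by
        rw [mul_pow]; ring
    _ ≤ _ := mul_le_mul_of_nonneg_left (hpow n i) h5

/-- For a matrix with nonnegative off-diagonal entries, an eigenvalue of largest real part is
real. -/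
theorem eq_perronEigenvalue_of_re_eq {A : Matrix (Fin d) (Fin d) ℝ} (J : JordanBasis A)
    (hA : ∀ i j, i ≠ j → 0 ≤ A i j) {μ : ℂ} (hμ : μ ∈ spectrum ℂ (toC A))
    (hre : μ.re = perronEigenvalue A) : μ = (perronEigenvalue A : ℂ) := by
  obtain ⟨v, hv0, hv⟩ := (mem_spectrum_iff _ _).1 hμ
  obtain ⟨k₀, hk₀⟩ := Function.ne_iff.1 hv0
  -- A shift large enough to make the diagonal of A + c nonnegative.
  let c : ℝ := ∑ i, |A i i|
  let B : Matrix (Fin d) (Fin d) ℝ := A + c • 1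
  let w : Fin d → ℝ := fun k => ‖v k‖
  let ρ : ℝ := ‖μ + c‖
  have hB : ∀ i j, 0 ≤ B i j := by
    intro i j
    by_cases hij : i = j
    · subst hij
      have h1 : |A i i| ≤ c :=
        Finset.single_le_sum (f := fun i => |A i i|) (fun _ _ => abs_nonneg _) (Finset.mem_univ i)
      have := neg_abs_le (A i i)
      simp only [B, Matrix.add_apply, Matrix.smul_apply, Matrix.one_apply_eq, smul_eq_mul, mul_one]
      linarith
    · simpa [B, Matrix.one_apply_ne hij] using hA i j hij
  have hBC : toC B = toC A + (c : ℂ) • 1 := by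
    ext i j
    by_cases hij : i = j
    · subst hij; simp [toC, B]
    · simp [toC, B, Matrix.one_apply_ne hij]
  have hBv : toC B *ᵥ v = (μ + c) • v := by
    rw [hBC, Matrix.add_mulVec, hv, Matrix.smul_mulVec, Matrix.one_mulVec, add_smul]
  -- Triangle inequality for a nonnegative matrix: the vector of moduli of an eigenvector is
  -- subinvariant.
  have hw : ∀ i, ρ * w i ≤ (B *ᵥ w) i := by
    intro i
    have h1 : ρ * w i = ‖(toC B *ᵥ v) i‖ := by
      rw [hBv, Pi.smul_apply, norm_smul]
    rw [h1]
    have h2 : (toC B *ᵥ v) i = ∑ j, toC B i j * v j := rfl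
    rw [h2]
    refine (norm_sum_le _ _).trans (le_of_eq ?_)
    refine Finset.sum_congr rfl fun j _ => ?_
    rw [norm_mul]
    simp only [toC, Matrix.map_apply, Complex.norm_real, Real.norm_of_nonneg (hB i j), w]
  obtain ⟨C, -, hC⟩ := J.exists_growth J.re_eig_le
  -- At the coordinate k₀, e^{Ar}w is at least e^{(ρ-c)r} w k₀, while its growth rate is at most λ₁.
  -- As Re μ = λ₁, this yields |μ + c| ≤ Re(μ + c), which forces the imaginary part to vanish.
  have hle : ρ - c ≤ perronEigenvalue A := by
    refine le_of_exp_growth (c := w k₀) (C := C * l2norm fun k => (w k : ℂ)) (norm_pos_iff.2 hk₀)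
      J.totalSize fun r hr => ?_
    have h1 := exp_mul_le_re_exp_mulVec hB hw (norm_nonneg _) hr k₀
    have h2 : NormedSpace.exp ((r : ℂ) • toC A) *ᵥ (fun k => (w k : ℂ)) =
        Complex.exp (r * (-c : ℂ)) • (NormedSpace.exp ((r : ℂ) • toC B) *ᵥ fun k => (w k : ℂ)) := by
      rw [exp_smul_mulVec_eq (toC A) r (-c), hBC, neg_smul, sub_neg_eq_add]
    have h3 := (Complex.re_le_norm _).trans
      (norm_le_l2norm (expMap A r fun k => (w k : ℂ)) k₀)
    rw [expMap_apply, h2] at h3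
    have h4 : Complex.exp (r * (-c : ℂ)) = ((Real.exp (-(c * r)) : ℝ) : ℂ) := by
      push_cast; congr 1; ring
    rw [h4, Pi.smul_apply, smul_eq_mul, Complex.re_ofReal_mul] at h3
    have h5 := hC r hr fun k => (w k : ℂ)
    rw [expMap_apply, h2, h4] at h5
    calc w k₀ * Real.exp ((ρ - c) * r)
        = Real.exp (-(c * r)) * (Real.exp (ρ * r) * w k₀) := by
          rw [← mul_assoc, ← Real.exp_add, mul_comm]; congr 2; ring
      _ ≤ Real.exp (-(c * r)) *
          ((NormedSpace.exp ((r : ℂ) • toC B) *ᵥ fun k => (w k : ℂ)) k₀).re := by gcongr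
      _ ≤ _ := h3.trans (h5.trans (le_of_eq (by ring)))
  have h1 : ‖μ + c‖ ≤ (μ + c).re := by
    simp only [Complex.add_re, Complex.ofReal_re, hre]
    linarith
  have h2 : (μ + c).im = 0 := by
    have h3 := Complex.sq_norm_sub_sq_re (μ + c)
    have h4 : ‖μ + c‖ = (μ + c).re := le_antisymm h1 (Complex.re_le_norm _)
    rw [h4, sub_self] at h3
    exact pow_eq_zero_iff (two_ne_zero) |>.1 h3.symm
  apply Complex.ext
  · simp [hre]
  · simpa using h2

namespace JordanBasis

variable {A : Matrix (Fin d) (Fin d) ℝ} (J : JordanBasis A)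

lemma size_le_m1 {b : Fin J.numBlocks} (hb : J.eig b = (perronEigenvalue A : ℂ)) :
    J.size b ≤ J.m1 := by
  classical
  unfold m1
  exact Finset.le_sup (f := J.size) (by simp [hb])

/-- Makes the natural-number subtraction in `J.m1 - 1` a true one. -/
lemma one_le_m1 (hA : ∀ i j, i ≠ j → 0 ≤ A i j) (h : 0 < perronEigenvalue A) : 1 ≤ J.m1 := by
  obtain ⟨μ, hμ, hre⟩ := exists_re_eq_perronEigenvalue h
  obtain ⟨b, hb⟩ := J.exists_re_le_re_eig hμ
  have h1 : (J.eig b).re = perronEigenvalue A := le_antisymm (J.re_eig_le b) (hre ▸ hb)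
  exact (J.size_pos b).trans_le
    (J.size_le_m1 (eq_perronEigenvalue_of_re_eq J hA (J.eig_mem_spectrum b) h1))

/-- The growth `(1 + s)^{m₁ - 1} e^{λ₁ s}` of the mean of the process. -/
def meanGrowth (s : ℝ) : ℝ := (1 + |s|) ^ (J.m1 - 1) * Real.exp (perronEigenvalue A * s)

lemma continuous_meanGrowth : Continuous J.meanGrowth := by
  unfold meanGrowth
  fun_prop

lemma meanGrowth_nonneg (s : ℝ) : 0 ≤ J.meanGrowth s := by
  unfold meanGrowth
  positivity

lemma one_le_meanGrowth (h : 0 < perronEigenvalue A) {s : ℝ} (hs : 0 ≤ s) : 1 ≤ J.meanGrowth s :=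
  one_le_mul_of_one_le_of_one_le (one_le_pow₀ (by linarith [abs_nonneg s]))
    (Real.one_le_exp (by positivity))

/-- A block with Re λ = λ₁ has λ = λ₁, hence size at most m₁ and polynomial degree at most m₁ - 1.
In any other block the spectral gap absorbs the polynomial. -/
lemma exists_meanGrowth_bound (hA : ∀ i j, i ≠ j → 0 ≤ A i j) :
    ∃ C, 0 < C ∧ ∀ r : ℝ, 0 ≤ r → ∀ x, l2norm (expMap A r x) ≤ C * J.meanGrowth r * l2norm x := by
  obtain ⟨C, hC, h⟩ := J.exists_basis_bound
  have hM := J.vecBound_nonneg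
  obtain ⟨ε, hε, hε'⟩ := exists_pos_le_of_finite
    (f := fun b => if (J.eig b).re = perronEigenvalue A then 1
      else perronEigenvalue A - (J.eig b).re) (fun b => by
        split_ifs with hb
        · exact one_pos
        · exact sub_pos.2 (lt_of_le_of_ne (J.re_eig_le b) hb))
  obtain ⟨D, hD, hD'⟩ := exists_one_add_pow_le_exp J.totalSize hε
  refine ⟨C * (J.totalSize * J.vecBound * (1 + D)) + 1, by positivity, fun r hr x => ?_⟩
  have hK := J.meanGrowth_nonneg r
  have hx := l2norm_nonneg x
  have key := h (expMap A r) (J.totalSize * J.vecBound * ((1 + D) * J.meanGrowth r)) (by positivity)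
    (fun b i hi => ?_) x
  · refine key.trans ?_
    have : 0 ≤ J.meanGrowth r * l2norm x := by positivity
    nlinarith
  by_cases hb : (J.eig b).re = perronEigenvalue A
  · have hbe := eq_perronEigenvalue_of_re_eq J hA (J.eig_mem_spectrum b) hb
    have hsz := J.size_le_m1 hbe
    have h1 := J.l2norm_map_expMap_blockVec_le LinearMap.id b (q := J.m1 - 1) hi
      (fun j _ => J.l2norm_blockVec_le b j) (fun k hk hk' => by omega) r
    rw [hb] at h1
    refine h1.trans ?_
    change _ * J.meanGrowth r ≤ _
    gcongr
    exact le_mul_of_one_le_left hK (by linarith)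
  · have h1 := J.l2norm_map_expMap_blockVec_le LinearMap.id b (q := J.totalSize) hi
      (fun j _ => J.l2norm_blockVec_le b j) (fun k hk hk' => by
        have := J.size_le_totalSize b; omega) r
    refine h1.trans (mul_le_mul_of_nonneg_left ?_ (by positivity))
    have h2 := hε' b
    simp only [hb, if_false] at h2
    rw [abs_of_nonneg hr]
    have h3 : (1 : ℝ) ≤ (1 + |r|) ^ (J.m1 - 1) := one_le_pow₀ (by linarith [abs_nonneg r])
    calc (1 + r) ^ J.totalSize * Real.exp ((J.eig b).re * r)
        ≤ D * Real.exp (ε * r) * Real.exp ((J.eig b).re * r) := by gcongr; exact hD' r hr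
      _ = D * Real.exp ((ε + (J.eig b).re) * r) := by
        rw [mul_assoc, ← Real.exp_add]; congr 2; ring
      _ ≤ D * Real.exp (perronEigenvalue A * r) := by gcongr; linarith
      _ ≤ (1 + D) * J.meanGrowth r := by
        unfold meanGrowth
        have := Real.exp_pos (perronEigenvalue A * r)
        gcongr
        · linarith
        · exact le_mul_of_one_le_left this.le h3

end JordanBasis

end
end BranchingMoments

namespace BranchingMoments
noncomputable section

variable {d : ℕ}

/-! ### The moment bounds for the branching process -/

lemma ofReal_natVec (x : Fin d → ℕ) : (fun k => ((natVec x k : ℝ) : ℂ)) = compVec x := by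
  funext k
  simp [natVec, compVec]

/-- Integrality: a nonzero composition has norm at least 1. Terms linear in ‖X(0)‖ can thus be
merged with quadratic ones. -/
lemma l2norm_compVec_le_sq (x : Fin d → ℕ) : l2norm (compVec x) ≤ l2norm (compVec x) ^ 2 := by
  by_cases hx : x = 0
  · have : compVec x = 0 := by subst hx; funext k; simp [compVec]
    simp [this, l2norm_zero]
  · obtain ⟨k, hk⟩ := Function.ne_iff.1 hx
    have h1 := norm_le_l2norm (compVec x) k
    have h2 : (1 : ℝ) ≤ ‖compVec x k‖ := by
      simp only [compVec, Complex.norm_natCast]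
      exact_mod_cast Nat.one_le_iff_ne_zero.2 hk
    exact le_self_pow₀ (h2.trans h1) two_ne_zero

lemma total_le_mul_l2norm (x : Fin d → ℕ) : total x ≤ d * l2norm (compVec x) := by
  have h : ∀ k ∈ (Finset.univ : Finset (Fin d)), (x k : ℝ) ≤ l2norm (compVec x) := fun k _ => by
    have := norm_le_l2norm (compVec x) k
    simpa [compVec] using this
  simpa [total] using Finset.sum_le_card_nsmul _ _ _ h

/-- The backward flow `s ↦ R e^{A (T - s)}`. -/
def expFlow (A : Matrix (Fin d) (Fin d) ℝ) (R : (Fin d → ℂ) →ₗ[ℂ] (Fin d → ℂ)) (T s : ℝ) :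
    (Fin d → ℝ) →ₗ[ℝ] EuclideanSpace ℂ (Fin d) where
  toFun x := WithLp.toLp 2 (R (expMap A (T - s) fun k => (x k : ℂ)))
  map_add' x y := by
    rw [← WithLp.toLp_add, ← map_add, ← map_add]
    congr 3
    funext k
    simp
  map_smul' c x := by
    have h : (fun k => (((c • x) k : ℝ) : ℂ)) = (c : ℂ) • fun k => (x k : ℂ) := by
      funext k
      simp
    rw [h, map_smul, map_smul, WithLp.toLp_smul]
    rfl

variable {A : Matrix (Fin d) (Fin d) ℝ}

lemma norm_expFlow (R : (Fin d → ℂ) →ₗ[ℂ] (Fin d → ℂ)) (T s : ℝ) (x : Fin d → ℝ) :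
    ‖expFlow A R T s x‖ = l2norm (R (expMap A (T - s) fun k => (x k : ℂ))) := rfl

lemma isBackwardFlow_expFlow (A : Matrix (Fin d) (Fin d) ℝ) (R : (Fin d → ℂ) →ₗ[ℂ] (Fin d → ℂ))
    (T : ℝ) : IsBackwardFlow A (expFlow A R T) := by
  intro x s
  have h1 := (hasDerivAt_expMap A (fun k => (x k : ℂ)) (T - s)).scomp s
    ((hasDerivAt_id s).const_sub T)
  let L : (Fin d → ℂ) →L[ℂ] EuclideanSpace ℂ (Fin d) := LinearMap.toContinuousLinearMap
    ((WithLp.linearEquiv 2 ℂ (Fin d → ℂ)).symm.toLinearMap ∘ₗ R)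
  have h2 := (L.restrictScalars ℝ).hasFDerivAt.comp_hasDerivAt s h1
  have h3 : toC A *ᵥ (fun k => (x k : ℂ)) = fun k => (((A *ᵥ x) k : ℝ) : ℂ) := by
    funext k
    simp [toC, Matrix.mulVec, dotProduct]
  have h4 : HasDerivAt (fun s => expFlow A R T s x)
      ((L.restrictScalars ℝ) ((-1 : ℝ) • expMap A (T - s) (toC A *ᵥ fun k => (x k : ℂ)))) s := h2
  rw [map_smul, neg_one_smul, h3] at h4
  exact h4

lemma integral_exp_neg_mul_le {c : ℝ} (hc : 0 < c) (T : ℝ) :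
    ∫ s in (0 : ℝ)..T, Real.exp (-(c * s)) ≤ 1 / c := by
  have h : ∀ s ∈ Set.uIcc 0 T, HasDerivAt (fun s => -(1 / c) * Real.exp (-(c * s)))
      (Real.exp (-(c * s))) s := by
    intro s _
    have h1 : HasDerivAt (fun s => -(1 / c) * Real.exp (-(c * s)))
        (-(1 / c) * (Real.exp (-(c * s)) * (-(c * 1)))) s :=
      ((((hasDerivAt_id s).const_mul c).neg).exp).const_mul (-(1 / c))
    refine h1.congr_deriv ?_
    field_simp
  rw [intervalIntegral.integral_eq_sub_of_hasDerivAt h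
    (Continuous.intervalIntegrable (by fun_prop) _ _)]
  have := Real.exp_pos (-(c * T))
  have hc' : 0 < 1 / c := by positivity
  simp only [mul_zero, neg_zero, Real.exp_zero, mul_one]
  nlinarith

/-- The exponents add up to 2λ₁T - λ₁s; half of the decay in s pays for the polynomial of K(s), and
the other half is integrable. -/
lemma JordanBasis.exists_integral_meanGrowth_le (J : JordanBasis A) (h : 0 < perronEigenvalue A) :
    ∃ C, 0 < C ∧ ∀ T : ℝ, 0 ≤ T →
      ∫ s in (0 : ℝ)..T, J.meanGrowth (T - s) ^ 2 * J.meanGrowth s ≤ C * J.meanGrowth T ^ 2 := by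
  set p := perronEigenvalue A with hp
  obtain ⟨D, hD, hD'⟩ := exists_one_add_pow_le_exp (J.m1 - 1) (half_pos h)
  refine ⟨D * (1 / (p / 2)), by positivity, fun T hT => ?_⟩
  have hc := J.continuous_meanGrowth
  calc ∫ s in (0 : ℝ)..T, J.meanGrowth (T - s) ^ 2 * J.meanGrowth s
      ≤ ∫ s in (0 : ℝ)..T, (J.meanGrowth T ^ 2 * D) * Real.exp (-(p / 2 * s)) := by
        refine intervalIntegral.integral_mono_on hT
          (Continuous.intervalIntegrable (by fun_prop) _ _)
          (Continuous.intervalIntegrable (by fun_prop) _ _) fun s hs => ?_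
        have hTs : 0 ≤ T - s := sub_nonneg.2 hs.2
        unfold meanGrowth
        rw [abs_of_nonneg hTs, abs_of_nonneg hT, abs_of_nonneg hs.1, ← hp]
        have e1 : Real.exp (p * (T - s)) ^ 2 * Real.exp (p * s) =
            Real.exp (p * T) ^ 2 * Real.exp (-(p * s)) := by
          rw [← Real.exp_nat_mul, ← Real.exp_nat_mul, ← Real.exp_add, ← Real.exp_add]
          congr 1
          push_cast
          ring
        have e2 : Real.exp (p / 2 * s) * Real.exp (-(p * s)) = Real.exp (-(p / 2 * s)) := by
          rw [← Real.exp_add]; congr 1; ring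
        have e3 : (1 + (T - s)) ^ (J.m1 - 1) ≤ (1 + T) ^ (J.m1 - 1) := by
          have := hs.1
          gcongr
          linarith
        calc ((1 + (T - s)) ^ (J.m1 - 1) * Real.exp (p * (T - s))) ^ 2 *
                ((1 + s) ^ (J.m1 - 1) * Real.exp (p * s))
            = ((1 + (T - s)) ^ (J.m1 - 1)) ^ 2 * (1 + s) ^ (J.m1 - 1) *
                (Real.exp (p * (T - s)) ^ 2 * Real.exp (p * s)) := by ring
          _ ≤ ((1 + T) ^ (J.m1 - 1)) ^ 2 * (D * Real.exp (p / 2 * s)) *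
                (Real.exp (p * T) ^ 2 * Real.exp (-(p * s))) := by
              rw [e1]
              have := hs.1
              gcongr
              exact hD' s hs.1
          _ = ((1 + T) ^ (J.m1 - 1) * Real.exp (p * T)) ^ 2 * D *
                (Real.exp (p / 2 * s) * Real.exp (-(p * s))) := by ring
          _ = _ := by rw [e2]
    _ = (J.meanGrowth T ^ 2 * D) * ∫ s in (0 : ℝ)..T, Real.exp (-(p / 2 * s)) :=
        intervalIntegral.integral_const_mul _ _
    _ ≤ (J.meanGrowth T ^ 2 * D) * (1 / (p / 2)) := by
        gcongr
        exact integral_exp_neg_mul_le (half_pos h) T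
    _ = _ := by ring

/-- Both bounds use the flow with R = id: the mean is the sum of the coordinates of e^{At}X(0), and
the second moment is controlled by the variance plus the squared mean. -/
theorem JordanBasis.exists_total_bound (J : JordanBasis A) {a : Fin d → ℝ} (ha : ∀ i, 0 < a i)
    (hA : ∀ i j, i ≠ j → 0 ≤ A i j) (h : 0 < perronEigenvalue A) :
    ∃ C, 0 < C ∧ ∀ (ν : Fin d → Measure (Fin d → ℤ)), (∀ i, IsProbabilityMeasure (ν i)) →
      AssumptionA1 ν → AssumptionA2 ν → meanMatrix a ν = A →
      ∀ (x₀ : Fin d → ℕ) (P : ℝ → Measure (Fin d → ℕ)), IsForwardSolution a ν x₀ P →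
      ∀ t : ℝ, 0 ≤ t →
        ∫ x, total x ∂(P t) ≤ C * J.meanGrowth t * l2norm (compVec x₀) ∧
        ∫ x, total x ^ 2 ∂(P t) ≤
          C ^ 2 * (1 + √(Xi4 ν)) * l2norm (compVec x₀) ^ 2 * J.meanGrowth t ^ 2 := by
  obtain ⟨C₁, hC₁, hK⟩ := J.exists_meanGrowth_bound hA
  obtain ⟨C₂, hC₂, hI⟩ := J.exists_integral_meanGrowth_le h
  have hα : 0 ≤ ∑ i, a i := Finset.sum_nonneg fun i _ => (ha i).le
  set α := ∑ i, a i
  let M := (d : ℝ) * C₁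
  let H := 2 * (d : ℝ) ^ 2 * C₁ ^ 2 * (α * M * C₂ + 1)
  have hM : 0 ≤ M := by positivity
  have hH : 0 ≤ H := by positivity
  -- One constant for both bounds: it dominates `M`, and its square dominates `H`.
  refine ⟨1 + M + H, by positivity, fun ν hν hA1 hA2 hmean x₀ P hP => ?_⟩
  set n₀ := l2norm (compVec x₀) with hn₀
  have hn0 : 0 ≤ n₀ := l2norm_nonneg _
  have hnsq : n₀ ≤ n₀ ^ 2 := l2norm_compVec_le_sq x₀
  have hfirst : ∀ t : ℝ, 0 ≤ t → ∫ x, total x ∂(P t) ≤ M * J.meanGrowth t * n₀ := by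
    intro t ht
    let ℓ : EuclideanSpace ℂ (Fin d) →L[ℝ] ℝ := ∑ k, Complex.reCLM ∘L
      ((EuclideanSpace.proj k : EuclideanSpace ℂ (Fin d) →L[ℂ] ℂ).restrictScalars ℝ)
    have hℓ : ∀ v : Fin d → ℂ, ℓ (WithLp.toLp 2 v) = ∑ k, (v k).re := fun v => by
      simp [ℓ]
    have h1 := hP.integral_clm ha hA1 hA2 (G := expFlow A LinearMap.id t)
      (by rw [hmean]; exact isBackwardFlow_expFlow A _ t) ℓ ht
    have h2 : ∀ x : Fin d → ℕ, ℓ (expFlow A LinearMap.id t t (natVec x)) = total x := fun x => by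
      change ℓ (WithLp.toLp 2 (expMap A (t - t) fun k => (natVec x k : ℂ))) = _
      rw [sub_self, expMap_zero, hℓ]
      simp [natVec, total]
    simp only [h2] at h1
    rw [h1]
    change ℓ (WithLp.toLp 2 (expMap A (t - 0) fun k => (natVec x₀ k : ℂ))) ≤ _
    rw [sub_zero, hℓ, ofReal_natVec]
    have h3 : ∀ k ∈ (Finset.univ : Finset (Fin d)), (expMap A t (compVec x₀) k).re ≤
        C₁ * J.meanGrowth t * n₀ := fun k _ =>
      ((Complex.re_le_norm _).trans (norm_le_l2norm _ k)).trans (hK t ht _)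
    refine (Finset.sum_le_card_nsmul _ _ _ h3).trans (le_of_eq ?_)
    simp only [Finset.card_univ, Fintype.card_fin, nsmul_eq_mul, M]
    ring
  refine fun t ht => ⟨?_, ?_⟩
  · refine (hfirst t ht).trans ?_
    have := J.meanGrowth_nonneg t
    gcongr
    linarith
  have hKt := J.meanGrowth_nonneg t
  have hc := J.continuous_meanGrowth
  obtain ⟨i1, h1⟩ := hP.integral_norm_sq_le ha hA1 hA2 (G := expFlow A LinearMap.id t)
    (by rw [hmean]; exact isBackwardFlow_expFlow A _ t) ht
    (b := fun s => C₁ * J.meanGrowth (t - s)) (m := fun s => M * J.meanGrowth s * n₀)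
    (fun s hs x => by
      rw [norm_expFlow]
      exact hK (t - s) (sub_nonneg.2 hs.2) _)
    (fun s hs => hfirst s hs.1) (by fun_prop) (by fun_prop)
  have h2 : ∫ s in (0 : ℝ)..t, (C₁ * J.meanGrowth (t - s)) ^ 2 * (M * J.meanGrowth s * n₀) ≤
      C₁ ^ 2 * M * n₀ * (C₂ * J.meanGrowth t ^ 2) := by
    have e : ∀ s, (C₁ * J.meanGrowth (t - s)) ^ 2 * (M * J.meanGrowth s * n₀) =
        (C₁ ^ 2 * M * n₀) * (J.meanGrowth (t - s) ^ 2 * J.meanGrowth s) := fun s => by ring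
    simp only [e]
    rw [intervalIntegral.integral_const_mul]
    gcongr
    exact hI t ht
  have h3 : ∀ x : Fin d → ℕ, total x ^ 2 ≤ 2 * (d : ℝ) ^ 2 *
      (‖expFlow A LinearMap.id t t (natVec x) - expFlow A LinearMap.id t 0 (natVec x₀)‖ ^ 2 +
        (C₁ * J.meanGrowth t * n₀) ^ 2) := by
    intro x
    have e1 : l2norm (compVec x) = ‖expFlow A LinearMap.id t t (natVec x)‖ := by
      rw [norm_expFlow, sub_self, expMap_zero, ofReal_natVec]; rfl
    have e2 : ‖expFlow A LinearMap.id t 0 (natVec x₀)‖ ≤ C₁ * J.meanGrowth t * n₀ := by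
      rw [norm_expFlow, sub_zero, ofReal_natVec]
      exact hK t ht _
    have e3 := norm_le_norm_sub_add (expFlow A LinearMap.id t t (natVec x))
      (expFlow A LinearMap.id t 0 (natVec x₀))
    rw [← e1] at e3
    set y := ‖expFlow A LinearMap.id t t (natVec x) - expFlow A LinearMap.id t 0 (natVec x₀)‖
    have hy : 0 ≤ y := norm_nonneg _
    have e4 : l2norm (compVec x) ≤ y + C₁ * J.meanGrowth t * n₀ := by linarith
    set w := C₁ * J.meanGrowth t * n₀
    calc total x ^ 2 ≤ (d * (y + w)) ^ 2 := by
          have := total_nonneg x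
          gcongr
          refine (total_le_mul_l2norm x).trans ?_
          gcongr
      _ = (d : ℝ) ^ 2 * (y + w) ^ 2 := by ring
      _ ≤ (d : ℝ) ^ 2 * (2 * (y ^ 2 + w ^ 2)) := by gcongr; exact add_sq_le
      _ = _ := by ring
  have := hP.prob t
  have hX : 0 ≤ √(Xi4 ν) := Real.sqrt_nonneg _
  calc ∫ x, total x ^ 2 ∂(P t) ≤ ∫ x, 2 * (d : ℝ) ^ 2 *
        (‖expFlow A LinearMap.id t t (natVec x) - expFlow A LinearMap.id t 0 (natVec x₀)‖ ^ 2 +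
          (C₁ * J.meanGrowth t * n₀) ^ 2) ∂(P t) :=
        integral_mono (hP.integrable_total_sq ha hA1 hA2 ht)
          ((i1.add (integrable_const _)).const_mul _) h3
    _ = 2 * (d : ℝ) ^ 2 * ((∫ x, ‖expFlow A LinearMap.id t t (natVec x) -
          expFlow A LinearMap.id t 0 (natVec x₀)‖ ^ 2 ∂(P t)) + (C₁ * J.meanGrowth t * n₀) ^ 2) := by
        rw [integral_const_mul, integral_add i1 (integrable_const _)]
        simp
    _ ≤ 2 * (d : ℝ) ^ 2 * (α * √(Xi4 ν) * (C₁ ^ 2 * M * n₀ * (C₂ * J.meanGrowth t ^ 2)) +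
          (C₁ * J.meanGrowth t * n₀) ^ 2) := by
        gcongr
        refine h1.trans ?_
        gcongr
    _ = 2 * (d : ℝ) ^ 2 * C₁ ^ 2 * J.meanGrowth t ^ 2 * (α * M * C₂ * √(Xi4 ν) * n₀ + n₀ ^ 2) := by
        ring
    _ ≤ 2 * (d : ℝ) ^ 2 * C₁ ^ 2 * J.meanGrowth t ^ 2 *
          ((α * M * C₂ + 1) * (1 + √(Xi4 ν)) * n₀ ^ 2) := by
        gcongr
        have e5 : α * M * C₂ * √(Xi4 ν) * n₀ ≤ α * M * C₂ * √(Xi4 ν) * n₀ ^ 2 := by gcongr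
        have e6 : 0 ≤ (α * M * C₂ + √(Xi4 ν)) * n₀ ^ 2 := by positivity
        nlinarith
    _ = H * ((1 + √(Xi4 ν)) * n₀ ^ 2 * J.meanGrowth t ^ 2) := by simp only [H]; ring
    _ ≤ (1 + M + H) ^ 2 * ((1 + √(Xi4 ν)) * n₀ ^ 2 * J.meanGrowth t ^ 2) := by
        gcongr
        nlinarith
    _ = _ := by ring

end
end BranchingMoments

/-! ### Fourth moments under a uniform bound on b²K -/

namespace BranchingMoments
noncomputable section

variable {d : ℕ} {A : Matrix (Fin d) (Fin d) ℝ}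

/-- Inserts the moments of |X(s)| into the martingale bound. The constant depends on a, the Jordan
basis and D alone: R, b and T enter only through the two bounds by D. -/
theorem JordanBasis.exists_fourth_moment_bound (J : JordanBasis A) {a : Fin d → ℝ}
    (ha : ∀ i, 0 < a i) (hA : ∀ i j, i ≠ j → 0 ≤ A i j) (h : 0 < perronEigenvalue A) {D : ℝ}
    (hD : 0 < D) :
    ∃ C, 0 < C ∧ ∀ (ν : Fin d → Measure (Fin d → ℤ)), (∀ i, IsProbabilityMeasure (ν i)) →
      AssumptionA1 ν → AssumptionA2 ν → meanMatrix a ν = A →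
      ∀ (x₀ : Fin d → ℕ) (P : ℝ → Measure (Fin d → ℕ)), IsForwardSolution a ν x₀ P →
      ∀ (T : ℝ), 0 ≤ T → ∀ (R : (Fin d → ℂ) →ₗ[ℂ] (Fin d → ℂ)) (b : ℝ → ℝ), Continuous b →
      (∀ s ∈ Set.Icc 0 T, ∀ x, l2norm (R (expMap A (T - s) x)) ≤ b s * l2norm x) →
      (∀ s ∈ Set.Icc 0 T, b s ^ 2 * J.meanGrowth s ≤ D) →
      (∫ s in (0 : ℝ)..T, b s ^ 2 * J.meanGrowth s ≤ D) →
      Integrable (fun x => l2norm (R (compVec x - expMap A T (compVec x₀))) ^ 4) (P T) ∧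
      ∫ x, l2norm (R (compVec x - expMap A T (compVec x₀))) ^ 4 ∂(P T) ≤
        C * (1 + Xi4 ν ^ (3 / 2 : ℝ)) * l2norm (compVec x₀) ^ 2 * min 1 T := by
  obtain ⟨H, hH, hTot⟩ := J.exists_total_bound ha hA h
  have hα : 0 ≤ ∑ i, a i := Finset.sum_nonneg fun i _ => (ha i).le
  set α := ∑ i, a i
  refine ⟨D ^ 2 * (128 * α ^ 2 * H ^ 2 + 6 * α * H + 1), by positivity,
    fun ν hν hA1 hA2 hmean x₀ P hP T hT R b hbc hb hbK hbI => ?_⟩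
  have htot := hTot ν hν hA1 hA2 hmean x₀ P hP
  set n₀ := l2norm (compVec x₀) with hn₀
  have hn0 : 0 ≤ n₀ := l2norm_nonneg _
  have hnsq : n₀ ≤ n₀ ^ 2 := l2norm_compVec_le_sq x₀
  set u := √(Xi4 ν) with hu
  have hu0 : 0 ≤ u := Real.sqrt_nonneg _
  have hXu : Xi4 ν = u ^ 2 := (Real.sq_sqrt Xi4_nonneg).symm
  have hXu3 : Xi4 ν ^ (3 / 2 : ℝ) = u ^ 3 := by
    rw [hXu, ← Real.rpow_natCast u 2, ← Real.rpow_mul hu0, ← Real.rpow_natCast]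
    norm_num
  have hc := J.continuous_meanGrowth
  -- Square root of the factor 1 + √Ξ_4 in the second moment, as Cauchy-Schwarz uses the L² norm of
  -- |X(s)|.
  set g := √(1 + u) with hg
  have hg2 : g ^ 2 = 1 + u := Real.sq_sqrt (by linarith)
  have hg0 : 0 ≤ g := Real.sqrt_nonneg _
  obtain ⟨i1, h1⟩ := hP.integral_norm_pow_four_le ha hA1 hA2 (G := expFlow A R T)
    (by rw [hmean]; exact isBackwardFlow_expFlow A _ T) hT
    (b := b) (m := fun s => H * J.meanGrowth s * n₀)
    (h := fun s => H * g * n₀ * J.meanGrowth s)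
    (fun s hs x => by rw [norm_expFlow]; exact hb s hs _)
    (fun s hs => (htot s hs.1).1)
    (fun s => mul_nonneg (by positivity) (J.meanGrowth_nonneg s))
    (fun s hs => (htot s hs.1).2.trans (le_of_eq (by rw [mul_pow, mul_pow, mul_pow, hg2])))
    hbc (by fun_prop) (by fun_prop)
  have hnorm : ∀ x : Fin d → ℕ, ‖expFlow A R T T (natVec x) - expFlow A R T 0 (natVec x₀)‖ =
      l2norm (R (compVec x - expMap A T (compVec x₀))) := by
    intro x
    change ‖WithLp.toLp 2 (R (expMap A (T - T) fun k => (natVec x k : ℂ))) -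
      WithLp.toLp 2 (R (expMap A (T - 0) fun k => (natVec x₀ k : ℂ)))‖ = _
    rw [sub_self, sub_zero, expMap_zero, ofReal_natVec, ofReal_natVec, ← WithLp.toLp_sub, ← map_sub]
    rfl
  simp only [hnorm] at i1 h1
  refine ⟨i1, h1.trans ?_⟩
  have e1 : ∀ s, b s ^ 2 * (H * g * n₀ * J.meanGrowth s) =
      (H * g * n₀) * (b s ^ 2 * J.meanGrowth s) := fun s => by ring
  have e2 : ∀ s, b s ^ 4 * (H * J.meanGrowth s * n₀) =
      (H * n₀) * (b s ^ 4 * J.meanGrowth s) := fun s => by ring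
  simp only [e1, e2]
  rw [intervalIntegral.integral_const_mul, intervalIntegral.integral_const_mul]
  set I := ∫ s in (0 : ℝ)..T, b s ^ 2 * J.meanGrowth s with hI
  set m := min 1 T with hm
  have hm0 : 0 ≤ m := le_min zero_le_one hT
  have hm1 : m ≤ 1 := min_le_left _ _
  have hI0 : 0 ≤ I := intervalIntegral.integral_nonneg hT fun s _ =>
    mul_nonneg (sq_nonneg _) (J.meanGrowth_nonneg s)
  -- The pointwise bound gives D T, useful for T ≤ 1; the integral bound gives D.
  have hIm : I ≤ D * m := by
    have hIT : I ≤ D * T := by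
      have := intervalIntegral.integral_mono_on hT
        (μ := volume)
        (Continuous.intervalIntegrable (by fun_prop) _ _) (intervalIntegrable_const (c := D)) hbK
      rw [intervalIntegral.integral_const, sub_zero, smul_eq_mul, mul_comm] at this
      exact this
    rcases le_total 1 T with h1T | h1T
    · rw [hm, min_eq_left h1T, mul_one]; exact hbI
    · rw [hm, min_eq_right h1T]; exact hIT
  -- Since K ≥ 1, the pointwise bound also gives b² ≤ D, so b⁴K ≤ D b²K.
  have hI4 : ∫ s in (0 : ℝ)..T, b s ^ 4 * J.meanGrowth s ≤ D * (D * m) := by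
    have : ∫ s in (0 : ℝ)..T, b s ^ 4 * J.meanGrowth s ≤
        ∫ s in (0 : ℝ)..T, D * (b s ^ 2 * J.meanGrowth s) := by
      refine intervalIntegral.integral_mono_on hT (Continuous.intervalIntegrable (by fun_prop) _ _)
        (Continuous.intervalIntegrable (by fun_prop) _ _) fun s hs => ?_
      have hk1 := J.one_le_meanGrowth h hs.1
      have hk0 := J.meanGrowth_nonneg s
      have hle : b s ^ 2 ≤ D :=
        (le_mul_of_one_le_right (sq_nonneg _) hk1).trans (hbK s hs)
      calc b s ^ 4 * J.meanGrowth s = b s ^ 2 * (b s ^ 2 * J.meanGrowth s) := by ring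
        _ ≤ D * (b s ^ 2 * J.meanGrowth s) := by gcongr
    rw [intervalIntegral.integral_const_mul] at this
    exact this.trans (by gcongr)
  have hI2 : I ^ 2 ≤ D ^ 2 * m := by
    calc I ^ 2 ≤ (D * m) ^ 2 := by gcongr
      _ = D ^ 2 * (m * m) := by ring
      _ ≤ D ^ 2 * (m * 1) := by gcongr
      _ = D ^ 2 * m := by ring
  have hu2 : u ^ 2 ≤ 1 + u ^ 3 := by
    rcases le_total u 1 with hu1 | hu1
    · have : u ^ 2 ≤ 1 := pow_le_one₀ hu0 hu1
      have : 0 ≤ u ^ 3 := by positivity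
      linarith
    · have := pow_le_pow_right₀ hu1 (by norm_num : 2 ≤ 3)
      linarith
  -- In terms of u = √Ξ_4 the product is u² + u³; this is the origin of the exponent 3/2.
  have hug : u ^ 2 * g ^ 2 ≤ 2 * (1 + u ^ 3) := by
    rw [hg2]
    linarith
  rw [hXu3, ← hu, hXu]
  calc (α * 8 * u * (H * g * n₀ * I)) ^ 2 +
          6 * α * u ^ 2 * (H * n₀ * ∫ s in (0 : ℝ)..T, b s ^ 4 * J.meanGrowth s)
      = 64 * α ^ 2 * H ^ 2 * (u ^ 2 * g ^ 2) * n₀ ^ 2 * I ^ 2 +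
          6 * α * H * u ^ 2 * n₀ * ∫ s in (0 : ℝ)..T, b s ^ 4 * J.meanGrowth s := by ring
    _ ≤ 64 * α ^ 2 * H ^ 2 * (2 * (1 + u ^ 3)) * n₀ ^ 2 * (D ^ 2 * m) +
          6 * α * H * (1 + u ^ 3) * n₀ ^ 2 * (D * (D * m)) := by
        have hI40 : 0 ≤ ∫ s in (0 : ℝ)..T, b s ^ 4 * J.meanGrowth s :=
          intervalIntegral.integral_nonneg hT fun s _ =>
            mul_nonneg (by positivity) (J.meanGrowth_nonneg s)
        generalize u ^ 2 * g ^ 2 = p at hug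
        gcongr
    _ = D ^ 2 * (128 * α ^ 2 * H ^ 2 + 6 * α * H) * (1 + u ^ 3) * n₀ ^ 2 * m := by ring
    _ ≤ D ^ 2 * (128 * α ^ 2 * H ^ 2 + 6 * α * H + 1) * (1 + u ^ 3) * n₀ ^ 2 * m := by
        have : 0 ≤ D ^ 2 * (1 + u ^ 3) * n₀ ^ 2 * m := by positivity
        linarith

lemma l2norm_add_pow_four_le (u v : Fin d → ℂ) :
    l2norm (u + v) ^ 4 ≤ 8 * (l2norm u ^ 4 + l2norm v ^ 4) := by
  have hu := l2norm_nonneg u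
  have hv := l2norm_nonneg v
  calc l2norm (u + v) ^ 4 ≤ (l2norm u + l2norm v) ^ 4 := by
        have := l2norm_nonneg (u + v)
        gcongr
        exact l2norm_add_le u v
    _ = ((l2norm u + l2norm v) ^ 2) ^ 2 := by ring
    _ ≤ (2 * (l2norm u ^ 2 + l2norm v ^ 2)) ^ 2 := by gcongr; exact add_sq_le
    _ = 4 * (l2norm u ^ 2 + l2norm v ^ 2) ^ 2 := by ring
    _ ≤ 4 * (2 * ((l2norm u ^ 2) ^ 2 + (l2norm v ^ 2) ^ 2)) := by gcongr; exact add_sq_le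
    _ = _ := by ring

universe w

/-- Both moment bounds for the image of the process under a linear map `R` such that
`‖R e^{A (T - s)}‖² (1 + s)^{m₁ - 1} e^{λ₁ s}` is bounded, with bounded integral over `[0, T]`. -/
theorem JordanBasis.exists_fourthMoment_bounds (J : JordanBasis A) {a : Fin d → ℝ}
    (ha : ∀ i, 0 < a i) (hA : ∀ i j, i ≠ j → 0 ≤ A i j) (h : 0 < perronEigenvalue A) {D : ℝ}
    (hD : 0 < D) :
    ∃ C, 0 < C ∧ ∀ (ν : Fin d → Measure (Fin d → ℤ)), (∀ i, IsProbabilityMeasure (ν i)) →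
      AssumptionA1 ν → AssumptionA2 ν → meanMatrix a ν = A →
      ∀ (Ω : Type w) [MeasurableSpace Ω] (μ : Measure Ω) [IsProbabilityMeasure μ]
        (x₀ : Fin d → ℕ) (X : ℝ≥0 → Ω → (Fin d → ℕ)), IsMCBP a ν x₀ μ X →
      ∀ (T : ℝ≥0) (R : (Fin d → ℂ) →ₗ[ℂ] (Fin d → ℂ)) (b : ℝ → ℝ), Continuous b →
      (∀ s ∈ Set.Icc 0 (T : ℝ), ∀ x, l2norm (R (expMap A (T - s) x)) ≤ b s * l2norm x) →
      (∀ s ∈ Set.Icc 0 (T : ℝ), b s ^ 2 * J.meanGrowth s ≤ D) →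
      (∫ s in (0 : ℝ)..T, b s ^ 2 * J.meanGrowth s ≤ D) →
      fourthMoment μ (fun ω => R (compVec (X T ω))) ≤
        ENNReal.ofReal (C * (1 + Xi4 ν ^ (3 / 2 : ℝ)) * l2norm (compVec x₀) ^ 4) ∧
      fourthMoment μ (fun ω => R (compVec (X T ω) - expMap A T (compVec x₀))) ≤
        ENNReal.ofReal (C * (1 + Xi4 ν ^ (3 / 2 : ℝ)) * l2norm (compVec x₀) ^ 2 * min 1 (T : ℝ)) := by
  obtain ⟨C, hC, hbd⟩ := J.exists_fourth_moment_bound ha hA h hD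
  refine ⟨8 * (C + D ^ 2), by positivity,
    fun ν hν hA1 hA2 hmean Ω _ μ _ x₀ X hX T R b hbc hb hbK hbI => ?_⟩
  obtain ⟨hXm, hP⟩ := hX.isForwardSolution hA2
  obtain ⟨i1, h1⟩ := hbd ν hν hA1 hA2 hmean x₀ _ hP T T.coe_nonneg R b hbc hb hbK hbI
  set n₀ := l2norm (compVec x₀) with hn₀
  have hn0 : 0 ≤ n₀ := l2norm_nonneg _
  have hnsq : n₀ ≤ n₀ ^ 2 := l2norm_compVec_le_sq x₀
  have hXi : 0 ≤ Xi4 ν ^ (3 / 2 : ℝ) := Real.rpow_nonneg Xi4_nonneg _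
  have hm0 : 0 ≤ min 1 (T : ℝ) := le_min zero_le_one T.coe_nonneg
  have hm1 : min 1 (T : ℝ) ≤ 1 := min_le_left _ _
  simp only [Real.toNNReal_coe] at i1 h1
  have hprob : IsProbabilityMeasure (μ.map (X T)) := Measure.isProbabilityMeasure_map (hXm T).aemeasurable
  have key : ∀ f : (Fin d → ℕ) → (Fin d → ℂ), Integrable (fun x => l2norm (f x) ^ 4) (μ.map (X T)) →
      fourthMoment μ (fun ω => f (X T ω)) =
        ENNReal.ofReal (∫ x, l2norm (f x) ^ 4 ∂(μ.map (X T))) := by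
    intro f hf
    rw [ofReal_integral_eq_lintegral_ofReal hf (ae_of_all _ fun x => pow_nonneg (norm_nonneg _) 4),
      lintegral_map Measurable.of_discrete (hXm T)]
    rfl
  have hle : ∀ x, l2norm (R (compVec x)) ^ 4 ≤
      8 * (l2norm (R (compVec x - expMap A T (compVec x₀))) ^ 4 + D ^ 2 * n₀ ^ 4) := by
    intro x
    have e : R (compVec x) = R (compVec x - expMap A T (compVec x₀)) +
        R (expMap A T (compVec x₀)) := by rw [← map_add, sub_add_cancel]
    rw [e]
    refine (l2norm_add_pow_four_le _ _).trans ?_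
    gcongr
    -- At s = 0 one has K = 1, so b(0)² ≤ D controls the deterministic part R e^{AT}X(0).
    have h0 : (0 : ℝ) ∈ Set.Icc 0 (T : ℝ) := ⟨le_rfl, T.coe_nonneg⟩
    have h2 := hb 0 h0 (compVec x₀)
    have h3 := hbK 0 h0
    rw [sub_zero] at h2
    simp only [meanGrowth, abs_zero, add_zero, one_pow, mul_zero, Real.exp_zero, mul_one] at h3
    calc l2norm (R (expMap A T (compVec x₀))) ^ 4 ≤ (b 0 * n₀) ^ 4 :=
          pow_le_pow_left₀ (l2norm_nonneg _) h2 4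
      _ = (b 0 ^ 2) ^ 2 * n₀ ^ 4 := by ring
      _ ≤ D ^ 2 * n₀ ^ 4 := by gcongr
  have i2 : Integrable (fun x => 8 * (l2norm (R (compVec x - expMap A T (compVec x₀))) ^ 4 +
      D ^ 2 * n₀ ^ 4)) (μ.map (X T)) := (i1.add (integrable_const _)).const_mul 8
  have i3 : Integrable (fun x => l2norm (R (compVec x)) ^ 4) (μ.map (X T)) :=
    i2.mono' Measurable.of_discrete.aestronglyMeasurable (ae_of_all _ fun x => by
      rw [Real.norm_of_nonneg (pow_nonneg (l2norm_nonneg _) 4)]; exact hle x)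
  rw [key _ i1, key _ i3]
  refine ⟨ENNReal.ofReal_le_ofReal ?_, ENNReal.ofReal_le_ofReal (h1.trans ?_)⟩
  · refine (integral_mono i3 i2 hle).trans ?_
    rw [integral_const_mul, integral_add i1 (integrable_const _)]
    simp only [integral_const, probReal_univ, smul_eq_mul, one_mul]
    have h2 : C * (1 + Xi4 ν ^ (3 / 2 : ℝ)) * n₀ ^ 2 * min 1 (T : ℝ) ≤
        C * (1 + Xi4 ν ^ (3 / 2 : ℝ)) * (n₀ ^ 2) ^ 2 * 1 := by gcongr
    have h3 : D ^ 2 * n₀ ^ 4 ≤ D ^ 2 * (1 + Xi4 ν ^ (3 / 2 : ℝ)) * n₀ ^ 4 := by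
      gcongr
      exact le_mul_of_one_le_right (by positivity) (by linarith)
    calc _ ≤ 8 * (C * (1 + Xi4 ν ^ (3 / 2 : ℝ)) * (n₀ ^ 2) ^ 2 * 1 +
          D ^ 2 * (1 + Xi4 ν ^ (3 / 2 : ℝ)) * n₀ ^ 4) := by
            gcongr
            exact h1.trans h2
      _ = _ := by ring
  · gcongr
    nlinarith [sq_nonneg D]

end
end BranchingMoments

namespace BranchingMoments
noncomputable section

variable {d : ℕ} {A : Matrix (Fin d) (Fin d) ℝ}

/-! ### Bounds on the small, critical and large components of the exponential -/

namespace JordanBasis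

variable (J : JordanBasis A)

lemma map_expMap_blockVec_eq_zero {R : (Fin d → ℂ) →ₗ[ℂ] (Fin d → ℂ)} {b : Fin J.numBlocks}
    (hR : ∀ j, R (J.blockVec b j) = 0) {i : ℕ} (hi : i < J.size b) (r : ℝ) :
    R (expMap A r (J.blockVec b i)) = 0 := by
  rw [J.expMap_blockVec b hi, map_smul, map_sum]
  simp [hR]

/-- Exponential bound for the component of `e^{A r}` in a set `S` of blocks whose eigenvalues
satisfy `Re λ · r ≤ (σ - ε) |r|`. -/
lemma exists_sum_proj_bound (S : Finset (Fin J.numBlocks)) {ε : ℝ} (hε : 0 < ε) :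
    ∃ C, 0 < C ∧ ∀ (σ r : ℝ), (∀ b ∈ S, (J.eig b).re * r ≤ (σ - ε) * |r|) → ∀ x,
      l2norm ((∑ b ∈ S, J.proj b) (expMap A r x)) ≤ C * Real.exp (σ * |r|) * l2norm x := by
  obtain ⟨C, hC, h⟩ := J.exists_basis_bound
  have hM := J.vecBound_nonneg
  obtain ⟨D, hD, hD'⟩ := exists_one_add_pow_le_exp J.totalSize hε
  refine ⟨C * (J.totalSize * J.vecBound * D) + 1, by positivity, fun σ r hr x => ?_⟩
  have hx := l2norm_nonneg x
  have key := h ((∑ b ∈ S, J.proj b) ∘ₗ expMap A r)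
    (J.totalSize * J.vecBound * (D * Real.exp (σ * |r|))) (by positivity) (fun b i hi => ?_) x
  · refine key.trans ?_
    have : 0 ≤ Real.exp (σ * |r|) * l2norm x := by positivity
    linarith
  rw [LinearMap.comp_apply]
  by_cases hb : b ∈ S
  · have h1 := J.l2norm_map_expMap_blockVec_le (∑ b ∈ S, J.proj b) b (q := J.totalSize) hi
      (fun j _ => by rw [sum_proj_blockVec, if_pos hb]; exact J.l2norm_blockVec_le b j)
      (fun k hk hk' => by have := J.size_le_totalSize b; omega) r
    refine h1.trans (mul_le_mul_of_nonneg_left ?_ (by positivity))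
    calc (1 + |r|) ^ J.totalSize * Real.exp ((J.eig b).re * r)
        ≤ D * Real.exp (ε * |r|) * Real.exp ((σ - ε) * |r|) := by
          exact mul_le_mul (hD' _ (abs_nonneg r)) (Real.exp_le_exp.2 (hr b hb))
            (Real.exp_pos _).le (by positivity)
      _ = D * Real.exp (σ * |r|) := by
          rw [mul_assoc, ← Real.exp_add]; congr 2; ring
  · rw [J.map_expMap_blockVec_eq_zero (fun j => by rw [sum_proj_blockVec, if_neg hb]) hi, l2norm_zero]
    positivity

/-- Finitely many blocks leave a uniform gap below λ₁/2. Half of it is spent on the Jordan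
polynomials, the other half is the remaining ε. -/
lemma exists_projSmall_bound : ∃ C ε, 0 < C ∧ 0 < ε ∧ ∀ r : ℝ, 0 ≤ r → ∀ x,
    l2norm (J.projSmall (expMap A r x)) ≤
      C * Real.exp ((perronEigenvalue A / 2 - ε) * r) * l2norm x := by
  classical
  obtain ⟨ε, hε, hε'⟩ := exists_pos_le_of_finite
    (f := fun b => if (J.eig b).re < perronEigenvalue A / 2 then
      perronEigenvalue A / 2 - (J.eig b).re else 1) (fun b => by
        split_ifs with hb
        · exact sub_pos.2 hb
        · exact one_pos)
  obtain ⟨C, hC, h⟩ := J.exists_sum_proj_bound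
    (Finset.univ.filter fun b => (J.eig b).re < perronEigenvalue A / 2) (half_pos hε)
  refine ⟨C, ε / 2, hC, half_pos hε, fun r hr x => ?_⟩
  have h1 := h (perronEigenvalue A / 2 - ε / 2) r (fun b hb => ?_) x
  · rw [abs_of_nonneg hr] at h1
    unfold projSmall
    convert h1
  · have hb' : (J.eig b).re < perronEigenvalue A / 2 := by simpa using hb
    have h2 := hε' b
    simp only [hb', if_true] at h2
    rw [abs_of_nonneg hr]
    gcongr
    linarith

lemma exists_projLarge_bound : ∃ C ε, 0 < C ∧ 0 < ε ∧ ∀ r : ℝ, 0 ≤ r → ∀ x,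
    l2norm (J.projLarge (expMap A (-r) x)) ≤
      C * Real.exp (-(perronEigenvalue A / 2 + ε) * r) * l2norm x := by
  classical
  obtain ⟨ε, hε, hε'⟩ := exists_pos_le_of_finite
    (f := fun b => if perronEigenvalue A / 2 < (J.eig b).re then
      (J.eig b).re - perronEigenvalue A / 2 else 1) (fun b => by
        split_ifs with hb
        · exact sub_pos.2 hb
        · exact one_pos)
  obtain ⟨C, hC, h⟩ := J.exists_sum_proj_bound
    (Finset.univ.filter fun b => perronEigenvalue A / 2 < (J.eig b).re) (half_pos hε)
  refine ⟨C, ε / 2, hC, half_pos hε, fun r hr x => ?_⟩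
  have h1 := h (-(perronEigenvalue A / 2 + ε / 2)) (-r) (fun b hb => ?_) x
  · rw [abs_neg, abs_of_nonneg hr] at h1
    unfold projLarge
    convert h1
  · have hb' : perronEigenvalue A / 2 < (J.eig b).re := by simpa using hb
    have h2 := hε' b
    simp only [hb', if_true] at h2
    rw [abs_neg, abs_of_nonneg hr, mul_neg, ← neg_mul]
    gcongr
    linarith

/-- In a block of size m the map N_A^{m-κ} already uses up m - κ places, so at most κ - 1 further
shifts by the exponential survive and the polynomial has degree κ - 1. -/
lemma exists_nil_pow_proj_bound : ∃ C, 0 < C ∧ ∀ b : Fin J.numBlocks,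
    ∀ κ : ℕ, 1 ≤ κ → κ ≤ J.size b → ∀ r : ℝ, 0 ≤ r → ∀ x,
    l2norm ((J.nil ^ (J.size b - κ)) (J.proj b (expMap A r x))) ≤
      C * ((1 + r) ^ (κ - 1) * Real.exp ((J.eig b).re * r)) * l2norm x := by
  obtain ⟨C, hC, h⟩ := J.exists_basis_bound
  have hM := J.vecBound_nonneg
  refine ⟨C * (J.totalSize * J.vecBound) + 1, by positivity, fun b κ hκ hκ' r hr x => ?_⟩
  have hx := l2norm_nonneg x
  let R : (Fin d → ℂ) →ₗ[ℂ] (Fin d → ℂ) := (J.nil ^ (J.size b - κ)) ∘ₗ J.proj b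
  have hRb : ∀ j, j < J.size b → R (J.blockVec b j) =
      if J.size b - κ ≤ j then J.blockVec b (j - (J.size b - κ)) else 0 := fun j hj => by
    simp only [R, LinearMap.comp_apply]
    rw [proj_blockVec, if_pos rfl, nil_pow_blockVec _ _ _ _ hj]
  have key := h (R ∘ₗ expMap A r)
    (J.totalSize * J.vecBound * ((1 + r) ^ (κ - 1) * Real.exp ((J.eig b).re * r))) (by positivity)
    (fun b' i hi => ?_) x
  · refine key.trans ?_
    have : 0 ≤ (1 + r) ^ (κ - 1) * Real.exp ((J.eig b).re * r) * l2norm x := by positivity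
    linarith
  rw [LinearMap.comp_apply]
  by_cases hb : b' = b
  · subst hb
    have h1 := J.l2norm_map_expMap_blockVec_le R b' (q := κ - 1) hi
      (fun j hj => by
        rw [hRb j (by omega)]
        split_ifs
        · exact J.l2norm_blockVec_le _ _
        · rw [l2norm_zero]; exact hM)
      (fun k hk hk' => by rw [hRb _ (by omega), if_neg (by omega)]) r
    rwa [abs_of_nonneg hr] at h1
  · rw [J.map_expMap_blockVec_eq_zero (fun j => ?_) hi, l2norm_zero]
    · positivity
    · simp only [R, LinearMap.comp_apply]
      rw [proj_blockVec, if_neg hb, LinearMap.map_zero]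

end JordanBasis

lemma norm_normaliser_sq (q : ℕ) (c : ℝ) {T : ℝ} (hT : 0 ≤ T) :
    ‖normaliser q c T‖ ^ 2 = ((1 + T) ^ q)⁻¹ * Real.exp (-(c * T)) := by
  have h1 : 0 ≤ 1 + T := by linarith
  rw [normaliser, Complex.norm_real, Real.norm_eq_abs, sq_abs, mul_pow, ← Real.exp_nat_mul,
    ← Real.rpow_natCast, ← Real.rpow_mul h1]
  congr 1
  · rw [← Real.rpow_natCast, ← Real.rpow_neg h1]
    congr 1
    push_cast
    ring
  · congr 1
    push_cast
    ring

lemma meanMatrix_nonneg {a : Fin d → ℝ} (ha : ∀ i, 0 < a i) {ν : Fin d → Measure (Fin d → ℤ)}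
    (hA2 : AssumptionA2 ν) {i j : Fin d} (hij : i ≠ j) : 0 ≤ meanMatrix a ν i j := by
  refine mul_nonneg (ha j).le (integral_nonneg_of_ae ?_)
  filter_upwards [hA2 j] with z hz
  simpa using hz.2 i hij

end
end BranchingMoments

namespace BranchingMoments

variable {d : ℕ} {A : Matrix (Fin d) (Fin d) ℝ} (J : JordanBasis A)

/-! ### Verification of the conditions for the three kinds of components -/

/-- The normaliser cancels the polynomial of K(s) because s ≤ T, and the exponents -λ₁T + (λ₁ -
2ε)(T - s) + λ₁s leave exactly -2ε(T - s). -/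
lemma JordanBasis.small_conditions (hm : 1 ≤ J.m1) {C ε : ℝ} (hε : 0 < ε)
    {T : ℝ} (hT : 0 ≤ T) {b : ℝ → ℝ}
    (hb : ∀ s, b s = ‖normaliser ((J.m1 : ℝ) - 1) (perronEigenvalue A) T‖ *
      (C * Real.exp ((perronEigenvalue A / 2 - ε) * (T - s)))) :
    (∀ s ∈ Set.Icc 0 T, b s ^ 2 * J.meanGrowth s ≤ C ^ 2) ∧
      ∫ s in (0 : ℝ)..T, b s ^ 2 * J.meanGrowth s ≤ C ^ 2 * (1 / (2 * ε)) := by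
  have hc := J.continuous_meanGrowth
  have hq : (J.m1 : ℝ) - 1 = ((J.m1 - 1 : ℕ) : ℝ) := by push_cast [hm]; ring
  have hle : ∀ s ∈ Set.Icc 0 T, b s ^ 2 * J.meanGrowth s ≤
      C ^ 2 * Real.exp (-(2 * ε * (T - s))) := by
    intro s hs
    have hs0 := hs.1
    have hT1 : 0 < (1 + T) ^ (J.m1 - 1) := by positivity
    rw [hb, mul_pow, hq, norm_normaliser_sq _ _ hT, mul_pow, JordanBasis.meanGrowth,
      abs_of_nonneg hs.1, ← Real.exp_nat_mul]
    set p := perronEigenvalue A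
    have e1 : Real.exp (-(p * T)) * Real.exp ((2 : ℕ) * ((p / 2 - ε) * (T - s))) * Real.exp (p * s) =
        Real.exp (-(2 * ε * (T - s))) := by
      rw [← Real.exp_add, ← Real.exp_add]
      congr 1
      push_cast
      ring
    have e2 : ((1 + T) ^ (J.m1 - 1))⁻¹ * (1 + s) ^ (J.m1 - 1) ≤ 1 := by
      rw [inv_mul_le_iff₀ hT1, mul_one]
      have := hs.2
      gcongr
    calc ((1 + T) ^ (J.m1 - 1))⁻¹ * Real.exp (-(p * T)) *
            (C ^ 2 * Real.exp ((2 : ℕ) * ((p / 2 - ε) * (T - s)))) *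
            ((1 + s) ^ (J.m1 - 1) * Real.exp (p * s))
        = (((1 + T) ^ (J.m1 - 1))⁻¹ * (1 + s) ^ (J.m1 - 1)) * (C ^ 2 *
            (Real.exp (-(p * T)) * Real.exp ((2 : ℕ) * ((p / 2 - ε) * (T - s))) *
              Real.exp (p * s))) := by ring
      _ ≤ 1 * (C ^ 2 * (Real.exp (-(p * T)) * Real.exp ((2 : ℕ) * ((p / 2 - ε) * (T - s))) *
              Real.exp (p * s))) := by gcongr
      _ = _ := by rw [e1, one_mul]
  have hbc : Continuous b := by
    rw [funext hb]
    fun_prop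
  refine ⟨fun s hs => (hle s hs).trans ?_, ?_⟩
  · refine mul_le_of_le_one_right (sq_nonneg C) (Real.exp_le_one_iff.2 ?_)
    have : 0 ≤ T - s := sub_nonneg.2 hs.2
    have : 0 ≤ 2 * ε * (T - s) := by positivity
    linarith
  · calc ∫ s in (0 : ℝ)..T, b s ^ 2 * J.meanGrowth s
        ≤ ∫ s in (0 : ℝ)..T, C ^ 2 * Real.exp (-(2 * ε * (T - s))) :=
          intervalIntegral.integral_mono_on hT (Continuous.intervalIntegrable (by fun_prop) _ _)
            (Continuous.intervalIntegrable (by fun_prop) _ _) hle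
      _ = C ^ 2 * ∫ s in (0 : ℝ)..T, Real.exp (-(2 * ε * s)) := by
          rw [intervalIntegral.integral_const_mul,
            intervalIntegral.integral_comp_sub_left (fun s => Real.exp (-(2 * ε * s)))]
          simp
      _ ≤ C ^ 2 * (1 / (2 * ε)) := by
          gcongr
          exact integral_exp_neg_mul_le (by positivity) T

/-- Here the exponentials cancel completely. The polynomials have total degree m₁ - 1 + 2(κ - 1),
one less than the power in the normaliser; the spare factor 1/(1+T) pays for integrating over [0,T].
-/
lemma JordanBasis.critical_conditions (hm : 1 ≤ J.m1) {κ : ℕ} (hκ : 1 ≤ κ) {C : ℝ} {T : ℝ}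
    (hT : 0 ≤ T) {b : ℝ → ℝ}
    (hb : ∀ s, b s = ‖normaliser ((J.m1 : ℝ) + 2 * κ - 2) (perronEigenvalue A) T‖ *
      (C * ((1 + |T - s|) ^ (κ - 1) * Real.exp (perronEigenvalue A / 2 * (T - s))))) :
    (∀ s ∈ Set.Icc 0 T, b s ^ 2 * J.meanGrowth s ≤ C ^ 2) ∧
      ∫ s in (0 : ℝ)..T, b s ^ 2 * J.meanGrowth s ≤ C ^ 2 := by
  have hc := J.continuous_meanGrowth
  have hq : (J.m1 : ℝ) + 2 * κ - 2 = ((J.m1 - 1 + 2 * (κ - 1) + 1 : ℕ) : ℝ) := by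
    push_cast [hm, hκ]; ring
  have hT1 : 0 < 1 + T := by linarith
  have hle : ∀ s ∈ Set.Icc 0 T, b s ^ 2 * J.meanGrowth s ≤ C ^ 2 * (1 + T)⁻¹ := by
    intro s hs
    have hs0 := hs.1
    have hTs : 0 ≤ T - s := sub_nonneg.2 hs.2
    rw [hb, mul_pow, hq, norm_normaliser_sq _ _ hT, mul_pow, mul_pow, JordanBasis.meanGrowth,
      abs_of_nonneg hs.1, abs_of_nonneg hTs, ← Real.exp_nat_mul]
    set p := perronEigenvalue A
    have e1 : Real.exp (-(p * T)) * Real.exp ((2 : ℕ) * (p / 2 * (T - s))) * Real.exp (p * s) = 1 := by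
      rw [← Real.exp_add, ← Real.exp_add, Real.exp_eq_one_iff]
      push_cast
      ring
    have e2 : ((1 + T) ^ (J.m1 - 1 + 2 * (κ - 1) + 1))⁻¹ *
        ((1 + s) ^ (J.m1 - 1) * ((1 + (T - s)) ^ (κ - 1)) ^ 2) ≤ (1 + T)⁻¹ := by
      rw [inv_mul_le_iff₀ (by positivity)]
      have hs2 := hs.2
      calc (1 + s) ^ (J.m1 - 1) * ((1 + (T - s)) ^ (κ - 1)) ^ 2
          ≤ (1 + T) ^ (J.m1 - 1) * ((1 + T) ^ (κ - 1)) ^ 2 := by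
            gcongr
            linarith
        _ = (1 + T) ^ (J.m1 - 1 + 2 * (κ - 1) + 1) * (1 + T)⁻¹ := by
            rw [pow_succ (1 + T) (J.m1 - 1 + 2 * (κ - 1)), mul_inv_cancel_right₀ hT1.ne', pow_add, mul_comm 2, pow_mul]
    calc ((1 + T) ^ (J.m1 - 1 + 2 * (κ - 1) + 1))⁻¹ * Real.exp (-(p * T)) *
            (C ^ 2 * (((1 + (T - s)) ^ (κ - 1)) ^ 2 * Real.exp ((2 : ℕ) * (p / 2 * (T - s))))) *
            ((1 + s) ^ (J.m1 - 1) * Real.exp (p * s))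
        = C ^ 2 * (((1 + T) ^ (J.m1 - 1 + 2 * (κ - 1) + 1))⁻¹ *
            ((1 + s) ^ (J.m1 - 1) * ((1 + (T - s)) ^ (κ - 1)) ^ 2)) *
            (Real.exp (-(p * T)) * Real.exp ((2 : ℕ) * (p / 2 * (T - s))) * Real.exp (p * s)) := by
          ring
      _ ≤ C ^ 2 * (1 + T)⁻¹ := by
          rw [e1, mul_one]
          gcongr
  have hbc : Continuous b := by
    rw [funext hb]
    fun_prop
  refine ⟨fun s hs => (hle s hs).trans ?_, ?_⟩
  · exact mul_le_of_le_one_right (sq_nonneg C) (inv_le_one_of_one_le₀ (by linarith))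
  · calc ∫ s in (0 : ℝ)..T, b s ^ 2 * J.meanGrowth s
        ≤ ∫ s in (0 : ℝ)..T, C ^ 2 * (1 + T)⁻¹ :=
          intervalIntegral.integral_mono_on hT (Continuous.intervalIntegrable (by fun_prop) _ _)
            (Continuous.intervalIntegrable (by fun_prop) _ _) hle
      _ = C ^ 2 * ((1 + T)⁻¹ * T) := by
          rw [intervalIntegral.integral_const, smul_eq_mul]; ring
      _ ≤ C ^ 2 := by
          refine mul_le_of_le_one_right (sq_nonneg C) ?_
          rw [inv_mul_le_iff₀ hT1]
          linarith

/-- The product decays like (1+s)^{m₁-1} e^{-2εs}; half of the decay absorbs the polynomial. No time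
normalisation is needed, as b does not depend on T. -/
lemma JordanBasis.large_conditions {C ε : ℝ} (hε : 0 < ε) :
    ∃ D, 0 < D ∧ ∀ T : ℝ, 0 ≤ T → ∀ b : ℝ → ℝ,
      (∀ s, b s = C * Real.exp (-(perronEigenvalue A / 2 + ε) * s)) →
      (∀ s ∈ Set.Icc 0 T, b s ^ 2 * J.meanGrowth s ≤ D) ∧
        ∫ s in (0 : ℝ)..T, b s ^ 2 * J.meanGrowth s ≤ D := by
  obtain ⟨D, hD, hD'⟩ := exists_one_add_pow_le_exp (J.m1 - 1) hε
  have hc := J.continuous_meanGrowth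
  refine ⟨C ^ 2 * D * (1 + 1 / ε) + 1, by positivity, fun T hT b hb => ?_⟩
  have hCD : 0 ≤ C ^ 2 * D := by positivity
  have hε1 : 0 < 1 / ε := by positivity
  have hCDε : 0 ≤ C ^ 2 * D * (1 / ε) := by positivity
  have hle : ∀ s ∈ Set.Icc 0 T, b s ^ 2 * J.meanGrowth s ≤ C ^ 2 * D * Real.exp (-(ε * s)) := by
    intro s hs
    rw [hb, mul_pow, JordanBasis.meanGrowth, abs_of_nonneg hs.1, ← Real.exp_nat_mul]
    set p := perronEigenvalue A
    have e1 : Real.exp ((2 : ℕ) * (-(p / 2 + ε) * s)) * Real.exp (ε * s) * Real.exp (p * s) =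
        Real.exp (-(ε * s)) := by
      rw [← Real.exp_add, ← Real.exp_add]
      congr 1
      push_cast
      ring
    calc C ^ 2 * Real.exp ((2 : ℕ) * (-(p / 2 + ε) * s)) *
            ((1 + s) ^ (J.m1 - 1) * Real.exp (p * s))
        ≤ C ^ 2 * Real.exp ((2 : ℕ) * (-(p / 2 + ε) * s)) *
            (D * Real.exp (ε * s) * Real.exp (p * s)) := by
          gcongr
          exact hD' s hs.1
      _ = C ^ 2 * D * (Real.exp ((2 : ℕ) * (-(p / 2 + ε) * s)) * Real.exp (ε * s) *
            Real.exp (p * s)) := by ring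
      _ = _ := by rw [e1]
  have hbc : Continuous b := by
    rw [funext hb]
    fun_prop
  refine ⟨fun s hs => (hle s hs).trans ?_, ?_⟩
  · have h1 : Real.exp (-(ε * s)) ≤ 1 := Real.exp_le_one_iff.2 (by
      have := mul_nonneg hε.le hs.1
      linarith)
    have := mul_le_of_le_one_right hCD h1
    linarith
  · have h1 : ∫ s in (0 : ℝ)..T, b s ^ 2 * J.meanGrowth s ≤ C ^ 2 * D * (1 / ε) := by
      calc ∫ s in (0 : ℝ)..T, b s ^ 2 * J.meanGrowth s
          ≤ ∫ s in (0 : ℝ)..T, C ^ 2 * D * Real.exp (-(ε * s)) :=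
            intervalIntegral.integral_mono_on hT (Continuous.intervalIntegrable (by fun_prop) _ _)
              (Continuous.intervalIntegrable (by fun_prop) _ _) hle
        _ = C ^ 2 * D * ∫ s in (0 : ℝ)..T, Real.exp (-(ε * s)) :=
            intervalIntegral.integral_const_mul _ _
        _ ≤ C ^ 2 * D * (1 / ε) := by
            gcongr
            exact integral_exp_neg_mul_le hε T
    linarith

end BranchingMoments

/-! ### Assembly of the three kinds of components -/

theorem mainTheorem6 {d : ℕ} (a : Fin d → ℝ) (ha : ∀ i, 0 < a i)
    (A : Matrix (Fin d) (Fin d) ℝ) (hA3 : 0 < perronEigenvalue A) (J : JordanBasis A) :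
    ∃ C : ℝ, 0 < C ∧
      ∀ (ν : Fin d → Measure (Fin d → ℤ)), (∀ i, IsProbabilityMeasure (ν i)) →
        AssumptionA1 ν → AssumptionA2 ν → meanMatrix a ν = A →
      ∀ (Ω : Type*) [MeasurableSpace Ω] (μ : Measure Ω) [IsProbabilityMeasure μ]
        (x₀ : Fin d → ℕ) (X : ℝ≥0 → Ω → (Fin d → ℕ)), IsMCBP a ν x₀ μ X →
      ∀ t : ℝ≥0,
        -- small components
        (fourthMoment μ (fun ω =>
            normaliser ((J.m1 : ℝ) - 1) (perronEigenvalue A) t •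
              J.projSmall (compVec (X t ω)))
          ≤ ENNReal.ofReal (C * (1 + Xi4 ν ^ (3 / 2 : ℝ)) * l2norm (compVec x₀) ^ 4) ∧
        fourthMoment μ (fun ω =>
            normaliser ((J.m1 : ℝ) - 1) (perronEigenvalue A) t •
              J.projSmall (compVec (X t ω) - expMap A t (compVec x₀)))
          ≤ ENNReal.ofReal
              (C * (1 + Xi4 ν ^ (3 / 2 : ℝ)) * l2norm (compVec x₀) ^ 2 * min 1 (t : ℝ))) ∧
        -- critical components
        (∀ b : Fin J.numBlocks, (J.eig b).re = perronEigenvalue A / 2 →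
          ∀ κ : ℕ, 1 ≤ κ → κ ≤ J.size b →
          fourthMoment μ (fun ω =>
              normaliser ((J.m1 : ℝ) + 2 * κ - 2) (perronEigenvalue A) t •
                (J.nil ^ (J.size b - κ)) (J.proj b (compVec (X t ω))))
            ≤ ENNReal.ofReal (C * (1 + Xi4 ν ^ (3 / 2 : ℝ)) * l2norm (compVec x₀) ^ 4) ∧
          fourthMoment μ (fun ω =>
              normaliser ((J.m1 : ℝ) + 2 * κ - 2) (perronEigenvalue A) t •
                (J.nil ^ (J.size b - κ))
                  (J.proj b (compVec (X t ω) - expMap A t (compVec x₀))))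
            ≤ ENNReal.ofReal
                (C * (1 + Xi4 ν ^ (3 / 2 : ℝ)) * l2norm (compVec x₀) ^ 2 * min 1 (t : ℝ))) ∧
        -- large components
        (fourthMoment μ (fun ω => J.projLarge (expMap A (-(t : ℝ)) (compVec (X t ω))))
          ≤ ENNReal.ofReal (C * (1 + Xi4 ν ^ (3 / 2 : ℝ)) * l2norm (compVec x₀) ^ 4) ∧
        fourthMoment μ (fun ω =>
            J.projLarge (expMap A (-(t : ℝ)) (compVec (X t ω)) - compVec x₀))
          ≤ ENNReal.ofReal
              (C * (1 + Xi4 ν ^ (3 / 2 : ℝ)) * l2norm (compVec x₀) ^ 2 * min 1 (t : ℝ))) := by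
  -- By (A2) a mean matrix has nonnegative off-diagonal entries; for any other A no ν is admissible
  -- and the claim is vacuous.
  by_cases hA : ∀ i j, i ≠ j → 0 ≤ A i j
  swap
  · refine ⟨1, one_pos, fun ν _ _ hA2 hmean => ?_⟩
    exact absurd (fun i j hij => hmean ▸ meanMatrix_nonneg ha hA2 hij) hA
  have hm := J.one_le_m1 hA hA3
  obtain ⟨C₁, ε₁, hC₁, hε₁, hs⟩ := J.exists_projSmall_bound
  obtain ⟨C₂, hC₂, hcr⟩ := J.exists_nil_pow_proj_bound
  obtain ⟨C₃, ε₃, hC₃, hε₃, hl⟩ := J.exists_projLarge_bound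
  obtain ⟨D₃, hD₃, hlarge⟩ := J.large_conditions (C := C₃) hε₃
  have hD₁ : 0 < C₁ ^ 2 * (1 / (2 * ε₁)) := by positivity
  have hD₁' : 0 < C₁ ^ 2 := by positivity
  have hD₂ : 0 < C₂ ^ 2 := by positivity
  obtain ⟨C, hC, key⟩ := J.exists_fourthMoment_bounds ha hA hA3
    (D := C₁ ^ 2 + C₁ ^ 2 * (1 / (2 * ε₁)) + C₂ ^ 2 + D₃) (by positivity)
  refine ⟨C, hC, fun ν hν hA1 hA2 hmean Ω _ μ _ x₀ X hX t => ?_⟩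
  have main := key ν hν hA1 hA2 hmean Ω μ x₀ X hX t
  have ht : (0 : ℝ) ≤ t := t.coe_nonneg
  refine ⟨?_, fun b hb κ hκ hκ' => ?_, ?_⟩
  · obtain ⟨h1, h2⟩ := J.small_conditions hm (C := C₁) hε₁ ht (fun _ => rfl)
    refine main (normaliser ((J.m1 : ℝ) - 1) (perronEigenvalue A) t • J.projSmall) _
      (by fun_prop) (fun s hs' x => ?_) (fun s hs' => (h1 s hs').trans (by linarith))
      (h2.trans (by linarith))
    rw [LinearMap.smul_apply, l2norm_smul, mul_assoc]
    gcongr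
    exact hs _ (sub_nonneg.2 hs'.2) x
  · obtain ⟨h1, h2⟩ := J.critical_conditions hm hκ (C := C₂) ht (fun _ => rfl)
    refine main (normaliser ((J.m1 : ℝ) + 2 * κ - 2) (perronEigenvalue A) t •
      ((J.nil ^ (J.size b - κ)) ∘ₗ J.proj b)) _
      (by fun_prop) (fun s hs' x => ?_) (fun s hs' => (h1 s hs').trans (by linarith))
      (h2.trans (by linarith))
    have hts := sub_nonneg.2 hs'.2
    rw [LinearMap.smul_apply, l2norm_smul, mul_assoc, abs_of_nonneg hts, ← hb]
    gcongr
    exact hcr b κ hκ hκ' _ hts x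
  · obtain ⟨h1, h2⟩ := hlarge t ht _ (fun _ => rfl)
    have h3 := main (J.projLarge ∘ₗ expMap A (-(t : ℝ))) _
      (by fun_prop) (fun s hs' x => ?_) (fun s hs' => (h1 s hs').trans (by linarith))
      (h2.trans (by linarith))
    · have e : ∀ y, (J.projLarge ∘ₗ expMap A (-(t : ℝ))) (y - expMap A t (compVec x₀)) =
          J.projLarge (expMap A (-(t : ℝ)) y - compVec x₀) := fun y => by
        rw [LinearMap.comp_apply, map_sub (expMap A _), ← expMap_add, neg_add_cancel, expMap_zero]
      simp only [e] at h3
      exact h3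
    -- With R = P_ℓ e^{-At} the flow R e^{A(t-s)} is P_ℓ e^{-As}, whose bound decays in s whatever t
    -- is.
    · rw [LinearMap.comp_apply, ← expMap_add]
      have e : -(t : ℝ) + (t - s) = -s := by ring
      rw [e]
      exact hl s hs'.1 x
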